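/- Notation. Let $\mathcal O$ be the ring of holomorphic functions on $\mathbb C^n$ and let $D=\{\Delta=0\}\subseteq\mathbb C^n$ be a reduced divisor with global defining equation $\Delta\in\mathcal O$ (that is, $\Delta\neq0$ and every $f\in\mathcal O$ vanishing on $D$ is divisible by $\Delta$). Let $\Gamma(\mathbb C^n,\mathrm{Der}(-\log D))$ be the $\mathcal O$-module of holomorphic vector fields $\delta$ on $\mathbb C^n$ with $\delta(\Delta)\in\mathcal O\cdot\Delta$, and let $\Gamma(\mathbb C^n,\Omega^\bullet(\log D))$ be the complex (with the exterior derivative $d$) of holomorphic forms $\omega$ on $\mathbb C^n\setminus D$ such that $\Delta\omega$ and $\Delta\,d\omega$ extend to holomorphic forms on $\mathbb C^n$. Call $D$ a linear free divisor if $\Gamma(\mathbb C^n,\mathrm{Der}(-\log D))$ has an $\mathcal O$-basis $\delta_1,\dots,\delta_n$ whose members have linear coefficients with respect to $\partial_1,\dots,\partial_n$. Let $L_D$ be the Lie algebra of all $xA\partial^t=\sum_{i,j}x_ia_{ij}\partial_j\in\Gamma(\mathbb C^n,\mathrm{Der}(-\log D))$, $A=(a_{ij})\in\mathbb C^{n\times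 n}$. Let $G_D=\{A\in GL_n(\mathbb C)\mid A(D)=D\}$, with identity component $G_D^\circ$ and Lie algebra $\mathfrak g_D$. Let $H^*_A(L;\mathbb C)$ be the Lie algebra (Chevalley–Eilenberg) cohomology with trivial coefficients $\mathbb C$, and $H^*(X;\mathbb C)$ the singular cohomology of a topological space $X$. One says that the global logarithmic comparison theorem (GLCT) holds for $D$ if $H^*(\Gamma(\mathbb C^n,\Omega^\bullet(\log D)))\cong H^*(\mathbb C^n\setminus D;\mathbb C)$ as graded vector spaces. Statement. Let $D\subseteq\mathbb C^n$ be a linear free divisor. Then: (1) The inclusion of the subcomplex $\Gamma(\mathbb C^n,\Omega^\bullet(\log D))_0$ of forms that are homogeneous of degree $0$ (with $\deg x_i=\deg dx_i=1$) into $\Gamma(\mathbb C^n,\Omega^\bullet(\log D))$ is a quasi-isomorphism. (2) For $\omega\in\Gamma(\mathbb C^n,\Omega^k(\log D))_0$ and $\chi_1,\dots,\chi_k\in L_D$ the function $\omega(\chi_1,\dots,\chi_k)$ is constant on $\mathbb C^n\setminus D$, and sending $\omega$ to $(\chi_1,\dots,\chi_k)\mapsto\omega(\chi_1,\dots,\chi_k)$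 is an isomorphism of complexes from $\Gamma(\mathbb C^n,\Omega^\bullet(\log D))_0$ to the Chevalley–Eilenberg complex of $L_D$ with coefficients in $\mathbb C$. (3) $H^k(\Gamma(\mathbb C^n,\Omega^\bullet(\log D)))\cong H^k_A(L_D;\mathbb C)$ for every $k\ge 0$. (4) GLCT holds for $D$ if and only if $H^k(G_D^\circ;\mathbb C)\cong H^k_A(\mathfrak g_D;\mathbb C)$ for every $k\ge0$. -/

import Mathlib

open CategoryTheory

attribute [local instance] LieRing.ofAssociativeRing

noncomputable section

namespace LFD

section ChevalleyEilenberg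

variable (L : Type) [LieRing L] [LieAlgebra ℂ L]

/-- Contraction of an alternating form with `x` in the first slot. -/
abbrev ceInsert {L : Type} [LieRing L] [LieAlgebra ℂ L] {m : ℕ} (x : L) (ω : L [⋀^Fin (m + 1)]→ₗ[ℂ] ℂ) :
    L [⋀^Fin m]→ₗ[ℂ] ℂ := ω.curryLeft x

/-- Auxiliary form of the differential below, used only to see that it is alternating. -/
def ceDiffAux (m : ℕ) (ω : L [⋀^Fin (m + 1)]→ₗ[ℂ] ℂ) : L [⋀^Fin (m + 2)]→ₗ[ℂ] ℂ :=
  -(1 / 2 : ℂ) • AlternatingMap.alternatizeUncurryFin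
    (AlternatingMap.alternatizeUncurryFinLM ∘ₗ
      LinearMap.mk₂ ℂ (fun x y : L => ω.curryLeft ⁅x, y⁆) (by simp) (by simp) (by simp) (by simp))

theorem ceDiffAux_apply (m : ℕ) (ω : L [⋀^Fin (m + 1)]→ₗ[ℂ] ℂ) (v : Fin (m + 2) → L) :
    ceDiffAux L m ω v = -∑ i : Fin (m + 1), ∑ j ≥ i, (-1) ^ (i + j : ℕ) *
      ω (Matrix.vecCons ⁅v i.castSucc, v j.succ⁆ (j.removeNth (i.castSucc.removeNth v))) := by
  simp only [ceDiffAux, AlternatingMap.smul_apply]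
  rw [AlternatingMap.alternatizeUncurryFin_alternatizeUncurryFinLM_comp_apply]
  rw [neg_smul, Finset.smul_sum]
  congr 1
  refine Finset.sum_congr rfl fun i _ => ?_
  rw [Finset.smul_sum]
  refine Finset.sum_congr rfl fun j _ => ?_
  have h : ⁅v j.succ, v i.castSucc⁆ = -⁅v i.castSucc, v j.succ⁆ := (lie_skew _ _).symm
  simp only [LinearMap.mk₂_apply, h, map_neg,
    AlternatingMap.neg_apply, AlternatingMap.curryLeft_apply_apply]
  simp only [zsmul_eq_mul, smul_eq_mul]
  push_cast
  ring

/-- The Chevalley--Eilenberg differential (trivial coefficients) in degree `m + 1`: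
`(d ω)(v₀, …, v_{m+1}) = ∑_{a < b} (-1)^(a+b) ω([v_a, v_b], v₀, …, v̂_a, …, v̂_b, …, v_{m+1})`.
The pairs `a < b` are encoded as `a = i.castSucc`, `b = j.succ` with `i ≤ j`, so that
`(-1)^(a+b) = -(-1)^(i+j)`. -/
def ceDiffSucc (m : ℕ) (ω : L [⋀^Fin (m + 1)]→ₗ[ℂ] ℂ) : L [⋀^Fin (m + 2)]→ₗ[ℂ] ℂ where
  toFun v := -∑ i : Fin (m + 1), ∑ j ≥ i, (-1) ^ (i + j : ℕ) *
    ω (Matrix.vecCons ⁅v i.castSucc, v j.succ⁆ (j.removeNth (i.castSucc.removeNth v)))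
  map_update_add' v i x y := by
    have := Subsingleton.elim (‹DecidableEq (Fin (m + 2))›) (instDecidableEqFin _)
    subst this
    simpa only [ceDiffAux_apply] using (ceDiffAux L m ω).map_update_add v i x y
  map_update_smul' v i c x := by
    have := Subsingleton.elim (‹DecidableEq (Fin (m + 2))›) (instDecidableEqFin _)
    subst this
    simpa only [ceDiffAux_apply] using (ceDiffAux L m ω).map_update_smul v i c x
  map_eq_zero_of_eq' v i j h hij := by
    simpa only [ceDiffAux_apply] using (ceDiffAux L m ω).map_eq_zero_of_eq v h hij

theorem ceDiffSucc_apply (m : ℕ) (ω : L [⋀^Fin (m + 1)]→ₗ[ℂ] ℂ) (v : Fin (m + 2) → L) :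
    ceDiffSucc L m ω v = -∑ i : Fin (m + 1), ∑ j ≥ i, (-1) ^ (i + j : ℕ) *
      ω (Matrix.vecCons ⁅v i.castSucc, v j.succ⁆ (j.removeNth (i.castSucc.removeNth v))) := rfl

/-- The Chevalley--Eilenberg differential with trivial coefficients `ℂ`; it is zero in degree `0`. -/
def ceDiff : ∀ k : ℕ, (L [⋀^Fin k]→ₗ[ℂ] ℂ) →ₗ[ℂ] (L [⋀^Fin (k + 1)]→ₗ[ℂ] ℂ)
  | 0 => 0
  | m + 1 =>
    { toFun := ceDiffSucc L m
      map_add' := fun a b => by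
        ext v
        simp only [ceDiffSucc_apply, AlternatingMap.add_apply, mul_add, Finset.sum_add_distrib,
          neg_add]
      map_smul' := fun c a => by
        ext v
        simp only [ceDiffSucc_apply, AlternatingMap.smul_apply, smul_eq_mul, Finset.mul_sum,
          mul_neg, RingHom.id_apply, mul_left_comm] }

variable {L}
/-- Lie derivative on cochains (used only to prove that the differential squares to zero). -/
def ceLie (x : L) : ∀ k : ℕ, (L [⋀^Fin k]→ₗ[ℂ] ℂ) → (L [⋀^Fin k]→ₗ[ℂ] ℂ)
  | 0 => fun _ => 0
  | _ + 1 => fun ω => -AlternatingMap.alternatizeUncurryFin (ω.curryLeft ∘ₗ LieAlgebra.ad ℂ L x)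

theorem ceLie_succ_apply (x : L) (m : ℕ) (ω : L [⋀^Fin (m + 1)]→ₗ[ℂ] ℂ) (v : Fin (m + 1) → L) :
    ceLie x (m + 1) ω v = -∑ j : Fin (m + 1), (-1) ^ (j : ℕ) *
      ω (Matrix.vecCons ⁅x, v j⁆ (j.removeNth v)) := by
  simp only [ceLie, AlternatingMap.neg_apply, AlternatingMap.alternatizeUncurryFin_apply,
    zsmul_eq_mul, LinearMap.comp_apply, LieAlgebra.ad_apply, AlternatingMap.curryLeft_apply_apply]
  simp

theorem ceSwap {m : ℕ} (ω : L [⋀^Fin (m + 2)]→ₗ[ℂ] ℂ) (a b : L) (v : Fin m → L) :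
    ω (Matrix.vecCons a (Matrix.vecCons b v)) = -ω (Matrix.vecCons b (Matrix.vecCons a v)) := by
  have h := ω.map_swap (Matrix.vecCons b (Matrix.vecCons a v)) (i := 0) (j := 1) (by simp)
  rw [← h]
  congr 1
  ext i
  refine Fin.cases ?_ (fun i => ?_) i
  · simp
  · refine Fin.cases ?_ (fun i => ?_) i
    · simp
    · simp only [Function.comp_apply]
      rw [Equiv.swap_apply_of_ne_of_ne (by simp) (by
        intro h; simpa using congrArg Fin.val h)]
      simp

theorem removeNth_succ_vecCons {α : Type} {m : ℕ} (j : Fin (m + 1)) (a : α) (v : Fin (m + 1) → α) :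
    j.succ.removeNth (Matrix.vecCons a v : Fin (m + 2) → α) = Matrix.vecCons a (j.removeNth v) := by
  ext i
  refine Fin.cases ?_ (fun i => ?_) i <;> simp [Fin.removeNth]

theorem ceInsert_ceLie (x y : L) (m : ℕ) (ω : L [⋀^Fin (m + 1)]→ₗ[ℂ] ℂ) :
    ceInsert y (ceLie x (m + 1) ω) = ceLie x m (ceInsert y ω) - ceInsert ⁅x, y⁆ ω := by
  ext v
  simp only [AlternatingMap.curryLeft_apply_apply, AlternatingMap.sub_apply, ceLie_succ_apply]
  rw [Fin.sum_univ_succ]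
  cases m with
  | zero => simp [ceLie]
  | succ m =>
    simp only [ceLie_succ_apply, Matrix.cons_val_zero, Matrix.cons_val_succ,
      removeNth_succ_vecCons, AlternatingMap.curryLeft_apply_apply]
    simp only [ceSwap ω _ y]
    simp [pow_succ]
    ring

theorem ceInsert_ceDiff (x : L) (m : ℕ) (ω : L [⋀^Fin (m + 1)]→ₗ[ℂ] ℂ) :
    ceInsert x (ceDiff L (m + 1) ω) = ceLie x (m + 1) ω - ceDiff L m (ceInsert x ω) := by
  ext v
  simp only [AlternatingMap.curryLeft_apply_apply, AlternatingMap.sub_apply, ceLie_succ_apply]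
  change ceDiffSucc L m ω _ = _
  rw [ceDiffSucc_apply, Fin.sum_univ_succ]
  cases m with
  | zero => simp [ceDiff]
  | succ m =>
    change _ = _ - ceDiffSucc L m _ _
    rw [ceDiffSucc_apply]
    have hI : ∀ (N : ℕ) (i : Fin N) (f : Fin N → ℂ),
        ∑ j ≥ i, f j = ∑ j, if i ≤ j then f j else 0 := fun N i f => by
      rw [← Finset.sum_filter]
      exact Finset.sum_congr (by ext; simp) fun _ _ => rfl
    simp only [hI, Fin.zero_le, if_true]
    rw [neg_add, sub_eq_add_neg, neg_neg]
    congr 1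
    · simp [Fin.removeNth_zero]
    · rw [← Finset.sum_neg_distrib]
      refine Finset.sum_congr rfl fun i _ => ?_
      rw [Fin.sum_univ_succ, if_neg (by simp), zero_add, ← Finset.sum_neg_distrib]
      refine Finset.sum_congr rfl fun j _ => ?_
      simp only [Fin.succ_le_succ_iff]
      split_ifs with h
      · simp only [← Fin.succ_castSucc, removeNth_succ_vecCons, Matrix.cons_val_succ,
          AlternatingMap.curryLeft_apply_apply]
        rw [ceSwap ω x]
        have hp : (-1 : ℂ) ^ ((i : ℕ) + 1 + ((j : ℕ) + 1)) = (-1) ^ ((i : ℕ) + j) := by ring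
        simp [hp]
      · simp

theorem ceInsert_injective {m : ℕ} {ω η : L [⋀^Fin (m + 1)]→ₗ[ℂ] ℂ}
    (h : ∀ x, ceInsert x ω = ceInsert x η) : ω = η := by
  ext v
  have := congrArg (fun f => f (Matrix.vecTail v)) (h (v 0))
  simpa only [AlternatingMap.curryLeft_apply_apply, Matrix.cons_head_tail,
    show Matrix.vecCons (v 0) (Matrix.vecTail v) = v from Matrix.cons_head_tail v] using this

theorem ceLie_add (x : L) (m : ℕ) (ω η : L [⋀^Fin m]→ₗ[ℂ] ℂ) :
    ceLie x m (ω + η) = ceLie x m ω + ceLie x m η := by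
  cases m with
  | zero => simp [ceLie]
  | succ m => ext v; simp [ceLie_succ_apply, mul_add, Finset.sum_add_distrib]; ring

theorem ceLie_neg (x : L) (m : ℕ) (ω : L [⋀^Fin m]→ₗ[ℂ] ℂ) :
    ceLie x m (-ω) = -ceLie x m ω := by
  cases m with
  | zero => simp [ceLie]
  | succ m => ext v; simp [ceLie_succ_apply]

theorem ceLie_sub (x : L) (m : ℕ) (ω η : L [⋀^Fin m]→ₗ[ℂ] ℂ) :
    ceLie x m (ω - η) = ceLie x m ω - ceLie x m η := by
  rw [sub_eq_add_neg, ceLie_add, ceLie_neg, sub_eq_add_neg]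

theorem ceInsert_sub {m : ℕ} (x : L) (ω η : L [⋀^Fin (m + 1)]→ₗ[ℂ] ℂ) :
    ceInsert x (ω - η) = ceInsert x ω - ceInsert x η := by
  ext v; simp

theorem ceLie_comm (x y : L) (m : ℕ) (ω : L [⋀^Fin m]→ₗ[ℂ] ℂ) :
    ceLie x m (ceLie y m ω) - ceLie y m (ceLie x m ω) = ceLie ⁅x, y⁆ m ω := by
  induction m with
  | zero => simp [ceLie]
  | succ m ih =>
    refine ceInsert_injective fun z => ?_
    have hj : ceInsert ⁅⁅x, y⁆, z⁆ ω = ceInsert ⁅x, ⁅y, z⁆⁆ ω - ceInsert ⁅y, ⁅x, z⁆⁆ ω := by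
      simp only [ceInsert]
      rw [← map_sub, lie_lie]
    rw [ceInsert_sub]
    simp only [ceInsert_ceLie, ceLie_sub]
    rw [hj, ← ih]
    abel

theorem ceDiff_ceLie (x : L) (m : ℕ) (ω : L [⋀^Fin m]→ₗ[ℂ] ℂ) :
    ceDiff L m (ceLie x m ω) = ceLie x (m + 1) (ceDiff L m ω) := by
  induction m with
  | zero => ext v; simp [ceLie_succ_apply, ceDiff]
  | succ m ih =>
    refine ceInsert_injective fun z => ?_
    rw [ceInsert_ceDiff, ceInsert_ceLie, ceInsert_ceLie, ceInsert_ceDiff, ceInsert_ceDiff,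
      map_sub, ih, ceLie_sub, ← ceLie_comm]
    abel

theorem ceDiff_ceDiff (m : ℕ) (ω : L [⋀^Fin m]→ₗ[ℂ] ℂ) :
    ceDiff L (m + 1) (ceDiff L m ω) = 0 := by
  induction m with
  | zero => exact map_zero (ceDiff L 1)
  | succ m ih =>
    refine ceInsert_injective fun z => ?_
    rw [ceInsert_ceDiff, ceInsert_ceDiff, map_sub, ih, ceDiff_ceLie, sub_zero, sub_self]
    ext v
    simp

/-- The Chevalley--Eilenberg complex of `L` with trivial coefficients `ℂ`. -/
def ceComplex (L : Type) [LieRing L] [LieAlgebra ℂ L] : CochainComplex (ModuleCat.{0} ℂ) ℕ :=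
  CochainComplex.of (fun k => ModuleCat.of ℂ (L [⋀^Fin k]→ₗ[ℂ] ℂ))
    (fun k => ModuleCat.ofHom (ceDiff L k))
    (fun k => by
      rw [← ModuleCat.ofHom_comp,
        LinearMap.ext (f := ceDiff L (k + 1) ∘ₗ ceDiff L k) (g := 0) (ceDiff_ceDiff k)]
      rfl)

end ChevalleyEilenberg

/-- The ring `Γ(ℂⁿ, 𝒪)` of holomorphic functions on `ℂⁿ`. -/
def entireFunctions (n : ℕ) : Subalgebra ℂ ((Fin n → ℂ) → ℂ) where
  carrier := {f | AnalyticOnNhd ℂ f Set.univ}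
  mul_mem' hf hg := hf.mul hg
  add_mem' hf hg := hf.add hg
  algebraMap_mem' _ := analyticOnNhd_const

/-- `Δ` is a global defining equation of a reduced divisor: `Δ ≠ 0`, and `Δ` generates the ideal of
all holomorphic functions that vanish on `{Δ = 0}`. -/
structure IsReducedEquation {n : ℕ} (Δ : entireFunctions n) : Prop where
  ne_zero : Δ ≠ 0
  dvd_of_vanishing : ∀ f : entireFunctions n, (∀ x, Δ.1 x = 0 → f.1 x = 0) → Δ ∣ f

/-- The divisor `D = {Δ = 0} ⊆ ℂⁿ`. -/
def divisorSet {n : ℕ} (Δ : entireFunctions n) : Set (Fin n → ℂ) := {x | Δ.1 x = 0}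

/-- `Γ(ℂⁿ, Der(-log D))`: the holomorphic vector fields `v` on `ℂⁿ` with `v(Δ) ∈ 𝒪 · Δ`,
as a module over the ring of holomorphic functions. -/
def logVectorFields {n : ℕ} (Δ : entireFunctions n) :
    Submodule (entireFunctions n) ((Fin n → ℂ) → (Fin n → ℂ)) where
  carrier := {v | AnalyticOnNhd ℂ v Set.univ ∧
    ∃ α : entireFunctions n, ∀ x, fderiv ℂ Δ.1 x (v x) = α.1 x * Δ.1 x}
  add_mem' := by
    rintro v w ⟨hv, α, hα⟩ ⟨hw, β, hβ⟩
    exact ⟨hv.add hw, α + β, fun x => by simp [hα, hβ, add_mul]⟩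
  zero_mem' := ⟨analyticOnNhd_const, 0, fun x => by simp⟩
  smul_mem' := by
    rintro f v ⟨hv, α, hα⟩
    refine ⟨f.2.smul hv, f * α, fun x => ?_⟩
    have : (f • v) x = f.1 x • v x := rfl
    simp [this, hα, mul_assoc]

/-- The vector field `x A ∂ᵗ = ∑ x_i a_{ij} ∂_j` with linear coefficients. -/
def linearField {n : ℕ} (A : Matrix (Fin n) (Fin n) ℂ) : (Fin n → ℂ) → (Fin n → ℂ) :=
  fun x => Matrix.vecMul x A

/-- `D` is a linear free divisor: the module `Γ(ℂⁿ, Der(-log D))` has a basis `δ₁, …, δₙ` of vector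
fields with linear coefficients. -/
def IsLinearFree {n : ℕ} (Δ : entireFunctions n) : Prop :=
  ∃ b : Module.Basis (Fin n) (entireFunctions n) (logVectorFields Δ),
    ∀ i, ∃ A : Matrix (Fin n) (Fin n) ℂ, (b i : (Fin n → ℂ) → (Fin n → ℂ)) = linearField A

def linearFieldCLM {n : ℕ} (A : Matrix (Fin n) (Fin n) ℂ) : (Fin n → ℂ) →L[ℂ] (Fin n → ℂ) :=
  LinearMap.toContinuousLinearMap (Matrix.vecMulLinear A)

theorem linearFieldCLM_apply {n : ℕ} (A : Matrix (Fin n) (Fin n) ℂ) (x : Fin n → ℂ) :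
    linearFieldCLM A x = linearField A x := rfl

theorem fderiv_dir_linearField {n : ℕ} {f : (Fin n → ℂ) → ℂ} (hf : AnalyticOnNhd ℂ f Set.univ)
    (A : Matrix (Fin n) (Fin n) ℂ) (x w : Fin n → ℂ) :
    fderiv ℂ (fun y => fderiv ℂ f y (linearField A y)) x w =
      fderiv ℂ (fderiv ℂ f) x w (linearField A x) + fderiv ℂ f x (linearField A w) := by
  have h1 : DifferentiableAt ℂ (fderiv ℂ f) x :=
    ((hf.fderiv) x (Set.mem_univ x)).differentiableAt
  have h2 : HasFDerivAt (fun y => linearField A y) (linearFieldCLM A) x :=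
    (linearFieldCLM A).hasFDerivAt
  rw [(h1.hasFDerivAt.clm_apply h2).fderiv]
  simp [linearFieldCLM_apply, add_comm]

/-- The Lie algebra `L_D` of global logarithmic vector fields of degree zero, a vector field
`x A ∂ᵗ` being identified with its matrix `A`; the commutator of matrices is then the bracket of
vector fields. -/
def linearLogFields {n : ℕ} (Δ : entireFunctions n) :
    LieSubalgebra ℂ (Matrix (Fin n) (Fin n) ℂ) where
  carrier := {A | linearField A ∈ logVectorFields Δ}
  add_mem' := by
    intro A B hA hB
    have : linearField (A + B) = linearField A + linearField B := by
      ext1 x; exact Matrix.vecMul_add A B x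
    change linearField (A + B) ∈ logVectorFields Δ
    exact this ▸ add_mem hA hB
  zero_mem' := by
    have : linearField (0 : Matrix (Fin n) (Fin n) ℂ) = 0 := by
      ext1 x; exact Matrix.vecMul_zero x
    change linearField 0 ∈ logVectorFields Δ
    exact this ▸ zero_mem _
  smul_mem' := by
    intro c A hA
    have : linearField (c • A) = (algebraMap ℂ (entireFunctions n) c) • linearField A := by
      ext1 x; exact Matrix.vecMul_smul x c A
    change linearField (c • A) ∈ logVectorFields Δ
    exact this ▸ Submodule.smul_mem _ _ hA
  lie_mem' := by
    rintro A B ⟨-, α, hα⟩ ⟨-, β, hβ⟩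
    have hmem : ∀ (γ : entireFunctions n) (C : Matrix (Fin n) (Fin n) ℂ),
        AnalyticOnNhd ℂ (fun x => fderiv ℂ γ.1 x (linearField C x)) Set.univ := fun γ C =>
      fun x hx =>
      (ContinuousLinearMap.analyticAt_bilinear (ContinuousLinearMap.apply ℂ ℂ).flip _).comp₂
        (γ.2.fderiv x hx) ((linearFieldCLM C).analyticAt x)
    refine ⟨fun x _ => (linearFieldCLM _).analyticAt x,
      ⟨_, hmem β A⟩ - ⟨_, hmem α B⟩, fun x => ?_⟩
    have hd : ∀ γ : entireFunctions n, DifferentiableAt ℂ γ.1 x := fun γ =>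
      (γ.2 x (Set.mem_univ x)).differentiableAt
    have hsym : IsSymmSndFDerivAt ℂ Δ.1 x :=
      ((Δ.2 x (Set.mem_univ x)).contDiffAt (n := ⊤)).isSymmSndFDerivAt (by simp)
    have e1 := fderiv_dir_linearField Δ.2 B x (linearField A x)
    have e2 := fderiv_dir_linearField Δ.2 A x (linearField B x)
    rw [funext hβ, fderiv_fun_mul (hd β) (hd Δ)] at e1
    rw [funext hα, fderiv_fun_mul (hd α) (hd Δ)] at e2
    have hb : linearField ⁅A, B⁆ x = linearField B (linearField A x) -
        linearField A (linearField B x) := by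
      simp [linearField, Ring.lie_def, Matrix.vecMul_sub, Matrix.vecMul_vecMul]
    have hs := hsym.eq (linearField A x) (linearField B x)
    simp only [add_apply, smul_apply, smul_eq_mul,
      hα, hβ] at e1 e2
    rw [hb, map_sub]
    change _ = (fderiv ℂ β.1 x (linearField A x) - fderiv ℂ α.1 x (linearField B x)) * Δ.1 x
    linear_combination -hs - e1 + e2

/-- Differential `k`-forms on `ℂⁿ` (arbitrary functions, no regularity). -/
abbrev FormOn (n k : ℕ) : Type := (Fin n → ℂ) → (Fin n → ℂ) [⋀^Fin k]→L[ℂ] ℂ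

theorem extDeriv_analyticAt {n k : ℕ} {ω : FormOn n k} {x : Fin n → ℂ} (h : AnalyticAt ℂ ω x) :
    AnalyticAt ℂ (extDeriv ω) x := by
  exact ((ContinuousAlternatingMap.alternatizeUncurryFinCLM (n := k) ℂ (Fin n → ℂ) ℂ).analyticAt _).comp
    h.fderiv

theorem compl_divisor_nhds {n : ℕ} (Δ : entireFunctions n) {x : Fin n → ℂ} (hx : Δ.1 x ≠ 0) :
    ∀ᶠ y in nhds x, Δ.1 y ≠ 0 :=
  (Δ.2 x (Set.mem_univ x)).continuousAt.eventually_ne hx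

/-- `Γ(ℂⁿ, Ωᵏ(log D))`: the forms `ω` holomorphic on `ℂⁿ ∖ D` such that `Δ ω` and `Δ dω` extend to
holomorphic forms on `ℂⁿ`. A form on `ℂⁿ ∖ D` is represented by its extension by `0` to `D`. -/
def logForms {n : ℕ} (Δ : entireFunctions n) (k : ℕ) : Submodule ℂ (FormOn n k) where
  carrier := {ω | (∀ x, Δ.1 x = 0 → ω x = 0) ∧
    (∀ x, Δ.1 x ≠ 0 → AnalyticAt ℂ ω x) ∧
    (∃ η : FormOn n k, AnalyticOnNhd ℂ η Set.univ ∧ ∀ x, Δ.1 x ≠ 0 → Δ.1 x • ω x = η x) ∧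
    (∃ θ : FormOn n (k + 1), AnalyticOnNhd ℂ θ Set.univ ∧
      ∀ x, Δ.1 x ≠ 0 → Δ.1 x • extDeriv ω x = θ x)}
  add_mem' := by
    rintro ω₁ ω₂ ⟨h1, h2, ⟨η₁, h3, h4⟩, θ₁, h5, h6⟩ ⟨k1, k2, ⟨η₂, k3, k4⟩, θ₂, k5, k6⟩
    refine ⟨fun x hx => by simp [h1 x hx, k1 x hx], fun x hx => (h2 x hx).add (k2 x hx),
      ⟨η₁ + η₂, h3.add k3, fun x hx => by simp [← h4 x hx, ← k4 x hx]⟩,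
      θ₁ + θ₂, h5.add k5, fun x hx => ?_⟩
    rw [extDeriv_add (h2 x hx).differentiableAt (k2 x hx).differentiableAt]
    simp [← h6 x hx, ← k6 x hx]
  zero_mem' := by
    refine ⟨fun _ _ => rfl, fun x _ => analyticAt_const, ⟨0, analyticOnNhd_const, by simp⟩,
      0, analyticOnNhd_const, fun x _ => ?_⟩
    have : extDeriv (0 : FormOn n k) x = 0 := by
      simpa using extDeriv_smul (x := x) (0 : ℂ) (0 : FormOn n k)
    simp [this]
  smul_mem' := by
    rintro c ω ⟨h1, h2, ⟨η, h3, h4⟩, θ, h5, h6⟩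
    refine ⟨fun x hx => by simp [h1 x hx], fun x hx => analyticAt_const.smul (h2 x hx),
      ⟨c • η, fun x hx => analyticAt_const.smul (h3 x hx), fun x hx => by
        simp [← h4 x hx, smul_comm c]⟩,
      c • θ, fun x hx => analyticAt_const.smul (h5 x hx), fun x hx => ?_⟩
    rw [extDeriv_smul, smul_comm, h6 x hx]
    rfl

/-- The exterior derivative on `ℂⁿ ∖ D`, extended by `0` to `D`. -/
def logExtDeriv {n : ℕ} (Δ : entireFunctions n) {k : ℕ} (ω : FormOn n k) : FormOn n (k + 1) :=
  fun x => if Δ.1 x = 0 then 0 else extDeriv ω x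

theorem logExtDeriv_eventuallyEq {n : ℕ} (Δ : entireFunctions n) {k : ℕ} (ω : FormOn n k)
    {x : Fin n → ℂ} (hx : Δ.1 x ≠ 0) : logExtDeriv Δ ω =ᶠ[nhds x] extDeriv ω := by
  filter_upwards [compl_divisor_nhds Δ hx] with y hy
  simp [logExtDeriv, hy]

theorem extDeriv_logExtDeriv {n : ℕ} (Δ : entireFunctions n) {k : ℕ} {ω : FormOn n k}
    {x : Fin n → ℂ} (hx : Δ.1 x ≠ 0) (hω : AnalyticAt ℂ ω x) :
    extDeriv (logExtDeriv Δ ω) x = 0 := by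
  rw [(logExtDeriv_eventuallyEq Δ ω hx).extDeriv_eq]
  exact extDeriv_extDeriv_apply (hω.contDiffAt (n := ⊤)) (by simp)

theorem logExtDeriv_mem {n : ℕ} (Δ : entireFunctions n) {k : ℕ} {ω : FormOn n k}
    (hω : ω ∈ logForms Δ k) : logExtDeriv Δ ω ∈ logForms Δ (k + 1) := by
  obtain ⟨-, h2, -, θ, h5, h6⟩ := hω
  refine ⟨fun x hx => by simp [logExtDeriv, hx], fun x hx => ?_,
    ⟨θ, h5, fun x hx => by simp [logExtDeriv, hx, h6 x hx]⟩,
    0, analyticOnNhd_const, fun x hx => ?_⟩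
  · exact (extDeriv_analyticAt (h2 x hx)).congr (logExtDeriv_eventuallyEq Δ ω hx).symm
  · rw [extDeriv_logExtDeriv Δ hx (h2 x hx)]; simp

/-- The exterior derivative `Γ(ℂⁿ, Ωᵏ(log D)) → Γ(ℂⁿ, Ωᵏ⁺¹(log D))`. -/
def logD {n : ℕ} (Δ : entireFunctions n) (k : ℕ) : logForms Δ k →ₗ[ℂ] logForms Δ (k + 1) where
  toFun ω := ⟨logExtDeriv Δ ω.1, logExtDeriv_mem Δ ω.2⟩
  map_add' ω₁ ω₂ := by
    ext1; funext x
    by_cases hx : Δ.1 x = 0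
    · simp [logExtDeriv, hx]
    · simp only [logExtDeriv, hx, if_false, Submodule.coe_add, Pi.add_apply]
      exact extDeriv_add (ω₁.2.2.1 x hx).differentiableAt (ω₂.2.2.1 x hx).differentiableAt
  map_smul' c ω := by
    ext1; funext x
    by_cases hx : Δ.1 x = 0
    · simp only [logExtDeriv, hx, if_true, Submodule.coe_smul, Pi.smul_apply, RingHom.id_apply]
      exact (smul_zero (A := (Fin n → ℂ) [⋀^Fin (k + 1)]→L[ℂ] ℂ) c).symm
    · simp only [logExtDeriv, hx, if_false, Submodule.coe_smul, Pi.smul_apply, RingHom.id_apply]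
      exact extDeriv_smul c _

theorem logD_logD {n : ℕ} (Δ : entireFunctions n) (k : ℕ) (ω : logForms Δ k) :
    logD Δ (k + 1) (logD Δ k ω) = 0 := by
  ext1; funext x
  by_cases hx : Δ.1 x = 0
  · simp [logD, logExtDeriv, hx]
  · have := extDeriv_logExtDeriv Δ hx (ω.2.2.1 x hx)
    simpa [logD, logExtDeriv, hx] using this

/-- The complex `Γ(ℂⁿ, Ω^•(log D))`. -/
def logComplex {n : ℕ} (Δ : entireFunctions n) : CochainComplex (ModuleCat.{0} ℂ) ℕ :=
  CochainComplex.of (fun k => ModuleCat.of ℂ (logForms Δ k)) (fun k => ModuleCat.ofHom (logD Δ k))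
    (fun k => by
      rw [← ModuleCat.ofHom_comp]
      have : logD Δ (k + 1) ∘ₗ logD Δ k = 0 := LinearMap.ext (logD_logD Δ k)
      rw [this]; rfl)

/-- `Γ(ℂⁿ, Ωᵏ(log D))₀`: the logarithmic forms that are homogeneous of degree zero, where `x_i` and
`dx_i` have degree one, that is, that are invariant under pullback by `x ↦ t x`, `t ∈ ℂ^×`. -/
def degZeroForms {n : ℕ} (Δ : entireFunctions n) (k : ℕ) : Submodule ℂ (FormOn n k) where
  carrier := {ω | ω ∈ logForms Δ k ∧ ∀ (t : ℂ) (x : Fin n → ℂ),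
    t ≠ 0 → Δ.1 x ≠ 0 → Δ.1 (t • x) ≠ 0 → t ^ k • ω (t • x) = ω x}
  add_mem' h1 h2 := ⟨add_mem h1.1 h2.1, fun t x ht hx htx => by
    simp [← h1.2 t x ht hx htx, ← h2.2 t x ht hx htx]⟩
  zero_mem' := ⟨zero_mem _, fun t x _ _ _ => by simp⟩
  smul_mem' c ω h := ⟨Submodule.smul_mem _ c h.1, fun t x ht hx htx => by
    simp [← h.2 t x ht hx htx, smul_comm c]⟩

theorem degZeroForms_le {n : ℕ} (Δ : entireFunctions n) (k : ℕ) :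
    degZeroForms Δ k ≤ logForms Δ k := fun _ h => h.1

theorem logExtDeriv_mem_degZeroForms {n : ℕ} (Δ : entireFunctions n) (k : ℕ) {ω : FormOn n k}
    (hω : ω ∈ degZeroForms Δ k) : logExtDeriv Δ ω ∈ degZeroForms Δ (k + 1) := by
  refine ⟨logExtDeriv_mem Δ hω.1, fun t x ht hx htx => ?_⟩
  have hev : ω =ᶠ[nhds x] fun y => t ^ k • ω (t • y) := by
    have hc : ContinuousAt (fun y : Fin n → ℂ => t • y) x := by fun_prop
    filter_upwards [compl_divisor_nhds Δ hx, hc.eventually (compl_divisor_nhds Δ htx)] with y hy hty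
    exact (hω.2 t y ht hy hty).symm
  have hf : fderiv ℂ ω x = t ^ (k + 1) • fderiv ℂ ω (t • x) := by
    rw [hev.fderiv_eq]
    have hd : HasFDerivAt (fun y => t ^ k • ω (t • y)) _ x :=
      (((hω.1.2.1 _ htx).differentiableAt.hasFDerivAt).comp x
        ((hasFDerivAt_id x).const_smul t)).const_smul (t ^ k)
    rw [hd.fderiv]
    ext1 v
    simp [pow_succ, smul_smul]
  simp only [logExtDeriv, hx, htx, if_false, extDeriv, hf]
  exact (ContinuousAlternatingMap.alternatizeUncurryFin_smul ..).symm

/-- The exterior derivative on forms of degree zero. -/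
def degZeroD {n : ℕ} (Δ : entireFunctions n) (k : ℕ) :
    degZeroForms Δ k →ₗ[ℂ] degZeroForms Δ (k + 1) where
  toFun ω := ⟨logExtDeriv Δ ω.1, logExtDeriv_mem_degZeroForms Δ k ω.2⟩
  map_add' ω₁ ω₂ := by
    have h := congrArg Subtype.val ((logD Δ k).map_add
      (Submodule.inclusion (degZeroForms_le Δ k) ω₁)
      (Submodule.inclusion (degZeroForms_le Δ k) ω₂))
    exact Subtype.ext h
  map_smul' c ω := by
    have h := congrArg Subtype.val ((logD Δ k).map_smul c
      (Submodule.inclusion (degZeroForms_le Δ k) ω))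
    exact Subtype.ext h

theorem degZeroD_degZeroD {n : ℕ} (Δ : entireFunctions n) (k : ℕ) (ω : degZeroForms Δ k) :
    degZeroD Δ (k + 1) (degZeroD Δ k ω) = 0 := by
  have h := congrArg Subtype.val (logD_logD Δ k (Submodule.inclusion (degZeroForms_le Δ k) ω))
  exact Subtype.ext h

/-- The complex `Γ(ℂⁿ, Ω^•(log D))₀`. -/
def degZeroComplex {n : ℕ} (Δ : entireFunctions n) : CochainComplex (ModuleCat.{0} ℂ) ℕ :=
  CochainComplex.of (fun k => ModuleCat.of ℂ (degZeroForms Δ k))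
    (fun k => ModuleCat.ofHom (degZeroD Δ k))
    (fun k => by
      rw [← ModuleCat.ofHom_comp, LinearMap.ext (f := degZeroD Δ (k + 1) ∘ₗ degZeroD Δ k) (g := 0)
        (degZeroD_degZeroD Δ k)]
      rfl)

/-- The inclusion `Γ(ℂⁿ, Ω^•(log D))₀ → Γ(ℂⁿ, Ω^•(log D))`. -/
def degZeroInclusion {n : ℕ} (Δ : entireFunctions n) : degZeroComplex Δ ⟶ logComplex Δ :=
  CochainComplex.ofHom
    (fun k => ModuleCat.ofHom (Submodule.inclusion (degZeroForms_le Δ k)))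
    (fun k => by
      simp only [degZeroComplex, logComplex, CochainComplex.of_d]
      rfl)

/-- The singular cochain complex of `X` with complex coefficients (the dual of the singular chains). -/
def singularCochainComplex (X : Type) [TopologicalSpace X] : CochainComplex (ModuleCat.{0} ℂ) ℕ :=
  let K := ((AlgebraicTopology.singularChainComplexFunctor (ModuleCat.{0} ℂ)).obj
    (ModuleCat.of ℂ ℂ)).obj (TopCat.of X)
  CochainComplex.of (fun k => ModuleCat.of ℂ (Module.Dual ℂ (K.X k)))
    (fun k => ModuleCat.ofHom (K.d (k + 1) k).hom.dualMap)
    (fun k => by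
      rw [← ModuleCat.ofHom_comp, LinearMap.dualMap_comp_dualMap, ← ModuleCat.hom_comp,
        K.d_comp_d]
      ext : 1
      exact LinearMap.ext fun f => LinearMap.ext fun x => map_zero f)

/-- The group `G_D = {A ∈ GLₙ(ℂ) | A(D) = D}`. -/
def stabilizerGroup {n : ℕ} (D : Set (Fin n → ℂ)) : Subgroup (GL (Fin n) ℂ) where
  carrier := {g | (fun x => Matrix.mulVec g.1 x) '' D = D}
  mul_mem' := by
    intro g h hg hh
    change _ '' D = D at hg hh
    change (fun x => Matrix.mulVec (g * h).1 x) '' D = D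
    conv_rhs => rw [← hg, ← hh, Set.image_image]
    simp [Matrix.mulVec_mulVec]
  one_mem' := by simp
  inv_mem' := by
    intro g hg
    change _ '' D = D at hg
    change (fun x => Matrix.mulVec (g⁻¹).1 x) '' D = D
    conv_lhs => rw [← hg, Set.image_image]
    simp [Matrix.mulVec_mulVec]

/-- The identity component of `G_D`. -/
abbrev identityComponent {n : ℕ} (D : Set (Fin n → ℂ)) : Subgroup (stabilizerGroup D) :=
  Subgroup.connectedComponentOfOne (stabilizerGroup D)

/-- The Lie algebra of a closed (complex algebraic) subgroup `G` of `GLₙ(ℂ)`: all `A` with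
`exp(tA) ∈ G` for every real `t`. For such a group this set is already a complex Lie algebra,
so that passing to the span only packages it; a group and its identity component have the same
Lie algebra. -/
def linearGroupLieAlgebra {n : ℕ} (G : Subgroup (GL (Fin n) ℂ)) :
    LieSubalgebra ℂ (Matrix (Fin n) (Fin n) ℂ) :=
  LieSubalgebra.lieSpan ℂ _
    {A | ∀ t : ℝ, ∃ g ∈ G, (g : Matrix (Fin n) (Fin n) ℂ) = NormedSpace.exp ((t : ℂ) • A)}

/-- `H^k(Γ(ℂⁿ, Ω^•(log D)))`. -/
def logCohomology {n : ℕ} (Δ : entireFunctions n) (k : ℕ) : ModuleCat.{0} ℂ :=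
  (logComplex Δ).homology k

/-- The Lie algebra cohomology `H^k_A(L; ℂ)` with trivial coefficients. -/
def lieCohomology (L : Type) [LieRing L] [LieAlgebra ℂ L] (k : ℕ) : ModuleCat.{0} ℂ :=
  (ceComplex L).homology k

/-- The singular cohomology `H^k(X; ℂ)`. -/
def singularCohomology (X : Type) [TopologicalSpace X] (k : ℕ) : ModuleCat.{0} ℂ :=
  (singularCochainComplex X).homology k

/-- The global logarithmic comparison theorem holds for `D`:
`H^*(Γ(ℂⁿ, Ω^•(log D))) ≅ H^*(ℂⁿ ∖ D; ℂ)` as graded vector spaces. -/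
def SatisfiesGLCT {n : ℕ} (Δ : entireFunctions n) : Prop :=
  ∀ k, Nonempty (logCohomology Δ k ≅ singularCohomology ↥(divisorSet Δ)ᶜ k)

end LFD

end

open LFD

/-! Write 𝒪 for the ring of entire functions and E for the Euler field. An 𝒪-basis of linear
logarithmic fields is also a ℂ-basis of L_D (`LinearFrame`), and evaluation of L_D at x is an
isomorphism onto ℂⁿ exactly when x is off D. A form on the complement is therefore determined by its
values on L_D. The core of (1)-(3) is Saito's duality in global form: the logarithmic k-forms are
precisely those whose values on L_D extend to entire functions, so that `coeffEquiv` identifies them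
with the alternating k-maps from L_D to 𝒪. The two halves are `exists_entire_of_mem_logForms` and
`exists_mul_formOfCoeff_extends`; both rest on `vanishes_of_dvd_fderiv_mul`. Under this
identification d is the Chevalley-Eilenberg differential with coefficients in the L_D-module 𝒪, and
forms of degree zero are those with constant coefficients. This gives (2).

Since D is conical, E belongs to L_D, and it is central there. The Lie derivative along E therefore
acts on coefficients only, multiplying the homogeneous part of degree m by m. Dividing by m for m >
0 and contracting with E gives a homotopy (`eulerHomotopy`) between the identity and the projection
to the values of the coefficients at the origin. This gives (1) and (3).

For (4), M ↦ -Mᵀ identifies the Lie algebra of G_D with L_D (`linearGroupLieAlgebra_eq`,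
`logMatricesEquiv`). The group G_D° acts transitively on the connected complement of D, because its
orbits there are open. The isotropy group of a point is discrete, since L_D is its own normalizer
and evaluation at the point is injective on L_D; it is also algebraic, and a countable algebraic set
is finite. So the orbit map is a finite covering whose deck transformations are right translations,
homotopic to the identity because G_D° is path connected. The transfer then shows that G_D° and the
complement have the same complex cohomology (`nonempty_singularCohomology_iso`), and the two
conditions in (4) compare isomorphic spaces. -/

noncomputable section

namespace LFD

/-! ### Entire functions and division by the equation of the divisor -/

section Holomorphic

variable {n : ℕ} {Δ : entireFunctions n}

theorem entire_continuous (f : entireFunctions n) : Continuous f.1 :=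
  continuous_iff_continuousAt.2 fun x => (f.2 x (Set.mem_univ x)).continuousAt

theorem entire_differentiable (f : entireFunctions n) : Differentiable ℂ f.1 :=
  fun x => (f.2 x (Set.mem_univ x)).differentiableAt

theorem eq_zero_of_eventually_eq_zero {f : entireFunctions n} {x : Fin n → ℂ}
    (h : ∀ᶠ y in nhds x, f.1 y = 0) : f = 0 := by
  ext y
  exact f.2.eqOn_zero_of_preconnected_of_eventuallyEq_zero isPreconnected_univ (Set.mem_univ x) h
    (Set.mem_univ y)

theorem dense_compl_divisor (h : Δ ≠ 0) : Dense {x | Δ.1 x ≠ 0} := by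
  intro x
  rw [mem_closure_iff_frequently]
  intro hx
  exact h (eq_zero_of_eventually_eq_zero (hx.mono fun y hy => by simpa using hy))

theorem eq_of_eq_off_divisor (h : Δ ≠ 0) {F : Type*} [TopologicalSpace F] [T2Space F]
    {f g : (Fin n → ℂ) → F} (hf : Continuous f) (hg : Continuous g)
    (hfg : ∀ x, Δ.1 x ≠ 0 → f x = g x) : f = g :=
  Continuous.ext_on (dense_compl_divisor h) hf hg hfg

/-- If `f · dΔ` is divisible by `Δ`, then `f` vanishes on the divisor. -/
theorem vanishes_of_dvd_fderiv_mul (hΔ : Δ ≠ 0) {f : (Fin n → ℂ) → ℂ} (hf : Continuous f)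
    (h : ∀ v : Fin n → ℂ, ∃ g : (Fin n → ℂ) → ℂ, Continuous g ∧
      ∀ x, fderiv ℂ Δ.1 x v * f x = Δ.1 x * g x) {x : Fin n → ℂ} (hx : Δ.1 x = 0) : f x = 0 := by
  -- If f(x) ≠ 0, then on a ball around x the derivative of Δ along each segment from x is (g/f)·Δ
  -- with g/f bounded. By Grönwall's inequality Δ, which vanishes at x, vanishes along the segment,
  -- hence on the whole ball. The direction y - x, and with it g, depends on the end point y.
  by_contra hfx
  refine hΔ (eq_zero_of_eventually_eq_zero (x := x) ?_)
  obtain ⟨r, hr, hball⟩ := Metric.eventually_nhds_iff_ball.1 (hf.continuousAt.eventually_ne hfx)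
  filter_upwards [Metric.ball_mem_nhds x hr] with y hy
  obtain ⟨g, hg, hfg⟩ := h (y - x)
  set γ : ℝ → (Fin n → ℂ) := fun t => x + (t : ℂ) • (y - x) with hγ
  have hγc : Continuous γ := by fun_prop
  have hγd : ∀ t, HasDerivAt γ (y - x) t := fun t => by
    simpa only [Complex.ofRealCLM_apply, Complex.ofReal_one, one_smul] using!
      ((Complex.ofRealCLM.hasDerivAt (x := t)).smul_const (y - x)).const_add x
  have hmem : ∀ t ∈ Set.Icc (0 : ℝ) 1, f (γ t) ≠ 0 := fun t ht => by
    refine hball _ ?_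
    rw [mem_ball_iff_norm, hγ]
    rw [mem_ball_iff_norm] at hy
    simp only [add_sub_cancel_left, norm_smul, Complex.norm_real, Real.norm_eq_abs]
    rw [abs_of_nonneg ht.1]
    exact (mul_le_of_le_one_left (norm_nonneg _) ht.2).trans_lt hy
  have hcont : ContinuousOn (fun t => g (γ t) / f (γ t)) (Set.Icc (0 : ℝ) 1) :=
    (hg.comp hγc).continuousOn.div (hf.comp hγc).continuousOn hmem
  obtain ⟨K, hK⟩ := isCompact_Icc.exists_bound_of_continuousOn hcont
  have hd : ∀ t, HasDerivAt (fun t => Δ.1 (γ t)) (fderiv ℂ Δ.1 (γ t) (y - x)) t := fun t =>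
    ((entire_differentiable Δ (γ t)).hasFDerivAt.restrictScalars ℝ).comp_hasDerivAt t (hγd t)
  have := eq_zero_of_abs_deriv_le_mul_abs_self_of_eq_zero_right (f := fun t => Δ.1 (γ t))
    (f' := fun t => fderiv ℂ Δ.1 (γ t) (y - x)) (K := K) (a := 0) (b := 1)
    (((entire_continuous Δ).comp hγc).continuousOn) (fun t _ => (hd t).hasDerivWithinAt)
    (by simpa [hγ] using hx) (fun t ht => by
      have ht' := Set.Ico_subset_Icc_self ht
      have e : fderiv ℂ Δ.1 (γ t) (y - x) = g (γ t) / f (γ t) * Δ.1 (γ t) := by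
        have := hfg (γ t)
        field_simp [hmem t ht']
        linear_combination this
      rw [e, norm_mul]
      exact mul_le_mul_of_nonneg_right (hK t ht') (norm_nonneg _)) 1 (by simp)
  simpa [hγ] using this

theorem exists_eq_smul_of_vanishes (hΔ : IsReducedEquation Δ) {W : Type*} [NormedAddCommGroup W]
    [NormedSpace ℂ W] [FiniteDimensional ℂ W] {η : (Fin n → ℂ) → W}
    (hη : AnalyticOnNhd ℂ η Set.univ) (h : ∀ x, Δ.1 x = 0 → η x = 0) :
    ∃ θ : (Fin n → ℂ) → W, AnalyticOnNhd ℂ θ Set.univ ∧ ∀ x, η x = Δ.1 x • θ x := by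
  let b := Module.finBasis ℂ W
  have hcoord : ∀ i, AnalyticOnNhd ℂ (fun x => b.coord i (η x)) Set.univ := fun i x hx =>
    ((LinearMap.toContinuousLinearMap (b.coord i)).analyticAt _).comp (hη x hx)
  have hdiv : ∀ i, ∃ d : entireFunctions n, ∀ x, b.coord i (η x) = Δ.1 x * d.1 x := fun i => by
    obtain ⟨d, hd⟩ := hΔ.dvd_of_vanishing ⟨_, hcoord i⟩ fun x hx => by simp [h x hx]
    exact ⟨d, fun x => congrFun (congrArg Subtype.val hd) x⟩
  choose d hd using hdiv
  refine ⟨fun x => ∑ i, (d i).1 x • b i, fun x hx => ?_, fun x => ?_⟩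
  · exact Finset.analyticAt_fun_sum _ fun i _ => ((d i).2 x hx).smul analyticAt_const
  · conv_lhs => rw [← b.sum_repr (η x)]
    rw [Finset.smul_sum]
    refine Finset.sum_congr rfl fun i _ => ?_
    rw [smul_smul, ← hd i x]; rfl

end Holomorphic

/-! ### Coordinates and analyticity of alternating forms -/

section Forms

variable {n k : ℕ}

/-- The values of a form on tuples of standard basis vectors. -/
def formCoords (n k : ℕ) :
    ((Fin n → ℂ) [⋀^Fin k]→L[ℂ] ℂ) →ₗ[ℂ] ((Fin k → Fin n) → ℂ) where
  toFun ω r := ω fun i => Pi.single (r i) 1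
  map_add' _ _ := rfl
  map_smul' _ _ := rfl

theorem formCoords_injective : Function.Injective (formCoords n k) := by
  intro ω η h
  apply ContinuousAlternatingMap.toAlternatingMap_injective
  refine Module.Basis.ext_alternating (Pi.basisFun ℂ (Fin n)) fun r _ => ?_
  simpa [formCoords] using congrFun h r

instance : FiniteDimensional ℂ ((Fin n → ℂ) [⋀^Fin k]→L[ℂ] ℂ) :=
  FiniteDimensional.of_injective _ formCoords_injective

/-- A linear left inverse of `formCoords` recovers the form from finitely many of its values, so
analyticity can be tested on constant vectors. -/
theorem form_analyticAt {ω : FormOn n k} {x : Fin n → ℂ}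
    (h : ∀ v, AnalyticAt ℂ (fun y => ω y v) x) : AnalyticAt ℂ ω x := by
  obtain ⟨g, hg⟩ := (formCoords n k).exists_leftInverse_of_injective
    (LinearMap.ker_eq_bot.2 formCoords_injective)
  have e : ω = fun y => LinearMap.toContinuousLinearMap g (formCoords n k (ω y)) := by
    funext y
    exact (LinearMap.congr_fun hg (ω y)).symm
  rw [e]
  exact (ContinuousLinearMap.analyticAt _ _).comp (analyticAt_pi_iff.2 fun r => h _)

theorem form_apply_analyticAt {ω : FormOn n k} {x : Fin n → ℂ} (h : AnalyticAt ℂ ω x)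
    {v : Fin k → (Fin n → ℂ) → (Fin n → ℂ)} (hv : ∀ i, AnalyticAt ℂ (v i) x) :
    AnalyticAt ℂ (fun y => ω y fun i => v i y) x := by
  have e : (fun y => ω y fun i => v i y) = fun y => ∑ r : Fin k → Fin n,
      (∏ i, v i y (r i)) • ω y fun i => Pi.single (r i) 1 := by
    funext y
    have : (fun i => v i y) = fun i => ∑ j, v i y j • (Pi.single j 1 : Fin n → ℂ) := by
      funext i
      exact pi_eq_sum_univ' (v i y)
    rw [this, ContinuousAlternatingMap.map_sum]
    refine Finset.sum_congr rfl fun r _ => ?_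
    exact (ω y).toMultilinearMap.map_smul_univ _ _
  rw [e]
  refine Finset.analyticAt_fun_sum _ fun r _ => AnalyticAt.fun_smul ?_ ?_
  · exact Finset.analyticAt_fun_prod _ fun i _ => analyticAt_pi_iff.1 (hv i) _
  · exact ((ContinuousLinearMap.proj (R := ℂ) (φ := fun _ => ℂ) r).comp
      (LinearMap.toContinuousLinearMap (formCoords n k))).analyticAt _ |>.comp h

/-- An alternating map on a finite dimensional space is continuous. -/
def toContinuousForm (φ : (Fin n → ℂ) [⋀^Fin k]→ₗ[ℂ] ℂ) : (Fin n → ℂ) [⋀^Fin k]→L[ℂ] ℂ :=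
  { φ with
    cont := by
      have e : (φ : (Fin k → Fin n → ℂ) → ℂ) = fun v => ∑ r : Fin k → Fin n,
          (∏ i, v i (r i)) • φ fun i => Pi.single (r i) 1 := by
        funext v
        have : v = fun i => ∑ j, v i j • (Pi.single j 1 : Fin n → ℂ) := by
          funext i
          exact pi_eq_sum_univ' (v i)
        conv_lhs => rw [this]
        refine (φ.toMultilinearMap.map_sum _).trans (Finset.sum_congr rfl fun r _ => ?_)
        exact φ.toMultilinearMap.map_smul_univ _ _
      change Continuous (φ : (Fin k → Fin n → ℂ) → ℂ)
      rw [e]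
      fun_prop }

@[simp] theorem toContinuousForm_apply (φ : (Fin n → ℂ) [⋀^Fin k]→ₗ[ℂ] ℂ)
    (v : Fin k → Fin n → ℂ) : toContinuousForm φ v = φ v := rfl

end Forms

end LFD
end

/-! ### Linear frames and the determinant criterion for the divisor -/

noncomputable section

namespace LFD

variable {n : ℕ} {Δ : entireFunctions n}

theorem linearField_analyticOnNhd (A : Matrix (Fin n) (Fin n) ℂ) :
    AnalyticOnNhd ℂ (linearField A) Set.univ :=
  fun x _ => (linearFieldCLM A).analyticAt x

theorem fderiv_entire_analyticOnNhd (f : entireFunctions n) {v : (Fin n → ℂ) → (Fin n → ℂ)}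
    (hv : AnalyticOnNhd ℂ v Set.univ) :
    AnalyticOnNhd ℂ (fun x => fderiv ℂ f.1 x (v x)) Set.univ := fun x hx =>
  (ContinuousLinearMap.analyticAt_bilinear (ContinuousLinearMap.apply ℂ ℂ).flip _).comp₂
    (f.2.fderiv x hx) (hv x hx)

theorem mem_logVectorFields_iff (hΔ : IsReducedEquation Δ) {v : (Fin n → ℂ) → (Fin n → ℂ)} :
    v ∈ logVectorFields Δ ↔ AnalyticOnNhd ℂ v Set.univ ∧
      ∀ x, Δ.1 x = 0 → fderiv ℂ Δ.1 x (v x) = 0 := by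
  refine ⟨fun ⟨h1, α, hα⟩ => ⟨h1, fun x hx => by rw [hα, hx, mul_zero]⟩, fun ⟨h1, h2⟩ => ⟨h1, ?_⟩⟩
  obtain ⟨α, hα⟩ := hΔ.dvd_of_vanishing ⟨_, fderiv_entire_analyticOnNhd Δ h1⟩ h2
  exact ⟨α, fun x => (congrFun (congrArg Subtype.val hα) x).trans (mul_comm _ _)⟩

theorem mem_linearLogFields_iff (hΔ : IsReducedEquation Δ) {A : Matrix (Fin n) (Fin n) ℂ} :
    A ∈ linearLogFields Δ ↔ ∀ x, Δ.1 x = 0 → fderiv ℂ Δ.1 x (linearField A x) = 0 :=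
  (mem_logVectorFields_iff hΔ).trans (and_iff_right (linearField_analyticOnNhd A))

/-- Evaluation of the linear logarithmic vector fields at a point. -/
def evalField (Δ : entireFunctions n) (x : Fin n → ℂ) :
    linearLogFields Δ →ₗ[ℂ] (Fin n → ℂ) where
  toFun A := linearField A.1 x
  map_add' A B := Matrix.vecMul_add A.1 B.1 x
  map_smul' c A := Matrix.vecMul_smul x c A.1

theorem evalField_apply (x : Fin n → ℂ) (A : linearLogFields Δ) :
    evalField Δ x A = linearField A.1 x := rfl

theorem evalField_smul (t : ℂ) (x : Fin n → ℂ) : evalField Δ (t • x) = t • evalField Δ x := by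
  ext1 A
  exact Matrix.smul_vecMul t x A.1

theorem linearField_injective :
    Function.Injective (linearField : Matrix (Fin n) (Fin n) ℂ → _) := by
  intro A B h
  ext i j
  have := congrFun (congrFun h (Pi.single i 1)) j
  simpa [linearField] using this

/-- A basis of the space of linear logarithmic fields, together with the coefficients that express
the fields `Δ • v` in it. -/
structure LinearFrame (Δ : entireFunctions n) where
  basis : Module.Basis (Fin n) ℂ (linearLogFields Δ)
  span : ∀ w ∈ logVectorFields Δ, ∃ c : Fin n → entireFunctions n,
    ∀ x, w x = ∑ i, (c i).1 x • evalField Δ x (basis i)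
  cof : (Fin n → ℂ) → (Fin n → ℂ) →ₗ[ℂ] linearLogFields Δ
  evalField_cof : ∀ x v, evalField Δ x (cof x v) = Δ.1 x • v
  cof_analytic : ∀ v i, AnalyticOnNhd ℂ (fun x => basis.repr (cof x v) i) Set.univ

theorem exists_span_of_basis {b : Module.Basis (Fin n) (entireFunctions n) (logVectorFields Δ)}
    {A : Fin n → linearLogFields Δ} (hA : ∀ i, (b i).1 = linearField (A i).1)
    {w : (Fin n → ℂ) → (Fin n → ℂ)} (hw : w ∈ logVectorFields Δ) :
    ∃ c : Fin n → entireFunctions n, ∀ x, w x = ∑ i, (c i).1 x • evalField Δ x (A i) := by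
  refine ⟨b.repr ⟨w, hw⟩, fun x => ?_⟩
  have h := congrFun (congrArg Subtype.val (b.sum_repr ⟨w, hw⟩)) x
  rw [AddSubmonoidClass.coe_finsetSum, Finset.sum_apply] at h
  refine h.symm.trans (Finset.sum_congr rfl fun i _ => ?_)
  rw [evalField_apply, ← hA i]; rfl

set_option synthInstance.maxHeartbeats 200000 in
theorem linearIndependent_of_basis
    {b : Module.Basis (Fin n) (entireFunctions n) (logVectorFields Δ)}
    {A : Fin n → linearLogFields Δ} (hA : ∀ i, (b i).1 = linearField (A i).1) :
    LinearIndependent ℂ A := by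
  rw [Fintype.linearIndependent_iff]
  intro g hg i
  have hsum : ∑ i, algebraMap ℂ (entireFunctions n) (g i) • b i = 0 := by
    apply Subtype.ext
    funext x
    rw [AddSubmonoidClass.coe_finsetSum, Finset.sum_apply]
    have hx := congrArg (evalField Δ x) hg
    rw [map_sum, map_zero] at hx
    refine Eq.trans (Finset.sum_congr rfl fun i _ => ?_) hx
    rw [map_smul, evalField_apply, ← hA i]
    rfl
  have h := congrFun (b.repr_sum_self fun i => algebraMap ℂ (entireFunctions n) (g i)) i
  rw [hsum, map_zero] at h
  exact (congrFun (congrArg Subtype.val h) 0).symm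

/-- Both sides are compared at t • x: linear fields are homogeneous of degree one, so a factor t
cancels, and letting t tend to 0 freezes the coefficients at the origin. Thus 𝒪-generators of the
logarithmic fields generate L_D over ℂ. -/
theorem eq_sum_of_span {A : Fin n → linearLogFields Δ} {c : Fin n → entireFunctions n}
    {B : linearLogFields Δ}
    (hc : ∀ x, evalField Δ x B = ∑ i, (c i).1 x • evalField Δ x (A i)) :
    B = ∑ i, (c i).1 0 • A i := by
  apply Subtype.ext
  apply linearField_injective
  funext x
  rw [← evalField_apply, ← evalField_apply, map_sum]
  simp only [map_smul]
  have hne : ∀ t : ℂ, t ∈ ({0}ᶜ : Set ℂ) →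
      evalField Δ x B = ∑ i, (c i).1 (t • x) • evalField Δ x (A i) := by
    intro t ht
    have := hc (t • x)
    simp only [evalField_smul, LinearMap.smul_apply, smul_comm _ t, ← Finset.smul_sum] at this
    exact smul_right_injective _ ht this
  have hcont : Continuous fun t : ℂ => ∑ i, (c i).1 (t • x) • evalField Δ x (A i) :=
    continuous_finsetSum _ fun i _ =>
      ((entire_continuous (c i)).comp (by fun_prop)).smul continuous_const
  have := congrFun (Continuous.ext_on (dense_compl_singleton (0 : ℂ)) continuous_const hcont hne) 0
  simpa using this

theorem IsLinearFree.nonempty_frame (hD : IsLinearFree Δ) : Nonempty (LinearFrame Δ) := by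
  obtain ⟨b, hb⟩ := hD
  choose A' hA' using hb
  let A : Fin n → linearLogFields Δ := fun i => ⟨A' i, by
    change linearField (A' i) ∈ logVectorFields Δ
    rw [← hA' i]; exact (b i).2⟩
  have hA : ∀ i, (b i).1 = linearField (A i).1 := hA'
  have htop : ⊤ ≤ Submodule.span ℂ (Set.range A) := by
    rintro B -
    obtain ⟨c, hc⟩ := exists_span_of_basis hA B.2
    rw [eq_sum_of_span (B := B) hc]
    exact Submodule.sum_mem _ fun i _ => Submodule.smul_mem _ _ (Submodule.subset_span ⟨i, rfl⟩)
  let B := Module.Basis.mk (linearIndependent_of_basis hA) htop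
  have hB : ∀ i, B i = A i := fun i => by simp [B]
  -- Multiplying any constant field by Δ makes it logarithmic; expanding Δ • ∂_j in the basis
  -- produces the entire coefficients from which `cof` is built.
  have hmul : ∀ v : Fin n → ℂ, (fun x => Δ.1 x • v) ∈ logVectorFields Δ := fun v =>
    ⟨fun x hx => (Δ.2 x hx).smul analyticAt_const,
      ⟨_, fderiv_entire_analyticOnNhd Δ (v := fun _ => v) analyticOnNhd_const⟩, fun x => by
        simp [mul_comm]⟩
  choose c hc using fun j : Fin n => exists_span_of_basis hA (hmul (Pi.single j 1))
  refine ⟨⟨B, fun w hw => by simpa only [hB] using exists_span_of_basis hA hw,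
    fun x => ∑ j, (LinearMap.proj j).smulRight (∑ i, (c j i).1 x • B i), fun x v => ?_,
    fun v i x hx => ?_⟩⟩
  · simp only [LinearMap.sum_apply, LinearMap.smulRight_apply, LinearMap.proj_apply, map_sum,
      map_smul]
    conv_rhs => rw [pi_eq_sum_univ' v, Finset.smul_sum]
    refine Finset.sum_congr rfl fun j _ => ?_
    rw [smul_comm, hc j x]
    simp only [hB]
  · simp only [LinearMap.sum_apply, LinearMap.smulRight_apply, LinearMap.proj_apply, map_sum,
      map_smul, Finsupp.coe_finsetSum, Finset.sum_apply, Finsupp.smul_apply,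
      Module.Basis.repr_self, Finsupp.single_apply, smul_eq_mul, mul_ite, mul_one, mul_zero,
      Finset.sum_ite_eq', Finset.mem_univ, if_true]
    exact Finset.analyticAt_fun_sum _ fun j _ => analyticAt_const.mul ((c j i).2 x hx)

namespace LinearFrame

variable (S : LinearFrame Δ)
include S

theorem finiteDimensional : FiniteDimensional ℂ (linearLogFields Δ) := .of_basis S.basis

theorem evalField_bijective {x : Fin n → ℂ} (hx : Δ.1 x ≠ 0) :
    Function.Bijective (evalField Δ x) := by
  have := S.finiteDimensional
  have hs : Function.Surjective (evalField Δ x) := fun v =>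
    ⟨(Δ.1 x)⁻¹ • S.cof x v, by rw [map_smul, S.evalField_cof, inv_smul_smul₀ hx]⟩
  refine ⟨(LinearMap.injective_iff_surjective_of_finrank_eq_finrank ?_).2 hs, hs⟩
  rw [Module.finrank_eq_card_basis S.basis]; simp

theorem cof_evalField {x : Fin n → ℂ} (hx : Δ.1 x ≠ 0) (A : linearLogFields Δ) :
    S.cof x (evalField Δ x A) = Δ.1 x • A :=
  (S.evalField_bijective hx).1 (by rw [S.evalField_cof, map_smul])

/-- Let M be the matrix whose rows are the basis fields. By Cramer's rule det M • v is an
𝒪-combination of logarithmic fields, so det M times the derivative of Δ along v is divisible by Δ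
for every v. By `vanishes_of_dvd_fderiv_mul` the determinant vanishes on D. -/
theorem not_surjective_of_eq_zero (h0 : Δ ≠ 0) {x : Fin n → ℂ} (hx : Δ.1 x = 0) :
    ¬ Function.Surjective (evalField Δ x) := by
  let M : (Fin n → ℂ) → Matrix (Fin n) (Fin n) ℂ := fun y =>
    Matrix.of fun i => evalField Δ y (S.basis i)
  have hM : Continuous M := continuous_matrix fun i j =>
    (continuous_apply j).comp (linearFieldCLM (S.basis i).1).continuous
  have hdet : (M x).det = 0 := by
    refine vanishes_of_dvd_fderiv_mul h0 (f := fun y => (M y).det) hM.matrix_det (fun v => ?_) hx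
    have hα : ∀ i, ∃ α : entireFunctions n, ∀ y,
        fderiv ℂ Δ.1 y (evalField Δ y (S.basis i)) = α.1 y * Δ.1 y := fun i => (S.basis i).2.2
    choose α hα using hα
    refine ⟨fun y => ∑ i, Matrix.vecMul v (M y).adjugate i * (α i).1 y,
      continuous_finsetSum _ fun i _ => ?_, fun y => ?_⟩
    · exact ((continuous_apply i).comp
        (Continuous.matrix_vecMul continuous_const hM.matrix_adjugate)).mul
          (entire_continuous (α i))
    · have e : (M y).det • v =
          ∑ i, Matrix.vecMul v (M y).adjugate i • evalField Δ y (S.basis i) := by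
        have h := Matrix.vecMul_vecMul v (M y).adjugate (M y)
        rw [Matrix.adjugate_mul, Matrix.vecMul_smul, Matrix.vecMul_one] at h
        rw [← h, Matrix.vecMul_eq_sum]
        rfl
      have := congrArg (fderiv ℂ Δ.1 y) e
      rw [map_smul, map_sum, smul_eq_mul] at this
      rw [mul_comm, this, Finset.mul_sum]
      refine Finset.sum_congr rfl fun i _ => ?_
      rw [map_smul, hα, smul_eq_mul]; ring
  intro hs
  have hinj := (LinearMap.injective_iff_surjective_of_finrank_eq_finrank (f := evalField Δ x)
    (by rw [Module.finrank_eq_card_basis S.basis]; simp)).2 hs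
  obtain ⟨v, hv, hv0⟩ := Matrix.exists_vecMul_eq_zero_iff.2 hdet
  apply hv
  have h1 : evalField Δ x (∑ i, v i • S.basis i) = 0 := by
    rw [map_sum, ← hv0, Matrix.vecMul_eq_sum]
    simp only [map_smul]
    rfl
  have h2 := hinj (h1.trans (map_zero _).symm)
  funext i
  exact Fintype.linearIndependent_iff.1 S.basis.linearIndependent v h2 i

/-- D is recovered from L_D alone. This makes D conical, and later shows that it is preserved by
every matrix that normalizes L_D. -/
theorem eq_zero_iff_not_surjective (h0 : Δ ≠ 0) {x : Fin n → ℂ} :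
    Δ.1 x = 0 ↔ ¬ Function.Surjective (evalField Δ x) :=
  ⟨S.not_surjective_of_eq_zero h0, fun h => by_contra fun hx => h (S.evalField_bijective hx).2⟩

theorem smul_mem_divisor_iff (h0 : Δ ≠ 0) {x : Fin n → ℂ} {t : ℂ} (ht : t ≠ 0) :
    Δ.1 (t • x) = 0 ↔ Δ.1 x = 0 := by
  rw [S.eq_zero_iff_not_surjective h0, S.eq_zero_iff_not_surjective h0, evalField_smul]
  refine not_congr ⟨fun h y => ?_, fun h y => ?_⟩
  · obtain ⟨A, hA⟩ := h (t • y)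
    exact ⟨A, smul_right_injective _ ht hA⟩
  · obtain ⟨A, hA⟩ := h (t⁻¹ • y)
    exact ⟨A, by rw [LinearMap.smul_apply, hA, smul_inv_smul₀ ht]⟩

/-- D is a cone, so Δ vanishes along the punctured line through a point of D, and the derivative of
Δ in the radial direction is zero there. -/
theorem one_mem (hΔ : IsReducedEquation Δ) : (1 : Matrix (Fin n) (Fin n) ℂ) ∈ linearLogFields Δ := by
  rw [mem_linearLogFields_iff hΔ]
  intro x hx
  have e : linearField (1 : Matrix (Fin n) (Fin n) ℂ) x = x := Matrix.vecMul_one x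
  rw [e]
  have h1 : HasDerivAt (fun t : ℂ => Δ.1 (t • x)) (fderiv ℂ Δ.1 x x) 1 := by
    have h2 : HasDerivAt (fun t : ℂ => t • x) x 1 := by
      simpa using (hasDerivAt_id (1 : ℂ)).smul_const x
    have h3 := (entire_differentiable Δ ((1 : ℂ) • x)).hasFDerivAt.comp_hasDerivAt 1 h2
    simpa only [one_smul] using! h3
  have h2 : (fun t : ℂ => Δ.1 (t • x)) =ᶠ[nhds 1] fun _ => 0 := by
    filter_upwards [isOpen_ne.mem_nhds (one_ne_zero : (1 : ℂ) ≠ 0)] with t ht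
    exact (S.smul_mem_divisor_iff hΔ.ne_zero ht).2 hx
  exact h1.unique ((hasDerivAt_const (1 : ℂ) (0 : ℂ)).congr_of_eventuallyEq h2)

end LinearFrame

end LFD
end

/-! ### Logarithmic forms as alternating maps with entire values -/

noncomputable section

namespace LFD

variable {n : ℕ} {Δ : entireFunctions n} {k : ℕ}

theorem entire_ext_off_divisor (h : Δ ≠ 0) {f g : entireFunctions n}
    (hfg : ∀ x, Δ.1 x ≠ 0 → f.1 x = g.1 x) : f = g :=
  Subtype.ext (eq_of_eq_off_divisor h (entire_continuous f) (entire_continuous g) hfg)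

/-- The entire functions `a A` are the values of the form `ω` on tuples of linear logarithmic
fields. -/
def HasCoeff (ω : FormOn n k) (a : linearLogFields Δ [⋀^Fin k]→ₗ[ℂ] entireFunctions n) : Prop :=
  ∀ x, Δ.1 x ≠ 0 → ∀ A, (a A).1 x = ω x fun i => evalField Δ x (A i)

theorem exists_hasCoeff (h0 : Δ ≠ 0) {ω : FormOn n k}
    (h : ∀ A : Fin k → linearLogFields Δ, ∃ f : entireFunctions n, ∀ x, Δ.1 x ≠ 0 →
      f.1 x = ω x fun i => evalField Δ x (A i)) :
    ∃ a : linearLogFields Δ [⋀^Fin k]→ₗ[ℂ] entireFunctions n, HasCoeff ω a := by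
  choose f hf using h
  let φ : (x : Fin n → ℂ) → linearLogFields Δ [⋀^Fin k]→ₗ[ℂ] ℂ := fun x =>
    (ω x).toAlternatingMap.compLinearMap (evalField Δ x)
  have hφ : ∀ A x, Δ.1 x ≠ 0 → (f A).1 x = φ x A := hf
  refine ⟨{ toFun := f, map_update_add' := ?_, map_update_smul' := ?_,
            map_eq_zero_of_eq' := ?_ }, fun x hx A => hf A x hx⟩
  · intro _ v i A B
    refine entire_ext_off_divisor h0 fun x hx => ?_
    change _ = (f _).1 x + (f _).1 x
    rw [hφ _ x hx, hφ _ x hx, hφ _ x hx]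
    exact (φ x).map_update_add v i A B
  · intro _ v i c A
    refine entire_ext_off_divisor h0 fun x hx => ?_
    change _ = c • (f _).1 x
    rw [hφ _ x hx, hφ _ x hx]
    exact (φ x).map_update_smul v i c A
  · intro v i j hv hij
    refine entire_ext_off_divisor h0 fun x hx => ?_
    rw [hφ _ x hx]
    exact (φ x).map_eq_zero_of_eq v hv hij

theorem HasCoeff.unique (h0 : Δ ≠ 0) {ω : FormOn n k}
    {a b : linearLogFields Δ [⋀^Fin k]→ₗ[ℂ] entireFunctions n} (ha : HasCoeff ω a)
    (hb : HasCoeff ω b) : a = b := by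
  ext1 A
  exact entire_ext_off_divisor h0 fun x hx => (ha x hx A).trans (hb x hx A).symm

theorem HasCoeff.eq_form (S : LinearFrame Δ) {ω η : FormOn n k}
    {a : linearLogFields Δ [⋀^Fin k]→ₗ[ℂ] entireFunctions n} (hω : HasCoeff ω a)
    (hη : HasCoeff η a) {x : Fin n → ℂ} (hx : Δ.1 x ≠ 0) : ω x = η x := by
  ext v
  choose A hA using fun i => (S.evalField_bijective hx).2 (v i)
  have := (hω x hx A).symm.trans (hη x hx A)
  simpa only [hA] using this

/-- The values of a logarithmic form on linear logarithmic fields are entire. -/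
theorem exists_entire_of_mem_logForms (hΔ : IsReducedEquation Δ) {ω : FormOn n k}
    (hω : ω ∈ logForms Δ k) (A : Fin k → linearLogFields Δ) :
    ∃ f : entireFunctions n, ∀ x, Δ.1 x ≠ 0 → f.1 x = ω x fun i => evalField Δ x (A i) := by
  obtain ⟨-, hωa, ⟨η, hη, hηω⟩, θ, hθ, hθω⟩ := hω
  have hα : ∀ i, ∃ α : entireFunctions n, ∀ y,
      fderiv ℂ Δ.1 y (evalField Δ y (A i)) = α.1 y * Δ.1 y := fun i => (A i).2.2
  choose α hα using hα
  have hev : ∀ i, AnalyticOnNhd ℂ (fun x => evalField Δ x (A i)) Set.univ := fun i =>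
    linearField_analyticOnNhd (A i).1
  have hf0 : AnalyticOnNhd ℂ (fun x => η x fun i => evalField Δ x (A i)) Set.univ := fun x hx =>
    form_apply_analyticAt (hη x hx) fun i => hev i x hx
  have hvan : ∀ x, Δ.1 x = 0 → (η x fun i => evalField Δ x (A i)) = 0 := by
    intro x hx
    refine vanishes_of_dvd_fderiv_mul hΔ.ne_zero
      (f := fun x => η x fun i => evalField Δ x (A i))
      (entire_continuous ⟨_, hf0⟩) (fun v => ?_) hx
    -- It remains to see that η(A) vanishes on D. Evaluate dη = dΔ ∧ ω + Δ dω on (v, A₁, …, A_k).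
    -- The first slot contributes dΔ(v) ω(A), while in the other slots dΔ(A_j) = α_j Δ. Solving for
    -- dΔ(v) ω(A) and multiplying by Δ gives dΔ(v) η(A) = Δ g with the g below, so
    -- `vanishes_of_dvd_fderiv_mul` applies.
    let V : Fin (k + 1) → (Fin n → ℂ) → (Fin n → ℂ) :=
      Fin.cons (fun _ => v) fun i y => evalField Δ y (A i)
    have hV : ∀ i, AnalyticOnNhd ℂ (V i) Set.univ := by
      intro i
      refine Fin.cases ?_ (fun i => ?_) i
      · exact analyticOnNhd_const
      · exact hev i
    let g : (Fin n → ℂ) → ℂ := fun y => (extDeriv η y fun i => V i y) - (θ y fun i => V i y) +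
      ∑ j : Fin k, (-1) ^ (j : ℕ) * ((α j).1 y * η y fun i => V (j.succ.succAbove i) y)
    have hg : AnalyticOnNhd ℂ g Set.univ := fun y hy =>
      ((form_apply_analyticAt (extDeriv_analyticAt (hη y hy)) fun i => hV i y hy).sub
        (form_apply_analyticAt (hθ y hy) fun i => hV i y hy)).add
        (Finset.analyticAt_fun_sum _ fun j _ => analyticAt_const.mul
          (((α j).2 y hy).mul (form_apply_analyticAt (hη y hy) fun i => hV _ y hy)))
    refine ⟨g, entire_continuous ⟨g, hg⟩, fun y => ?_⟩
    refine congrFun (eq_of_eq_off_divisor hΔ.ne_zero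
      (f := fun y => fderiv ℂ Δ.1 y v * η y fun i => evalField Δ y (A i))
      (g := fun y => Δ.1 y * g y)
      ((entire_continuous ⟨_, fderiv_entire_analyticOnNhd Δ (v := fun _ => v)
        analyticOnNhd_const⟩).mul (entire_continuous ⟨_, hf0⟩))
      ((entire_continuous Δ).mul (entire_continuous ⟨g, hg⟩)) fun y hy => ?_) y
    have hnear : η =ᶠ[nhds y] fun z => Δ.1 z • ω z := by
      filter_upwards [compl_divisor_nhds Δ hy] with z hz
      exact (hηω z hz).symm
    have hd := ((entire_differentiable Δ y).hasFDerivAt.smul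
      (hωa y hy).differentiableAt.hasFDerivAt).congr_of_eventuallyEq hnear
    have hext : (extDeriv η y fun i => V i y) = Δ.1 y * (extDeriv ω y fun i => V i y) +
        ∑ i : Fin (k + 1), (-1) ^ (i : ℕ) * (fderiv ℂ Δ.1 y (V i y) *
          ω y fun j => V (i.succAbove j) y) := by
      rw [extDeriv, extDeriv, ContinuousAlternatingMap.alternatizeUncurryFin_apply,
        ContinuousAlternatingMap.alternatizeUncurryFin_apply, hd.fderiv, Finset.mul_sum, ← Finset.sum_add_distrib]
      refine Finset.sum_congr rfl fun i _ => ?_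
      simp only [add_apply, smul_apply,
        ContinuousLinearMap.smulRight_apply, ContinuousAlternatingMap.add_apply,
        ContinuousAlternatingMap.smul_apply, smul_eq_mul, zsmul_eq_mul]
      push_cast
      have : (i.removeNth fun i => V i y) = fun j => V (i.succAbove j) y := rfl
      rw [this]
      ring
    have hθy : (θ y fun i => V i y) = Δ.1 y * extDeriv ω y fun i => V i y := by
      rw [← hθω y hy]; rfl
    have hηy : ∀ u, η y u = Δ.1 y * ω y u := fun u => by rw [← hηω y hy]; rfl
    simp only [g]
    rw [hext, hθy, Fin.sum_univ_succ]
    simp only [hηy]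
    have hV0 : (fun j => V (Fin.succAbove 0 j) y) = fun i => evalField Δ y (A i) := by
      funext j; simp [V]
    have hVs : ∀ j : Fin k, fderiv ℂ Δ.1 y (V j.succ y) = (α j).1 y * Δ.1 y := fun j => hα j y
    rw [hV0]
    have hcancel : ∑ i : Fin k, (-1 : ℂ) ^ (i.succ : ℕ) * (fderiv ℂ Δ.1 y (V i.succ y) *
        ω y fun j => V (i.succ.succAbove j) y) = - ∑ j : Fin k, (-1) ^ (j : ℕ) * ((α j).1 y *
          (Δ.1 y * ω y fun i => V (j.succ.succAbove i) y)) := by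
      rw [← Finset.sum_neg_distrib]
      refine Finset.sum_congr rfl fun j _ => ?_
      rw [hVs, Fin.val_succ, pow_succ]; ring
    rw [hcancel]
    have : V 0 y = v := rfl
    rw [this]
    simp
    ring
  obtain ⟨f, hf⟩ := hΔ.dvd_of_vanishing ⟨_, hf0⟩ hvan
  refine ⟨f, fun x hx => ?_⟩
  have h1 : (η x fun i => evalField Δ x (A i)) = Δ.1 x * f.1 x := congrFun (congrArg Subtype.val hf) x
  rw [← hηω x hx] at h1
  exact (mul_left_cancel₀ hx h1).symm

theorem exists_hasCoeff_of_mem_logForms (hΔ : IsReducedEquation Δ) {ω : FormOn n k}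
    (hω : ω ∈ logForms Δ k) :
    ∃ a : linearLogFields Δ [⋀^Fin k]→ₗ[ℂ] entireFunctions n, HasCoeff ω a :=
  exists_hasCoeff hΔ.ne_zero (exists_entire_of_mem_logForms hΔ hω)

/-- Evaluation of entire functions at a point. -/
def evalAt (x : Fin n → ℂ) : entireFunctions n →ₗ[ℂ] ℂ where
  toFun f := f.1 x
  map_add' _ _ := rfl
  map_smul' _ _ := rfl

/-- The form on the complement of the divisor with prescribed values on linear logarithmic
fields. -/
def formOfCoeff (S : LinearFrame Δ)
    (a : linearLogFields Δ [⋀^Fin k]→ₗ[ℂ] entireFunctions n) : FormOn n k := fun x =>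
  if Δ.1 x = 0 then 0 else ((Δ.1 x)⁻¹ ^ k) •
    toContinuousForm (((evalAt x).compAlternatingMap a).compLinearMap (S.cof x))

/-- Off D the map `S.cof x` is Δ times the inverse of `evalField Δ x`. Each of the k slots yields
one factor Δ, and the power in `formOfCoeff` cancels them. -/
theorem hasCoeff_formOfCoeff (S : LinearFrame Δ)
    (a : linearLogFields Δ [⋀^Fin k]→ₗ[ℂ] entireFunctions n) : HasCoeff (formOfCoeff S a) a := by
  intro x hx A
  rw [formOfCoeff, if_neg hx]
  change _ = (Δ.1 x)⁻¹ ^ k • (evalAt x).compAlternatingMap a (fun i => S.cof x (evalField Δ x (A i)))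
  simp only [S.cof_evalField hx]
  have h2 := ((evalAt x).compAlternatingMap a).toMultilinearMap.map_smul_univ
    (fun _ => Δ.1 x) A
  simp only [Finset.prod_const, Finset.card_univ, Fintype.card_fin] at h2
  refine Eq.symm (Eq.trans (congrArg _ h2) ?_)
  rw [smul_smul, ← mul_pow, inv_mul_cancel₀ hx, one_pow, one_smul]
  rfl

/-- Off D this is Δ^k times `formOfCoeff S a`, so the latter has a pole of order at most k along D.
The bound is improved to a simple pole below. -/
theorem cofForm_analytic (S : LinearFrame Δ)
    (a : linearLogFields Δ [⋀^Fin k]→ₗ[ℂ] entireFunctions n) :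
    AnalyticOnNhd ℂ (fun x =>
      toContinuousForm (((evalAt x).compAlternatingMap a).compLinearMap (S.cof x))) Set.univ := by
  intro x hx
  refine form_analyticAt fun v => ?_
  have e : (fun y => toContinuousForm
      (((evalAt y).compAlternatingMap a).compLinearMap (S.cof y)) v) = fun y =>
      ∑ r : Fin k → Fin n, (∏ i, S.basis.repr (S.cof y (v i)) (r i)) •
        (a fun i => S.basis (r i)).1 y := by
    funext y
    change (evalAt y).compAlternatingMap a (fun i => S.cof y (v i)) = _
    have : (fun i => S.cof y (v i)) = fun i => ∑ j, S.basis.repr (S.cof y (v i)) j • S.basis j := by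
      funext i
      exact (S.basis.sum_repr _).symm
    conv_lhs => rw [this]
    refine (((evalAt y).compAlternatingMap a).toMultilinearMap.map_sum _).trans
      (Finset.sum_congr rfl fun r _ => ?_)
    exact ((evalAt y).compAlternatingMap a).toMultilinearMap.map_smul_univ _ _
  rw [e]
  exact Finset.analyticAt_fun_sum _ fun r _ => AnalyticAt.fun_smul
    (Finset.analyticAt_fun_prod _ fun i _ => S.cof_analytic _ _ x hx) ((a _).2 x hx)

theorem formOfCoeff_analyticAt (S : LinearFrame Δ)
    (a : linearLogFields Δ [⋀^Fin k]→ₗ[ℂ] entireFunctions n) {x : Fin n → ℂ} (hx : Δ.1 x ≠ 0) :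
    AnalyticAt ℂ (formOfCoeff S a) x := by
  refine AnalyticAt.congr (f := fun x => ((Δ.1 x)⁻¹ ^ k) • toContinuousForm
    (((evalAt x).compAlternatingMap a).compLinearMap (S.cof x))) ?_ ?_
  · exact (((Δ.2 x (Set.mem_univ x)).inv hx).pow k).fun_smul (cofForm_analytic S a x (Set.mem_univ x))
  · filter_upwards [compl_divisor_nhds Δ hx] with y hy
    simp [formOfCoeff, hy]

/-- Complete w by a basis of the kernel of ℓ. In a tuple of distinct basis vectors w occurs at most
once, so all entries but possibly one lie in the kernel. -/
theorem alternatingMap_eq_zero_of_ker {φ : (Fin n → ℂ) [⋀^Fin (k + 1)]→ₗ[ℂ] ℂ}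
    {ℓ : (Fin n → ℂ) →ₗ[ℂ] ℂ} {w : Fin n → ℂ} (hw : ℓ w ≠ 0)
    (h : ∀ (u : Fin (k + 1) → Fin n → ℂ) (i : Fin (k + 1)) (v : Fin n → ℂ),
      (∀ j, u j ∈ LinearMap.ker ℓ) → φ (Function.update u i v) = 0) : φ = 0 := by
  let b := Module.finBasis ℂ (LinearMap.ker ℓ)
  let e := Module.Basis.mkFinCons w b (fun c x hx hc => by
      have := congrArg ℓ hc
      rw [map_add, map_smul, LinearMap.mem_ker.1 hx, map_zero, add_zero, smul_eq_mul] at this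
      exact (mul_eq_zero.1 this).resolve_right hw) (fun z => ⟨-(ℓ z / ℓ w), by
      rw [LinearMap.mem_ker, map_add, map_smul, smul_eq_mul]
      field_simp
      ring⟩)
  have he : ∀ j, j ≠ 0 → e j ∈ LinearMap.ker ℓ := by
    intro j hj
    obtain ⟨j, rfl⟩ := Fin.exists_succ_eq.2 hj
    simp [e, b]
  refine Module.Basis.ext_alternating e fun v hv => ?_
  rw [AlternatingMap.zero_apply]
  by_cases h0 : ∃ i, v i = 0
  · obtain ⟨i, hi⟩ := h0
    have := h (Function.update (fun j => e (v j)) i 0) i (e (v i)) fun j => by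
      by_cases hj : j = i
      · subst hj; simp
      · rw [Function.update_of_ne hj]
        exact he _ fun h => hj (hv (h.trans hi.symm))
    rwa [Function.update_idem, Function.update_eq_self] at this
  · push Not at h0
    have := h (fun j => e (v j)) 0 (e (v 0)) fun j => he _ (h0 j)
    rwa [Function.update_eq_self] at this

/-- The Koszul field ∂_wΔ • v - ∂_vΔ • w annihilates Δ, hence is logarithmic, and at x it equals a
nonzero multiple of v. Its expansion in the basis gives A. -/
theorem ker_fderiv_le_range_evalField (S : LinearFrame Δ) (hΔ : IsReducedEquation Δ)
    {x w v : Fin n → ℂ} (hw : fderiv ℂ Δ.1 x w ≠ 0) (hv : fderiv ℂ Δ.1 x v = 0) :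
    ∃ A, evalField Δ x A = v := by
  have hd : ∀ u : Fin n → ℂ, AnalyticOnNhd ℂ (fun y => fderiv ℂ Δ.1 y u) Set.univ := fun u =>
    fderiv_entire_analyticOnNhd Δ (v := fun _ => u) analyticOnNhd_const
  have hK : (fun y => fderiv ℂ Δ.1 y w • v - fderiv ℂ Δ.1 y v • w) ∈ logVectorFields Δ := by
    rw [mem_logVectorFields_iff hΔ]
    refine ⟨fun y hy => ((hd w y hy).fun_smul analyticAt_const).sub
      ((hd v y hy).fun_smul analyticAt_const), fun y _ => ?_⟩
    simp [mul_comm]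
  obtain ⟨c, hc⟩ := S.span _ hK
  refine ⟨(fderiv ℂ Δ.1 x w)⁻¹ • ∑ i, (c i).1 x • S.basis i, ?_⟩
  have := hc x
  rw [hv, zero_smul, sub_zero] at this
  rw [map_smul, map_sum]
  simp only [map_smul]
  rw [← this, inv_smul_smul₀ hw]

/-- This lowers the pole order. If all entries but one come from L_D, then Δ times the value of the
form is entire, because `cof` is applied in one slot only; so η is divisible there by Δ^(m+1) and
vanishes on D. Where dΔ ≠ 0, every vector in the kernel of dΔ is a value of L_D, hence η = 0 by
`alternatingMap_eq_zero_of_ker`. So dΔ(w) η(v) vanishes on all of D, including its singular points,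
and is divisible by Δ; `vanishes_of_dvd_fderiv_mul` then gives η = 0 on D. -/
theorem form_vanishes_on_divisor (S : LinearFrame Δ) (hΔ : IsReducedEquation Δ)
    {a : linearLogFields Δ [⋀^Fin (k + 1)]→ₗ[ℂ] entireFunctions n} {η : FormOn n (k + 1)}
    (hη : AnalyticOnNhd ℂ η Set.univ) {m : ℕ}
    (h : ∀ x, Δ.1 x ≠ 0 → η x = Δ.1 x ^ (m + 2) • formOfCoeff S a x) {x : Fin n → ℂ}
    (hx : Δ.1 x = 0) : η x = 0 := by
  have key : ∀ (B : Fin (k + 1) → linearLogFields Δ) (i : Fin (k + 1)) (v y : Fin n → ℂ),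
      Δ.1 y = 0 → η y (Function.update (fun j => evalField Δ y (B j)) i v) = 0 := by
    intro B i v y hy
    let V : Fin (k + 1) → (Fin n → ℂ) → (Fin n → ℂ) :=
      Function.update (fun j y => evalField Δ y (B j)) i fun _ => v
    have hV : ∀ y, (fun j => V j y) = Function.update (fun j => evalField Δ y (B j)) i v := by
      intro y; funext j
      by_cases hj : j = i
      · subst hj; simp [V]
      · simp [V, hj]
    have hVa : ∀ j, AnalyticOnNhd ℂ (V j) Set.univ := by
      intro j
      by_cases hj : j = i
      · subst hj; simp only [V, Function.update_self]; exact analyticOnNhd_const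
      · simp only [V, Function.update_of_ne hj]; exact linearField_analyticOnNhd (B j).1
    let q : entireFunctions n := ⟨fun y => ∑ l, S.basis.repr (S.cof y v) l *
      (a (Function.update B i (S.basis l))).1 y, fun y hy => Finset.analyticAt_fun_sum _ fun l _ =>
        (S.cof_analytic v l y hy).mul ((a _).2 y hy)⟩
    have := congrFun (eq_of_eq_off_divisor hΔ.ne_zero (f := fun y => η y fun j => V j y)
      (g := fun y => Δ.1 y ^ (m + 1) * q.1 y)
      (entire_continuous ⟨_, fun y hy => form_apply_analyticAt (hη y hy) fun j => hVa j y hy⟩)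
      (((entire_continuous Δ).pow _).mul (entire_continuous q)) fun y hy => ?_) y
    · rw [← hV y]
      refine this.trans ?_
      simp [hy]
    · rw [h y hy, hV y]
      have e1 : Δ.1 y * formOfCoeff S a y (Function.update (fun j => evalField Δ y (B j)) i v) =
          q.1 y := by
        rw [← smul_eq_mul, ← ContinuousAlternatingMap.map_update_smul, ← S.evalField_cof]
        have e2 : Function.update (fun j => evalField Δ y (B j)) i (evalField Δ y (S.cof y v)) =
            fun j => evalField Δ y (Function.update B i (S.cof y v) j) := by
          funext j
          by_cases hj : j = i
          · subst hj; simp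
          · simp [hj]
        rw [e2, ← hasCoeff_formOfCoeff S a y hy]
        conv_lhs => rw [← S.basis.sum_repr (S.cof y v)]
        change (evalAt y) (a _) = _
        rw [AlternatingMap.map_update_sum, map_sum]
        refine Finset.sum_congr rfl fun l _ => ?_
        rw [AlternatingMap.map_update_smul, map_smul]
        rfl
      rw [← e1]
      simp only [ContinuousAlternatingMap.smul_apply, smul_eq_mul]
      ring
  ext v
  refine vanishes_of_dvd_fderiv_mul hΔ.ne_zero (f := fun x => η x v)
    (entire_continuous ⟨_, fun y hy => form_apply_analyticAt (hη y hy) (v := fun i _ => v i)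
      fun j => analyticAt_const⟩) (fun w => ?_) hx
  have hvan : ∀ y, Δ.1 y = 0 → fderiv ℂ Δ.1 y w * η y v = 0 := by
    intro y hy
    by_cases hw : fderiv ℂ Δ.1 y w = 0
    · simp [hw]
    · have : (η y).toAlternatingMap = 0 := by
        refine alternatingMap_eq_zero_of_ker (ℓ := (fderiv ℂ Δ.1 y).toLinearMap) hw
          fun u i v hu => ?_
        choose B hB using fun j => ker_fderiv_le_range_evalField S hΔ hw (hu j)
        have := key B i v y hy
        simp only [hB] at this
        exact this
      have h2 : η y v = 0 := congrArg (fun φ => φ v) this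
      simp [h2]
  obtain ⟨g, hg⟩ := hΔ.dvd_of_vanishing ⟨fun y => fderiv ℂ Δ.1 y w * η y v, fun y hy =>
    (fderiv_entire_analyticOnNhd Δ (v := fun _ => w) analyticOnNhd_const y hy).mul
      (form_apply_analyticAt (hη y hy) (v := fun i _ => v i) fun j => analyticAt_const)⟩ hvan
  exact ⟨g.1, entire_continuous g, fun y => congrFun (congrArg Subtype.val hg) y⟩

/-- A form with entire values on logarithmic fields has at most a simple pole along the divisor. -/
theorem exists_mul_formOfCoeff_extends (S : LinearFrame Δ) (hΔ : IsReducedEquation Δ)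
    (a : linearLogFields Δ [⋀^Fin k]→ₗ[ℂ] entireFunctions n) :
    ∃ η : FormOn n k, AnalyticOnNhd ℂ η Set.univ ∧
      ∀ x, Δ.1 x ≠ 0 → Δ.1 x • formOfCoeff S a x = η x := by
  have hk : ∀ x, Δ.1 x ≠ 0 → toContinuousForm
      (((evalAt x).compAlternatingMap a).compLinearMap (S.cof x)) =
        Δ.1 x ^ k • formOfCoeff S a x := by
    intro x hx
    rw [formOfCoeff, if_neg hx, smul_smul, ← mul_pow, mul_inv_cancel₀ hx, one_pow, one_smul]
  cases k with
  | zero =>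
    refine ⟨_, fun x hx => (Δ.2 x hx).fun_smul (cofForm_analytic S a x hx), fun x hx => ?_⟩
    rw [hk x hx, pow_zero, one_smul]
  | succ k =>
    -- Descent on the pole order: as long as Δ^(m+2) clears the pole, the product vanishes on D and
    -- can be divided by Δ. The descent starts with exponent k + 1, the degree of the form, and
    -- stops at 1.
    have desc : ∀ m, (∃ η : FormOn n (k + 1), AnalyticOnNhd ℂ η Set.univ ∧
        ∀ x, Δ.1 x ≠ 0 → η x = Δ.1 x ^ (m + 1) • formOfCoeff S a x) →
        ∃ η : FormOn n (k + 1), AnalyticOnNhd ℂ η Set.univ ∧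
          ∀ x, Δ.1 x ≠ 0 → Δ.1 x • formOfCoeff S a x = η x := by
      intro m
      induction m with
      | zero =>
        rintro ⟨η, hη, h⟩
        exact ⟨η, hη, fun x hx => by rw [h x hx, zero_add, pow_one]⟩
      | succ m ih =>
        rintro ⟨η, hη, h⟩
        obtain ⟨θ, hθ, hθη⟩ := exists_eq_smul_of_vanishes hΔ hη
          fun x hx => form_vanishes_on_divisor S hΔ hη h hx
        refine ih ⟨θ, hθ, fun x hx => smul_right_injective _ hx ?_⟩
        change Δ.1 x • θ x = Δ.1 x • _
        rw [← hθη x, h x hx, smul_smul, ← pow_succ']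
    exact desc k ⟨_, cofForm_analytic S a, hk⟩

end LFD
end

/-! ### The exterior derivative on coefficients, and forms of degree zero -/

noncomputable section

namespace LFD

variable {n : ℕ} {Δ : entireFunctions n} {k : ℕ}

/-- The signs agree because matrices act on row vectors; for x ↦ M x the bracket would be reversed,
which is why `logMatricesEquiv` carries a sign. -/
theorem lieBracket_linearField (A B : Matrix (Fin n) (Fin n) ℂ) (x : Fin n → ℂ) :
    VectorField.lieBracket ℂ (linearField A) (linearField B) x = linearField ⁅A, B⁆ x := by
  have h : ∀ C : Matrix (Fin n) (Fin n) ℂ, fderiv ℂ (linearField C) x = linearFieldCLM C :=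
    fun C => (linearFieldCLM C).hasFDerivAt.fderiv
  rw [VectorField.lieBracket_eq]
  beta_reduce
  rw [h, h, linearFieldCLM_apply, linearFieldCLM_apply]
  simp [linearField, Ring.lie_def, Matrix.vecMul_sub, Matrix.vecMul_vecMul]

/-- The derivative of an entire function along a linear field. -/
def fieldDeriv (A : Matrix (Fin n) (Fin n) ℂ) : entireFunctions n →ₗ[ℂ] entireFunctions n where
  toFun f := ⟨fun x => fderiv ℂ f.1 x (linearField A x),
    fderiv_entire_analyticOnNhd f (linearField_analyticOnNhd A)⟩
  map_add' f g := by
    ext x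
    have := fderiv_add (entire_differentiable f x) (entire_differentiable g x)
    exact congrArg (fun φ : (Fin n → ℂ) →L[ℂ] ℂ => φ (linearField A x)) this
  map_smul' c f := by
    ext x
    have := fderiv_const_smul (entire_differentiable f x) c
    exact congrArg (fun φ : (Fin n → ℂ) →L[ℂ] ℂ => φ (linearField A x)) this

theorem fieldDeriv_apply (A : Matrix (Fin n) (Fin n) ℂ) (f : entireFunctions n) (x : Fin n → ℂ) :
    (fieldDeriv A f).1 x = fderiv ℂ f.1 x (linearField A x) := rfl

/-- The part of the Chevalley--Eilenberg differential that involves brackets. -/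
def bracketPart : ∀ k : ℕ, (linearLogFields Δ [⋀^Fin k]→ₗ[ℂ] entireFunctions n) →
    (Fin (k + 1) → linearLogFields Δ) → entireFunctions n
  | 0, _, _ => 0
  | k + 1, a, A => -∑ i : Fin (k + 1), ∑ j ≥ i, (-1 : ℂ) ^ (i + j : ℕ) •
      a (Matrix.vecCons ⁅A i.castSucc, A j.succ⁆ (j.removeNth (i.castSucc.removeNth A)))

/-- The Chevalley--Eilenberg differential with coefficients in the entire functions. -/
def coeffDiff (k : ℕ) (a : linearLogFields Δ [⋀^Fin k]→ₗ[ℂ] entireFunctions n)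
    (A : Fin (k + 1) → linearLogFields Δ) : entireFunctions n :=
  ∑ i : Fin (k + 1), (-1 : ℂ) ^ (i : ℕ) • fieldDeriv (A i).1 (a (i.removeNth A)) + bracketPart k a A

theorem entire_sum_apply {ι : Type*} (s : Finset ι) (f : ι → entireFunctions n) (x : Fin n → ℂ) :
    (∑ i ∈ s, f i).1 x = ∑ i ∈ s, (f i).1 x :=
  map_sum (evalAt x) f s

theorem HasCoeff.fderiv_apply {ω : FormOn n k}
    {a : linearLogFields Δ [⋀^Fin k]→ₗ[ℂ] entireFunctions n} (h : HasCoeff ω a)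
    {x : Fin n → ℂ} (hx : Δ.1 x ≠ 0) (A : Fin k → linearLogFields Δ) :
    fderiv ℂ (fun y => ω y fun i => evalField Δ y (A i)) x = fderiv ℂ (a A).1 x := by
  refine Filter.EventuallyEq.fderiv_eq ?_
  filter_upwards [compl_divisor_nhds Δ hx] with y hy
  exact (h y hy A).symm

theorem HasCoeff.extDeriv_apply {ω : FormOn n k}
    {a : linearLogFields Δ [⋀^Fin k]→ₗ[ℂ] entireFunctions n} (h : HasCoeff ω a)
    {x : Fin n → ℂ} (hx : Δ.1 x ≠ 0) (hω : AnalyticAt ℂ ω x)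
    (A : Fin (k + 1) → linearLogFields Δ) :
    (extDeriv ω x fun i => evalField Δ x (A i)) = (coeffDiff k a A).1 x := by
  have hV : ∀ i, DifferentiableAt ℂ (linearField (A i).1) x := fun i =>
    (linearField_analyticOnNhd (A i).1 x (Set.mem_univ x)).differentiableAt
  have hfirst : ∑ i : Fin (k + 1), (-1) ^ (i : ℕ) • fderiv ℂ (fun y => ω y (i.removeNth
      fun j => linearField (A j).1 y)) x (linearField (A i).1 x) =
      (∑ i : Fin (k + 1), (-1 : ℂ) ^ (i : ℕ) • fieldDeriv (A i).1 (a (i.removeNth A))).1 x := by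
    rw [entire_sum_apply]
    refine Finset.sum_congr rfl fun i _ => ?_
    have := h.fderiv_apply hx (i.removeNth A)
    change _ = (-1 : ℂ) ^ (i : ℕ) • fderiv ℂ (a (i.removeNth A)).1 x (linearField (A i).1 x)
    rw [← this]
    simp only [zsmul_eq_mul, smul_eq_mul]
    push_cast
    rfl
  cases k with
  | zero =>
    -- For a 0-form there is a single field and no bracket term, so the commuting version of the
    -- invariant formula applies vacuously.
    have := extDeriv_apply_vectorField_of_pairwise_commute (V := fun i => linearField (A i).1)
      hω.differentiableAt hV (fun i j hij => (hij (Subsingleton.elim (α := Fin 1) i j)).elim)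
    refine this.trans (hfirst.trans ?_)
    rw [coeffDiff, bracketPart, add_zero]
  | succ k =>
    have := extDeriv_apply_vectorField (V := fun i => linearField (A i).1) hω.differentiableAt hV
    refine this.trans ?_
    rw [hfirst]
    change _ = _ + (bracketPart (k + 1) a A).1 x
    rw [sub_eq_add_neg]
    congr 1
    change _ = -(∑ i : Fin (k + 1), ∑ j ≥ i, (-1 : ℂ) ^ (i + j : ℕ) •
      a (Matrix.vecCons ⁅A i.castSucc, A j.succ⁆ (j.removeNth (i.castSucc.removeNth A)))).1 x
    rw [entire_sum_apply]
    congr 1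
    refine Finset.sum_congr rfl fun i _ => ?_
    rw [entire_sum_apply]
    refine Finset.sum_congr rfl fun j _ => ?_
    change _ = (-1 : ℂ) ^ (i + j : ℕ) • (a _).1 x
    rw [h x hx, lieBracket_linearField]
    have e : (fun l => evalField Δ x ((Matrix.vecCons ⁅A i.castSucc, A j.succ⁆
        (j.removeNth (i.castSucc.removeNth A)) : Fin (k + 1) → _) l)) =
        Matrix.vecCons (linearField ⁅(A i.castSucc).1, (A j.succ).1⁆ x)
          (j.removeNth (i.castSucc.removeNth fun l => linearField (A l).1 x)) := by
      funext l
      refine Fin.cases ?_ (fun l => ?_) l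
      · rfl
      · rfl
    rw [e]
    simp only [zsmul_eq_mul, smul_eq_mul]
    push_cast
    rfl

/-- That `coeffDiff` preserves alternating maps needs no computation: its result consists of the
values of a differential form. -/
theorem HasCoeff.logExtDeriv (h0 : Δ ≠ 0) {ω : FormOn n k}
    {a : linearLogFields Δ [⋀^Fin k]→ₗ[ℂ] entireFunctions n} (h : HasCoeff ω a)
    (hω : ∀ x, Δ.1 x ≠ 0 → AnalyticAt ℂ ω x) :
    ∃ b : linearLogFields Δ [⋀^Fin (k + 1)]→ₗ[ℂ] entireFunctions n,
      HasCoeff (logExtDeriv Δ ω) b ∧ ∀ A, b A = coeffDiff k a A := by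
  have key : ∀ A : Fin (k + 1) → linearLogFields Δ, ∀ x, Δ.1 x ≠ 0 →
      (coeffDiff k a A).1 x = LFD.logExtDeriv Δ ω x fun i => evalField Δ x (A i) := by
    intro A x hx
    rw [← h.extDeriv_apply hx (hω x hx), LFD.logExtDeriv, if_neg hx]
  obtain ⟨b, hb⟩ := exists_hasCoeff h0 fun A => ⟨coeffDiff k a A, key A⟩
  exact ⟨b, hb, fun A => entire_ext_off_divisor h0 fun x hx => (hb x hx A).trans (key A x hx).symm⟩

/-- The derivative of the form again has entire values on L_D, so the simple pole theorem applies
both to the form and to its derivative. -/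
theorem formOfCoeff_mem_logForms (S : LinearFrame Δ) (hΔ : IsReducedEquation Δ)
    (a : linearLogFields Δ [⋀^Fin k]→ₗ[ℂ] entireFunctions n) : formOfCoeff S a ∈ logForms Δ k := by
  refine ⟨fun x hx => by rw [formOfCoeff, if_pos hx], fun x hx => formOfCoeff_analyticAt S a hx,
    exists_mul_formOfCoeff_extends S hΔ a, ?_⟩
  obtain ⟨b, hb, -⟩ := (hasCoeff_formOfCoeff S a).logExtDeriv hΔ.ne_zero
    fun x hx => formOfCoeff_analyticAt S a hx
  obtain ⟨θ, hθ, h⟩ := exists_mul_formOfCoeff_extends S hΔ b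
  refine ⟨θ, hθ, fun x hx => ?_⟩
  rw [← h x hx, (hasCoeff_formOfCoeff S b).eq_form S hb hx, logExtDeriv, if_neg hx]

/-- Logarithmic forms are the alternating maps on the linear logarithmic fields with entire
values. -/
def coeffEquiv (S : LinearFrame Δ) (hΔ : IsReducedEquation Δ) (k : ℕ) :
    logForms Δ k ≃ₗ[ℂ] (linearLogFields Δ [⋀^Fin k]→ₗ[ℂ] entireFunctions n) where
  toFun ω := (exists_hasCoeff_of_mem_logForms hΔ ω.2).choose
  map_add' ω η := by
    refine (exists_hasCoeff_of_mem_logForms hΔ (ω + η).2).choose_spec.unique hΔ.ne_zero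
      fun x hx A => ?_
    have h1 := (exists_hasCoeff_of_mem_logForms hΔ ω.2).choose_spec x hx A
    have h2 := (exists_hasCoeff_of_mem_logForms hΔ η.2).choose_spec x hx A
    exact congrArg₂ (· + ·) h1 h2
  map_smul' c ω := by
    refine (exists_hasCoeff_of_mem_logForms hΔ (c • ω).2).choose_spec.unique hΔ.ne_zero
      fun x hx A => ?_
    have h1 := (exists_hasCoeff_of_mem_logForms hΔ ω.2).choose_spec x hx A
    exact congrArg (c • ·) h1
  invFun a := ⟨formOfCoeff S a, formOfCoeff_mem_logForms S hΔ a⟩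
  left_inv ω := by
    ext1
    funext x
    by_cases hx : Δ.1 x = 0
    · exact ((formOfCoeff_mem_logForms S hΔ _).1 x hx).trans (ω.2.1 x hx).symm
    · exact (hasCoeff_formOfCoeff S _).eq_form S
        (exists_hasCoeff_of_mem_logForms hΔ ω.2).choose_spec hx
  right_inv a := (exists_hasCoeff_of_mem_logForms hΔ
    (formOfCoeff_mem_logForms S hΔ a)).choose_spec.unique hΔ.ne_zero (hasCoeff_formOfCoeff S a)

theorem hasCoeff_coeffEquiv (S : LinearFrame Δ) (hΔ : IsReducedEquation Δ) (ω : logForms Δ k) :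
    HasCoeff ω.1 (coeffEquiv S hΔ k ω) :=
  (exists_hasCoeff_of_mem_logForms hΔ ω.2).choose_spec

theorem coeffEquiv_logD (S : LinearFrame Δ) (hΔ : IsReducedEquation Δ) (ω : logForms Δ k)
    (A : Fin (k + 1) → linearLogFields Δ) :
    coeffEquiv S hΔ (k + 1) (logD Δ k ω) A = coeffDiff k (coeffEquiv S hΔ k ω) A := by
  obtain ⟨b, hb, h⟩ := (hasCoeff_coeffEquiv S hΔ ω).logExtDeriv hΔ.ne_zero ω.2.2.1
  rw [← h, hb.unique hΔ.ne_zero (hasCoeff_coeffEquiv S hΔ (logD Δ k ω))]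

/-- The values at the origin of the coefficients of a logarithmic form. -/
def coeffAtZero (S : LinearFrame Δ) (hΔ : IsReducedEquation Δ) (k : ℕ) :
    logForms Δ k →ₗ[ℂ] (linearLogFields Δ [⋀^Fin k]→ₗ[ℂ] ℂ) where
  toFun ω := (evalAt 0).compAlternatingMap (coeffEquiv S hΔ k ω)
  map_add' ω η := by rw [map_add]; rfl
  map_smul' c ω := by rw [map_smul]; ext1 A; rfl

theorem linearField_zero_right (A : Matrix (Fin n) (Fin n) ℂ) : linearField A 0 = 0 :=
  Matrix.zero_vecMul A

/-- Linear fields vanish at the origin, so the derivative terms drop out there and only the bracket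
terms of the differential survive. -/
theorem coeffAtZero_logD (S : LinearFrame Δ) (hΔ : IsReducedEquation Δ) (ω : logForms Δ k) :
    coeffAtZero S hΔ (k + 1) (logD Δ k ω) =
      ceDiff (linearLogFields Δ) k (coeffAtZero S hΔ k ω) := by
  ext1 A
  change (coeffEquiv S hΔ (k + 1) (logD Δ k ω) A).1 0 = _
  rw [coeffEquiv_logD]
  have hfirst : (∑ i : Fin (k + 1), (-1 : ℂ) ^ (i : ℕ) •
      fieldDeriv (A i).1 (coeffEquiv S hΔ k ω (i.removeNth A))).1 0 = 0 := by
    rw [entire_sum_apply]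
    refine Finset.sum_eq_zero fun i _ => ?_
    change (-1 : ℂ) ^ (i : ℕ) •
      (fieldDeriv (A i).1 (coeffEquiv S hΔ k ω (i.removeNth A))).1 0 = 0
    rw [fieldDeriv_apply, linearField_zero_right, ContinuousLinearMap.map_zero, smul_zero]
  change _ + (bracketPart k _ A).1 0 = _
  rw [hfirst, zero_add]
  cases k with
  | zero => rfl
  | succ k =>
    change -(∑ i : Fin (k + 1), ∑ j ≥ i, (-1 : ℂ) ^ (i + j : ℕ) • coeffEquiv S hΔ (k + 1) ω
      (Matrix.vecCons ⁅A i.castSucc, A j.succ⁆ (j.removeNth (i.castSucc.removeNth A)))).1 0 =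
      ceDiffSucc _ _ _ A
    rw [ceDiffSucc_apply, entire_sum_apply]
    congr 1
    refine Finset.sum_congr rfl fun i _ => ?_
    rw [entire_sum_apply]
    rfl

theorem eq_const_of_homogeneous (S : LinearFrame Δ) (h0 : Δ ≠ 0) {f : entireFunctions n}
    (h : ∀ (t : ℂ) (x : Fin n → ℂ), t ≠ 0 → Δ.1 x ≠ 0 → Δ.1 (t • x) ≠ 0 → f.1 (t • x) = f.1 x)
    (x : Fin n → ℂ) : f.1 x = f.1 0 := by
  refine congrFun (eq_of_eq_off_divisor h0 (entire_continuous f)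
    (g := fun _ => f.1 0) continuous_const fun y hy => ?_) x
  have hne : ∀ t : ℂ, t ∈ ({0}ᶜ : Set ℂ) → f.1 (t • y) = f.1 y := fun t ht =>
    h t y ht hy fun h => hy ((S.smul_mem_divisor_iff h0 ht).1 h)
  have := congrFun (Continuous.ext_on (dense_compl_singleton (0 : ℂ))
    ((entire_continuous f).comp (by fun_prop : Continuous fun t : ℂ => t • y))
    continuous_const hne) 0
  simpa using this.symm

/-- The k linear fields absorb the factor t^k, so the coefficient is constant on each punctured line
through a point off D; letting t tend to 0 identifies the constant with the value at the origin. -/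
theorem coeff_eq_const (S : LinearFrame Δ) (hΔ : IsReducedEquation Δ) {ω : FormOn n k}
    (hω : ω ∈ degZeroForms Δ k) {a : linearLogFields Δ [⋀^Fin k]→ₗ[ℂ] entireFunctions n}
    (ha : HasCoeff ω a) (A : Fin k → linearLogFields Δ) (x : Fin n → ℂ) :
    (a A).1 x = (a A).1 0 := by
  refine eq_const_of_homogeneous S hΔ.ne_zero (fun t y ht hy hty => ?_) x
  rw [ha _ hty, ha _ hy, ← hω.2 t y ht hy hty]
  simp only [evalField_smul, LinearMap.smul_apply]
  have := (ω (t • y)).toMultilinearMap.map_smul_univ (fun _ => t) fun i => evalField Δ y (A i)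
  simp only [Finset.prod_const, Finset.card_univ, Fintype.card_fin] at this
  exact this

theorem mem_degZeroForms_of_const (S : LinearFrame Δ) {ω : FormOn n k}
    (hω : ω ∈ logForms Δ k) {a : linearLogFields Δ [⋀^Fin k]→ₗ[ℂ] entireFunctions n}
    (ha : HasCoeff ω a) (hc : ∀ A x, (a A).1 x = (a A).1 0) : ω ∈ degZeroForms Δ k := by
  refine ⟨hω, fun t x ht hx htx => ?_⟩
  ext v
  choose A hA using fun i => (S.evalField_bijective hx).2 (v i)
  obtain rfl : (fun i => evalField Δ x (A i)) = v := funext hA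
  have h1 := ha _ htx A
  rw [hc, ← hc A x, ha _ hx A] at h1
  rw [h1]
  simp only [evalField_smul, LinearMap.smul_apply]
  have := (ω (t • x)).toMultilinearMap.map_smul_univ (fun _ => t) fun i => evalField Δ x (A i)
  simp only [Finset.prod_const, Finset.card_univ, Fintype.card_fin] at this
  exact this.symm

/-- Constant functions as entire functions. -/
def constEntire (n : ℕ) : ℂ →ₗ[ℂ] entireFunctions n := Algebra.linearMap ℂ (entireFunctions n)

/-- Logarithmic forms of degree zero are the alternating forms on the Lie algebra of linear
logarithmic fields. -/
def degZeroEquiv (S : LinearFrame Δ) (hΔ : IsReducedEquation Δ) (k : ℕ) :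
    degZeroForms Δ k ≃ₗ[ℂ] (linearLogFields Δ [⋀^Fin k]→ₗ[ℂ] ℂ) :=
  LinearEquiv.ofBijective
    ((coeffAtZero S hΔ k).comp (Submodule.inclusion (degZeroForms_le Δ k))) <| by
    constructor
    · refine (injective_iff_map_eq_zero _).2 fun ω hω => ?_
      have h : coeffEquiv S hΔ k (Submodule.inclusion (degZeroForms_le Δ k) ω) = 0 := by
        ext1 A
        ext x
        rw [coeff_eq_const S hΔ ω.2 (hasCoeff_coeffEquiv S hΔ
          (Submodule.inclusion (degZeroForms_le Δ k) ω)) A x]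
        exact congrArg (fun φ => φ A) hω
      have h2 := (LinearEquiv.map_eq_zero_iff _).1 h
      exact Submodule.inclusion_injective _ (h2.trans (map_zero _).symm)
    · intro c
      let a := (constEntire n).compAlternatingMap c
      have ha := hasCoeff_formOfCoeff S a
      refine ⟨⟨formOfCoeff S a, mem_degZeroForms_of_const S (formOfCoeff_mem_logForms S hΔ a) ha
        fun A x => rfl⟩, ?_⟩
      have h := (coeffEquiv S hΔ k).apply_symm_apply a
      ext1 A
      exact congrArg (fun φ : linearLogFields Δ [⋀^Fin k]→ₗ[ℂ] entireFunctions n =>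
        (φ A).1 0) h

theorem degZeroEquiv_apply (S : LinearFrame Δ) (hΔ : IsReducedEquation Δ) (ω : degZeroForms Δ k)
    (A : Fin k → linearLogFields Δ) {x : Fin n → ℂ} (hx : Δ.1 x ≠ 0) :
    degZeroEquiv S hΔ k ω A = ω.1 x fun i => evalField Δ x (A i) := by
  have h := hasCoeff_coeffEquiv S hΔ (Submodule.inclusion (degZeroForms_le Δ k) ω)
  exact (coeff_eq_const S hΔ ω.2 h A x).symm.trans (h x hx A)

/-- Evaluation of the coefficients at the origin, as a morphism of complexes. -/
def coeffAtZeroHom (S : LinearFrame Δ) (hΔ : IsReducedEquation Δ) :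
    logComplex Δ ⟶ ceComplex (linearLogFields Δ) :=
  CochainComplex.ofHom (fun k => ModuleCat.ofHom (coeffAtZero S hΔ k)) (fun k => by
    simp only [logComplex, ceComplex, CochainComplex.of_d]
    ext ω : 2
    exact (coeffAtZero_logD S hΔ ω).symm)

theorem isIso_degZeroInclusion_comp (S : LinearFrame Δ) (hΔ : IsReducedEquation Δ) :
    IsIso (degZeroInclusion Δ ≫ coeffAtZeroHom S hΔ) := by
  have : ∀ k, IsIso ((degZeroInclusion Δ ≫ coeffAtZeroHom S hΔ).f k) := fun k =>
    (ConcreteCategory.isIso_iff_bijective _).2 (degZeroEquiv S hΔ k).bijective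
  exact HomologicalComplex.Hom.isIso_of_components _

/-- The complex of logarithmic forms of degree zero is the Chevalley--Eilenberg complex. -/
def degZeroIso (S : LinearFrame Δ) (hΔ : IsReducedEquation Δ) :
    degZeroComplex Δ ≅ ceComplex (linearLogFields Δ) :=
  have := isIso_degZeroInclusion_comp S hΔ
  asIso (degZeroInclusion Δ ≫ coeffAtZeroHom S hΔ)

theorem degZeroIso_hom_apply (S : LinearFrame Δ) (hΔ : IsReducedEquation Δ) (k : ℕ)
    (ω : degZeroForms Δ k) (A : Fin k → linearLogFields Δ) {x : Fin n → ℂ}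
    (hx : x ∉ divisorSet Δ) :
    (show linearLogFields Δ [⋀^Fin k]→ₗ[ℂ] ℂ from ((degZeroIso S hΔ).hom.f k).hom ω) A =
      ω.1 x (fun i => linearField (A i).1 x) :=
  degZeroEquiv_apply S hΔ ω A hx

end LFD
end

/-! ### Inverting the Euler derivation on entire functions -/

noncomputable section

namespace LFD

section Taylor

variable {E F : Type*} [NormedAddCommGroup E] [NormedSpace ℂ E] [NormedAddCommGroup F]
  [NormedSpace ℂ F]

/-- Cauchy's estimate in one variable on the complex line through x in direction v, where the disc
of radius ρ / ‖v‖ is mapped into the given ball. -/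
theorem norm_fderiv_le_of_bound {g : E → F} (hg : Differentiable ℂ g) {x : E} {ρ C : ℝ}
    (hρ : 0 < ρ) (hC : ∀ y ∈ Metric.closedBall x ρ, ‖g y‖ ≤ C) : ‖fderiv ℂ g x‖ ≤ C / ρ := by
  have hC0 : 0 ≤ C := (norm_nonneg _).trans (hC x (Metric.mem_closedBall_self hρ.le))
  refine ContinuousLinearMap.opNorm_le_bound _ (by positivity) fun v => ?_
  by_cases hv : v = 0
  · simp [hv]
  have hv' : 0 < ‖v‖ := norm_pos_iff.2 hv
  have hline : Differentiable ℂ fun z : ℂ => g (x + z • v) := hg.comp (by fun_prop)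
  have hd : HasDerivAt (fun z : ℂ => g (x + z • v)) (fderiv ℂ g x v) 0 := by
    have h1 : HasDerivAt (fun z : ℂ => x + z • v) v 0 := by
      simpa using ((hasDerivAt_id (0 : ℂ)).smul_const v).const_add x
    have h2 := (hg (x + (0 : ℂ) • v)).hasFDerivAt.comp_hasDerivAt 0 h1
    simpa only [zero_smul, add_zero] using! h2
  have := Complex.norm_deriv_le_of_forall_mem_sphere_norm_le (c := 0) (R := ρ / ‖v‖) (C := C)
    (by positivity) hline.diffContOnCl fun z hz => hC _ (by
      rw [mem_closedBall_iff_norm, add_sub_cancel_left, norm_smul, mem_sphere_zero_iff_norm.1 hz,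
        div_mul_cancel₀ _ hv'.ne'])
  rw [hd.deriv] at this
  refine this.trans (le_of_eq ?_)
  field_simp

/-- Each derivative costs ρ of the radius and a factor 1 / ρ, by `norm_fderiv_le_of_bound`. -/
theorem norm_iteratedFDeriv_le_of_bound [CompleteSpace F] {f : E → F}
    (hf : AnalyticOnNhd ℂ f Set.univ)
    {R C ρ : ℝ} (hρ : 0 < ρ) (hC : ∀ y ∈ Metric.closedBall 0 R, ‖f y‖ ≤ C) (j : ℕ) :
    ∀ x ∈ Metric.closedBall (0 : E) (R - j * ρ), ‖iteratedFDeriv ℂ j f x‖ ≤ C / ρ ^ j := by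
  induction j with
  | zero => intro x hx; simpa using hC x (by simpa using hx)
  | succ j ih =>
    intro x hx
    rw [← norm_fderiv_iteratedFDeriv]
    have hd : Differentiable ℂ (iteratedFDeriv ℂ j f) := fun y =>
      (hf.iteratedFDeriv j y (Set.mem_univ y)).differentiableAt
    have := norm_fderiv_le_of_bound hd hρ (x := x) (C := C / ρ ^ j) fun y hy => ih y (by
      rw [mem_closedBall_zero_iff] at hx ⊢
      rw [mem_closedBall_iff_norm] at hy
      have := norm_le_norm_add_norm_sub' y x
      push_cast at hx
      linarith)
    rwa [div_div, ← pow_succ] at this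

theorem norm_iteratedFDeriv_zero_le [CompleteSpace F] {f : E → F}
    (hf : AnalyticOnNhd ℂ f Set.univ)
    {r C : ℝ} (hr : 0 < r) (hC : ∀ y ∈ Metric.closedBall 0 (r * Real.exp 1), ‖f y‖ ≤ C) (m : ℕ) :
    ‖iteratedFDeriv ℂ m f 0‖ * r ^ m ≤ C * m.factorial := by
  have hC0 : 0 ≤ C := (norm_nonneg _).trans (hC 0 (Metric.mem_closedBall_self (by positivity)))
  rcases Nat.eq_zero_or_pos m with rfl | hm
  · simpa using hC 0 (Metric.mem_closedBall_self (by positivity))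
  have hm' : (0 : ℝ) < m := by exact_mod_cast hm
  -- The radius r e is divided evenly among the m derivatives. This gives the bound C (m / (r e))^m,
  -- and m^m ≤ e^m m! turns it into C m! / r^m.
  have h := norm_iteratedFDeriv_le_of_bound hf (ρ := r * Real.exp 1 / m) (by positivity) hC m 0
    (by rw [mul_div_cancel₀ _ hm'.ne', sub_self]; simp)
  refine (mul_le_mul_of_nonneg_right h (by positivity)).trans ?_
  have h2 := Real.pow_div_factorial_le_exp (m : ℝ) hm'.le m
  have h3 : Real.exp m = Real.exp 1 ^ m := by rw [← Real.exp_nat_mul, mul_one]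
  rw [h3, div_le_iff₀ (by positivity)] at h2
  rw [div_pow, mul_pow]
  have h4 : C / (r ^ m * Real.exp 1 ^ m / (m : ℝ) ^ m) * r ^ m =
      C * ((m : ℝ) ^ m / Real.exp 1 ^ m) := by
    field_simp
  rw [h4]
  refine mul_le_mul_of_nonneg_left ?_ hC0
  rw [div_le_iff₀ (by positivity), mul_comm]
  exact h2

end Taylor

variable {n : ℕ}

/-- The power series at the origin whose Euler derivative is the Taylor series of `f - f 0`. -/
def eulerSeries (f : entireFunctions n) : FormalMultilinearSeries ℂ (Fin n → ℂ) ℂ := fun m =>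
  -- For m = 0 the inverse is 0 by convention, so the constant term is dropped.
  ((m : ℂ)⁻¹ * (m.factorial : ℂ)⁻¹) • iteratedFDeriv ℂ m f.1 0

theorem eulerSeries_radius (f : entireFunctions n) : (eulerSeries f).radius = ⊤ := by
  refine ENNReal.eq_top_of_forall_nnreal_le fun r => ?_
  -- The estimate needs a positive radius, while r may be 0.
  have h1 : (r : ENNReal) ≤ ((r + 1 : NNReal) : ENNReal) := by exact_mod_cast le_self_add
  refine h1.trans ?_
  obtain ⟨C, hC⟩ := (isCompact_closedBall (0 : Fin n → ℂ)
    (((r + 1 : NNReal) : ℝ) * Real.exp 1)).exists_bound_of_continuousOn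
    (entire_continuous f).continuousOn
  refine FormalMultilinearSeries.le_radius_of_bound _ C fun m => ?_
  have h := norm_iteratedFDeriv_zero_le f.2 (r := ((r + 1 : NNReal) : ℝ)) (by positivity) hC m
  rw [eulerSeries, norm_smul, norm_mul, norm_inv, norm_inv, Complex.norm_natCast,
    Complex.norm_natCast]
  have hm : ((m : ℝ))⁻¹ ≤ 1 := by
    rcases Nat.eq_zero_or_pos m with rfl | hm
    · simp
    · exact inv_le_one_of_one_le₀ (by exact_mod_cast hm)
  calc (m : ℝ)⁻¹ * (m.factorial : ℝ)⁻¹ * ‖iteratedFDeriv ℂ m f.1 0‖ * ((r + 1 : NNReal) : ℝ) ^ m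
      = (m : ℝ)⁻¹ * ((m.factorial : ℝ)⁻¹ *
        (‖iteratedFDeriv ℂ m f.1 0‖ * ((r + 1 : NNReal) : ℝ) ^ m)) := by ring
    _ ≤ 1 * ((m.factorial : ℝ)⁻¹ *
        (‖iteratedFDeriv ℂ m f.1 0‖ * ((r + 1 : NNReal) : ℝ) ^ m)) := by gcongr
    _ ≤ 1 * ((m.factorial : ℝ)⁻¹ * (C * m.factorial)) := by gcongr
    _ = C := by field_simp

theorem iteratedDeriv_line (f : entireFunctions n) (x : Fin n → ℂ) (m : ℕ) :
    iteratedDeriv m (fun z : ℂ => f.1 (z • x)) 0 = iteratedFDeriv ℂ m f.1 0 fun _ => x := by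
  have hf : ContDiff ℂ m f.1 := contDiff_iff_contDiffAt.2 fun y =>
    (f.2 y (Set.mem_univ y)).contDiffAt
  have := ContinuousLinearMap.iteratedFDeriv_comp_right
    ((ContinuousLinearMap.id ℂ ℂ).smulRight x) hf (0 : ℂ) le_rfl
  rw [iteratedDeriv_eq_iteratedFDeriv]
  have e : (fun z : ℂ => f.1 (z • x)) = f.1 ∘ ((ContinuousLinearMap.id ℂ ℂ).smulRight x) := by
    funext z; simp
  rw [e, this]
  simp

/-- E multiplies the homogeneous part of degree m by m, so dividing that part of f by m solves the
equation up to the constant term. The identity is checked at z = 1 on the line z ↦ z • x, by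
comparing Taylor series in one variable. -/
theorem exists_euler_primitive (f : entireFunctions n) :
    ∃ g : entireFunctions n, fieldDeriv 1 g = f - constEntire n (f.1 0) ∧ g.1 0 = 0 := by
  have hrad := eulerSeries_radius f
  have hs := (eulerSeries f).hasFPowerSeriesOnBall (by rw [hrad]; simp)
  rw [hrad] at hs
  have hg : AnalyticOnNhd ℂ (eulerSeries f).sum Set.univ := by
    have := hs.analyticOnNhd
    rwa [Metric.eball_top] at this
  let g : entireFunctions n := ⟨(eulerSeries f).sum, hg⟩
  have hcoef : ∀ m x, (iteratedFDeriv ℂ m g.1 0 fun _ => x) =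
      (m : ℂ)⁻¹ * iteratedFDeriv ℂ m f.1 0 fun _ => x := by
    intro m x
    have := hs.factorial_smul x m
    rw [← this, eulerSeries]
    simp only [smul_apply, smul_eq_mul, nsmul_eq_mul]
    have : (m.factorial : ℂ) ≠ 0 := by exact_mod_cast m.factorial_ne_zero
    field_simp
  have hline : ∀ (h : entireFunctions n) x, Differentiable ℂ fun z : ℂ => h.1 (z • x) :=
    fun h x => (entire_differentiable h).comp (by fun_prop)
  refine ⟨g, ?_, ?_⟩
  · ext x
    change fderiv ℂ g.1 x (linearField 1 x) = f.1 x - f.1 0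
    have e1 : linearField (1 : Matrix (Fin n) (Fin n) ℂ) x = x := Matrix.vecMul_one x
    rw [e1]
    let φ : ℂ → ℂ := fun z => f.1 (z • x)
    let γ : ℂ → ℂ := fun z => g.1 (z • x)
    have hd : deriv γ 1 = fderiv ℂ g.1 x x := by
      have h2 : HasDerivAt (fun t : ℂ => t • x) x 1 := by
        simpa using (hasDerivAt_id (1 : ℂ)).smul_const x
      have h3 := (entire_differentiable g ((1 : ℂ) • x)).hasFDerivAt.comp_hasDerivAt 1 h2
      rw [one_smul] at h3
      exact h3.deriv
    rw [← hd]
    have hγ' : Differentiable ℂ (deriv γ) := fun z =>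
      (((hline g x).differentiableOn (s := Set.univ)).deriv isOpen_univ).differentiableAt
        Filter.univ_mem
    have s1 := Complex.hasSum_taylorSeries_of_entire hγ' 0 1
    have s2 := Complex.hasSum_taylorSeries_of_entire (hline f x) 0 1
    have s3 := (hasSum_nat_add_iff' 1).2 s2
    -- The factor 1 / (m + 1) from `hcoef` turns 1 / m! into 1 / (m + 1)!, so the series of γ' is
    -- that of z ↦ f(z • x) without its first term.
    have hterm : ∀ m : ℕ, ((m.factorial : ℂ)⁻¹ • (1 - 0 : ℂ) ^ m • iteratedDeriv m (deriv γ) 0) =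
        ((m + 1).factorial : ℂ)⁻¹ • (1 - 0 : ℂ) ^ (m + 1) •
          iteratedDeriv (m + 1) (fun z : ℂ => f.1 (z • x)) 0 := by
      intro m
      rw [← iteratedDeriv_succ', iteratedDeriv_line f, iteratedDeriv_line g, hcoef,
        Nat.factorial_succ]
      simp only [sub_zero, one_pow, smul_eq_mul]
      push_cast
      rw [mul_inv]
      ring
    rw [funext hterm] at s1
    have := s1.unique s3
    rw [this]
    simp
  · have h0 := hcoef 0 0
    simpa using h0

theorem eq_const_of_euler_zero {f : entireFunctions n} (h : fieldDeriv 1 f = 0)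
    (x : Fin n → ℂ) : f.1 x = f.1 0 := by
  have hdiff : Differentiable ℂ fun z : ℂ => f.1 (z • x) :=
    (entire_differentiable f).comp (by fun_prop)
  have hd : ∀ z : ℂ, HasDerivAt (fun z : ℂ => f.1 (z • x)) (fderiv ℂ f.1 (z • x) x) z := fun z => by
    have h2 : HasDerivAt (fun t : ℂ => t • x) x z := by
      simpa using (hasDerivAt_id z).smul_const x
    exact (entire_differentiable f (z • x)).hasFDerivAt.comp_hasDerivAt z h2
  -- The Euler equation at z • x carries a factor z, which can be removed only for z ≠ 0; the value
  -- at z = 0 follows by continuity.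
  have hne : ∀ z : ℂ, z ∈ ({0}ᶜ : Set ℂ) → fderiv ℂ f.1 (z • x) x = 0 := by
    intro z hz
    have h1 := congrFun (congrArg Subtype.val h) (z • x)
    rw [fieldDeriv_apply, show linearField (1 : Matrix (Fin n) (Fin n) ℂ) (z • x) = z • x from
      Matrix.vecMul_one _, map_smul] at h1
    exact (smul_eq_zero.1 h1).resolve_left hz
  have hc : Continuous fun z : ℂ => fderiv ℂ f.1 (z • x) x :=
    (entire_continuous ⟨_, fderiv_entire_analyticOnNhd f (v := fun _ => x)
      analyticOnNhd_const⟩).comp (by fun_prop : Continuous fun z : ℂ => z • x)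
  have hz := congrFun (Continuous.ext_on (dense_compl_singleton (0 : ℂ)) hc continuous_const hne)
  have := is_const_of_deriv_eq_zero hdiff (fun z => (hd z).deriv.trans (hz z)) 1 0
  simpa using this

theorem eq_of_euler_eq {f g : entireFunctions n} (h : fieldDeriv 1 f = fieldDeriv 1 g)
    (h0 : f.1 0 = g.1 0) : f = g := by
  have h1 : fieldDeriv 1 (f - g) = 0 := by rw [map_sub, h, sub_self]
  ext x
  have h2 : f.1 x - g.1 x = f.1 0 - g.1 0 := eq_const_of_euler_zero h1 x
  rw [h0, sub_self] at h2
  exact sub_eq_zero.1 h2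

/-- The right inverse of the Euler field on entire functions that vanish at the origin. -/
def eulerInv (n : ℕ) : entireFunctions n →ₗ[ℂ] entireFunctions n where
  toFun f := (exists_euler_primitive f).choose
  map_add' f g := by
    have hf := (exists_euler_primitive f).choose_spec
    have hg := (exists_euler_primitive g).choose_spec
    have hfg := (exists_euler_primitive (f + g)).choose_spec
    refine eq_of_euler_eq ?_ ?_
    · rw [hfg.1, map_add, hf.1, hg.1,
        show constEntire n ((f + g).1 0) = constEntire n (f.1 0) + constEntire n (g.1 0) from
          map_add _ _ _]
      abel
    · rw [hfg.2]
      exact ((congrArg₂ (· + ·) hf.2 hg.2).trans (add_zero 0)).symm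
  map_smul' c f := by
    have hf := (exists_euler_primitive f).choose_spec
    have hcf := (exists_euler_primitive (c • f)).choose_spec
    refine eq_of_euler_eq ?_ ?_
    · rw [hcf.1, RingHom.id_apply, map_smul, hf.1,
        show constEntire n ((c • f).1 0) = c • constEntire n (f.1 0) from
          (constEntire n).map_smul c (f.1 0), smul_sub]
    · rw [hcf.2]
      exact ((congrArg (c • ·) hf.2).trans (smul_zero c)).symm

theorem fieldDeriv_eulerInv (f : entireFunctions n) :
    fieldDeriv 1 (eulerInv n f) = f - constEntire n (f.1 0) :=
  (exists_euler_primitive f).choose_spec.1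

theorem eulerInv_apply_zero (f : entireFunctions n) : (eulerInv n f).1 0 = 0 :=
  (exists_euler_primitive f).choose_spec.2

theorem fieldDeriv_apply_zero (A : Matrix (Fin n) (Fin n) ℂ) (f : entireFunctions n) :
    (fieldDeriv A f).1 0 = 0 := by
  rw [fieldDeriv_apply, linearField_zero_right, ContinuousLinearMap.map_zero]

theorem fieldDeriv_const (A : Matrix (Fin n) (Fin n) ℂ) (c : ℂ) :
    fieldDeriv A (constEntire n c) = 0 := by
  ext x
  change fderiv ℂ (fun _ => c) x _ = 0
  simp

theorem fieldDeriv_one_comm (A : Matrix (Fin n) (Fin n) ℂ) (f : entireFunctions n) :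
    fieldDeriv 1 (fieldDeriv A f) = fieldDeriv A (fieldDeriv 1 f) := by
  ext x
  have hsym : IsSymmSndFDerivAt ℂ f.1 x :=
    ((f.2 x (Set.mem_univ x)).contDiffAt (n := ⊤)).isSymmSndFDerivAt (by simp)
  have h1 := fderiv_dir_linearField f.2 A x (linearField 1 x)
  have h2 := fderiv_dir_linearField f.2 1 x (linearField A x)
  refine h1.trans (Eq.trans ?_ h2.symm)
  have e : ∀ y, linearField (1 : Matrix (Fin n) (Fin n) ℂ) y = y := Matrix.vecMul_one
  rw [hsym.eq]
  simp only [e]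

/-- Linear fields commute with E and their derivatives vanish at the origin. Both sides therefore
have the same Euler derivative and the same value at 0, which determines them. -/
theorem eulerInv_fieldDeriv (A : Matrix (Fin n) (Fin n) ℂ) (f : entireFunctions n) :
    eulerInv n (fieldDeriv A f) = fieldDeriv A (eulerInv n f) := by
  refine eq_of_euler_eq ?_ ?_
  · rw [fieldDeriv_eulerInv, fieldDeriv_one_comm, fieldDeriv_eulerInv, map_sub,
      fieldDeriv_apply_zero, fieldDeriv_const, map_zero]
  · rw [eulerInv_apply_zero, fieldDeriv_apply_zero]

end LFD
end

/-! ### The Euler homotopy -/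

noncomputable section

namespace LFD

variable {n : ℕ} {Δ : entireFunctions n} {k : ℕ}

/-- The Euler field as an element of the Lie algebra of linear logarithmic fields. -/
def eulerField (S : LinearFrame Δ) (hΔ : IsReducedEquation Δ) : linearLogFields Δ :=
  ⟨1, S.one_mem hΔ⟩

theorem eulerField_lie (S : LinearFrame Δ) (hΔ : IsReducedEquation Δ) (A : linearLogFields Δ) :
    ⁅eulerField S hΔ, A⁆ = 0 := by
  apply Subtype.ext
  change ⁅(1 : Matrix (Fin n) (Fin n) ℂ), A.1⁆ = 0
  rw [Ring.lie_def, one_mul, mul_one, sub_self]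

theorem swap_vecCons (b : linearLogFields Δ [⋀^Fin (k + 2)]→ₗ[ℂ] entireFunctions n)
    (x y : linearLogFields Δ) (v : Fin k → linearLogFields Δ) :
    b (Matrix.vecCons x (Matrix.vecCons y v)) = -b (Matrix.vecCons y (Matrix.vecCons x v)) := by
  ext z
  exact ceSwap ((evalAt z).compAlternatingMap b) x y v

theorem sum_ge_succ (m : ℕ) (i : Fin m) (f : Fin (m + 1) → entireFunctions n) :
    ∑ j ≥ i.succ, f j = ∑ j ≥ i, f j.succ := by
  have hI : ∀ (N : ℕ) (i : Fin N) (f : Fin N → entireFunctions n),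
      ∑ j ≥ i, f j = ∑ j, if i ≤ j then f j else 0 := fun N i f => by
    rw [← Finset.sum_filter]
    exact Finset.sum_congr (by ext; simp) fun _ _ => rfl
  rw [hI, hI, Fin.sum_univ_succ, if_neg (by simp), zero_add]
  simp only [Fin.succ_le_succ_iff]

/-- Brackets with E vanish since the identity matrix is central. In the remaining terms E is moved
past the bracket, which gives the sign. -/
theorem bracketPart_euler (S : LinearFrame Δ) (hΔ : IsReducedEquation Δ)
    (b : linearLogFields Δ [⋀^Fin (k + 1)]→ₗ[ℂ] entireFunctions n)
    (A : Fin (k + 1) → linearLogFields Δ) :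
    bracketPart (k + 1) b (Matrix.vecCons (eulerField S hΔ) A) =
      -bracketPart k (b.curryLeft (eulerField S hΔ)) A := by
  rw [bracketPart, Fin.sum_univ_succ]
  have h0 : ∑ j ≥ (0 : Fin (k + 1)), (-1 : ℂ) ^ (((0 : Fin (k + 1)) : ℕ) + (j : ℕ)) •
      b (Matrix.vecCons ⁅(Matrix.vecCons (eulerField S hΔ) A : Fin (k + 2) → _) (Fin.castSucc 0),
        (Matrix.vecCons (eulerField S hΔ) A : Fin (k + 2) → _) j.succ⁆
        (j.removeNth ((Fin.castSucc 0).removeNth (Matrix.vecCons (eulerField S hΔ) A)))) = 0 := by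
    refine Finset.sum_eq_zero fun j _ => ?_
    have e : ⁅(Matrix.vecCons (eulerField S hΔ) A : Fin (k + 2) → _) (Fin.castSucc 0),
        (Matrix.vecCons (eulerField S hΔ) A : Fin (k + 2) → _) j.succ⁆ = 0 := eulerField_lie S hΔ _
    rw [e, b.map_coord_zero 0 rfl, smul_zero]
  rw [h0, zero_add]
  cases k with
  | zero => simp [bracketPart]
  | succ k =>
    rw [bracketPart, neg_neg, ← Finset.sum_neg_distrib]
    refine Finset.sum_congr rfl fun i _ => ?_
    rw [sum_ge_succ, ← Finset.sum_neg_distrib]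
    refine Finset.sum_congr rfl fun j _ => ?_
    rw [← Fin.succ_castSucc, removeNth_succ_vecCons, removeNth_succ_vecCons]
    simp only [Matrix.cons_val_succ, AlternatingMap.curryLeft_apply_apply]
    have hp : (-1 : ℂ) ^ ((i.succ : ℕ) + (j.succ : ℕ)) = (-1) ^ ((i : ℕ) + (j : ℕ)) := by
      rw [Fin.val_succ, Fin.val_succ]
      ring
    rw [swap_vecCons, smul_neg, hp, neg_neg]

/-- Cartan's formula for the Lie derivative along E. As E is central, this Lie derivative only
differentiates the coefficients. -/
theorem coeffDiff_euler (S : LinearFrame Δ) (hΔ : IsReducedEquation Δ)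
    (b : linearLogFields Δ [⋀^Fin (k + 1)]→ₗ[ℂ] entireFunctions n)
    (A : Fin (k + 1) → linearLogFields Δ) :
    coeffDiff (k + 1) b (Matrix.vecCons (eulerField S hΔ) A) =
      fieldDeriv 1 (b A) - coeffDiff k (b.curryLeft (eulerField S hΔ)) A := by
  rw [coeffDiff, coeffDiff, bracketPart_euler, Fin.sum_univ_succ]
  have h0 : (-1 : ℂ) ^ (((0 : Fin (k + 2)) : ℕ)) •
      fieldDeriv ((Matrix.vecCons (eulerField S hΔ) A : Fin (k + 2) → _) 0).1
        (b (Fin.removeNth 0 (Matrix.vecCons (eulerField S hΔ) A : Fin (k + 2) → _))) =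
      fieldDeriv 1 (b A) := by
    rw [Fin.val_zero, pow_zero, one_smul]
    rfl
  have h1 : ∑ i : Fin (k + 1), (-1 : ℂ) ^ (i.succ : ℕ) •
      fieldDeriv ((Matrix.vecCons (eulerField S hΔ) A : Fin (k + 2) → _) i.succ).1
        (b (Fin.removeNth i.succ (Matrix.vecCons (eulerField S hΔ) A : Fin (k + 2) → _))) =
      -∑ i : Fin (k + 1), (-1 : ℂ) ^ (i : ℕ) •
        fieldDeriv (A i).1 (b.curryLeft (eulerField S hΔ) (i.removeNth A)) := by
    rw [← Finset.sum_neg_distrib]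
    refine Finset.sum_congr rfl fun i _ => ?_
    rw [removeNth_succ_vecCons, Fin.val_succ, pow_succ, mul_neg_one, neg_smul]
    rfl
  rw [h0, h1]
  abel

/-- The differential is built from derivatives along linear fields and ℂ-linear combinations, and
`eulerInv` commutes with both. -/
theorem coeffDiff_eulerInv (b : linearLogFields Δ [⋀^Fin k]→ₗ[ℂ] entireFunctions n)
    (A : Fin (k + 1) → linearLogFields Δ) :
    coeffDiff k ((eulerInv n).compAlternatingMap b) A = eulerInv n (coeffDiff k b A) := by
  rw [coeffDiff, coeffDiff, map_add, map_sum]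
  congr 1
  · refine Finset.sum_congr rfl fun i _ => ?_
    rw [map_smul, eulerInv_fieldDeriv]
    rfl
  · cases k with
    | zero => exact (map_zero _).symm
    | succ k =>
      rw [bracketPart, bracketPart, map_neg, map_sum]
      congr 1
      refine Finset.sum_congr rfl fun i _ => ?_
      rw [map_sum]
      refine Finset.sum_congr rfl fun j _ => ?_
      rw [map_smul]
      rfl

/-- Contraction with `x` followed by `eulerInv`. -/
def eulerContraction (x : linearLogFields Δ) (k : ℕ) :
    (linearLogFields Δ [⋀^Fin (k + 1)]→ₗ[ℂ] entireFunctions n) →ₗ[ℂ]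
      (linearLogFields Δ [⋀^Fin k]→ₗ[ℂ] entireFunctions n) where
  toFun b := (eulerInv n).compAlternatingMap (b.curryLeft x)
  map_add' b c := by
    ext1 A
    exact map_add (eulerInv n) _ _
  map_smul' c b := by
    ext1 A
    exact map_smul (eulerInv n) c _

/-- The homotopy operator: contraction with the Euler field followed by `eulerInv`. -/
def eulerHomotopy (S : LinearFrame Δ) (hΔ : IsReducedEquation Δ) (k : ℕ) :
    logForms Δ (k + 1) →ₗ[ℂ] logForms Δ k :=
  (coeffEquiv S hΔ k).symm.toLinearMap ∘ₗ eulerContraction (eulerField S hΔ) k ∘ₗ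
    (coeffEquiv S hΔ (k + 1)).toLinearMap

theorem coeffEquiv_eulerHomotopy (S : LinearFrame Δ) (hΔ : IsReducedEquation Δ)
    (ω : logForms Δ (k + 1)) (A : Fin k → linearLogFields Δ) :
    coeffEquiv S hΔ k (eulerHomotopy S hΔ k ω) A =
      eulerInv n (coeffEquiv S hΔ (k + 1) ω (Matrix.vecCons (eulerField S hΔ) A)) := by
  change coeffEquiv S hΔ k ((coeffEquiv S hΔ k).symm _) A = _
  rw [LinearEquiv.apply_symm_apply]
  rfl

theorem eulerInv_fieldDeriv_one (f : entireFunctions n) :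
    eulerInv n (fieldDeriv 1 f) = f - constEntire n (f.1 0) := by
  rw [eulerInv_fieldDeriv, fieldDeriv_eulerInv]

/-- The morphism from the Chevalley--Eilenberg complex to the logarithmic forms. -/
def constCoeffHom (S : LinearFrame Δ) (hΔ : IsReducedEquation Δ) :
    ceComplex (linearLogFields Δ) ⟶ logComplex Δ :=
  (degZeroIso S hΔ).inv ≫ degZeroInclusion Δ

/-- The logarithmic form with given constant coefficients. -/
def constCoeff (S : LinearFrame Δ) (hΔ : IsReducedEquation Δ) (k : ℕ)
    (c : linearLogFields Δ [⋀^Fin k]→ₗ[ℂ] ℂ) : logForms Δ k :=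
  ((constCoeffHom S hΔ).f k).hom c

theorem constCoeffHom_comp (S : LinearFrame Δ) (hΔ : IsReducedEquation Δ) :
    constCoeffHom S hΔ ≫ coeffAtZeroHom S hΔ = 𝟙 _ := by
  rw [constCoeffHom, Category.assoc]
  exact (degZeroIso S hΔ).inv_hom_id

theorem coeffEquiv_constCoeff (S : LinearFrame Δ) (hΔ : IsReducedEquation Δ)
    (c : linearLogFields Δ [⋀^Fin k]→ₗ[ℂ] ℂ) (A : Fin k → linearLogFields Δ) :
    coeffEquiv S hΔ k (constCoeff S hΔ k c) A = constEntire n (c A) := by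
  let ω : degZeroForms Δ k := ((degZeroIso S hΔ).inv.f k).hom c
  have h1 : coeffAtZero S hΔ k (Submodule.inclusion (degZeroForms_le Δ k) ω) = c := by
    have h := congrArg (fun φ : ceComplex (linearLogFields Δ) ⟶ ceComplex (linearLogFields Δ) =>
      (φ.f k).hom c) (degZeroIso S hΔ).inv_hom_id
    exact h
  ext x
  refine (coeff_eq_const S hΔ ω.2 (hasCoeff_coeffEquiv S hΔ
    (Submodule.inclusion (degZeroForms_le Δ k) ω)) A x).trans ?_
  exact congrArg (fun φ => φ A) h1

theorem coeffEquiv_sub_apply (S : LinearFrame Δ) (hΔ : IsReducedEquation Δ) (ω η : logForms Δ k)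
    (A : Fin k → linearLogFields Δ) :
    coeffEquiv S hΔ k (ω - η) A = coeffEquiv S hΔ k ω A - coeffEquiv S hΔ k η A :=
  congrArg (fun φ : linearLogFields Δ [⋀^Fin k]→ₗ[ℂ] entireFunctions n => φ A)
    ((coeffEquiv S hΔ k).toLinearMap.map_sub ω η)

theorem sub_constCoeff_zero (S : LinearFrame Δ) (hΔ : IsReducedEquation Δ) (ω : logForms Δ 0) :
    ω - constCoeff S hΔ 0 (coeffAtZero S hΔ 0 ω) =
      eulerHomotopy S hΔ 0 (logD Δ 0 ω) := by
  apply (coeffEquiv S hΔ 0).injective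
  ext1 A
  rw [coeffEquiv_eulerHomotopy, coeffEquiv_logD, coeffDiff, bracketPart, add_zero,
    Fin.sum_univ_succ, Fin.sum_univ_zero, add_zero, Fin.val_zero, pow_zero, one_smul]
  have e : (Fin.removeNth 0 (Matrix.vecCons (eulerField S hΔ) A : Fin 1 → _)) = A := rfl
  rw [e]
  refine Eq.trans ?_ (eulerInv_fieldDeriv_one _).symm
  have h := coeffEquiv_constCoeff S hΔ (coeffAtZero S hΔ 0 ω) A
  rw [coeffEquiv_sub_apply, h]
  rfl

/-- The homotopy identity: applying `eulerInv` to Cartan's formula turns the Lie derivative of ω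
along E into ω minus its constant coefficients, and the term dι into d of the homotopy. -/
theorem sub_constCoeff_succ (S : LinearFrame Δ) (hΔ : IsReducedEquation Δ)
    (ω : logForms Δ (k + 1)) :
    ω - constCoeff S hΔ (k + 1) (coeffAtZero S hΔ (k + 1) ω) =
      logD Δ k (eulerHomotopy S hΔ k ω) + eulerHomotopy S hΔ (k + 1) (logD Δ (k + 1) ω) := by
  apply (coeffEquiv S hΔ (k + 1)).injective
  ext1 A
  have h1 : coeffEquiv S hΔ (k + 1) (logD Δ k (eulerHomotopy S hΔ k ω)) A =
      eulerInv n (coeffDiff k ((coeffEquiv S hΔ (k + 1) ω).curryLeft (eulerField S hΔ)) A) := by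
    rw [coeffEquiv_logD, ← coeffDiff_eulerInv]
    congr 1
    ext1 B
    exact coeffEquiv_eulerHomotopy S hΔ ω B
  have h := coeffEquiv_constCoeff S hΔ (coeffAtZero S hΔ (k + 1) ω) A
  rw [coeffEquiv_sub_apply, h, map_add,
    AlternatingMap.add_apply, h1, coeffEquiv_eulerHomotopy, coeffEquiv_logD, coeffDiff_euler,
    map_sub, eulerInv_fieldDeriv_one, add_sub_cancel]
  rfl

/-- The components of the homotopy between the identity and the projection to degree zero. -/
def eulerHomotopyHom (S : LinearFrame Δ) (hΔ : IsReducedEquation Δ) :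
    ∀ i j, (ComplexShape.up ℕ).Rel j i → ((logComplex Δ).X i ⟶ (logComplex Δ).X j) :=
  fun i j h => by
    have h' : j + 1 = i := h
    subst h'
    exact ModuleCat.ofHom (eulerHomotopy S hΔ j)

theorem id_sub_eq_nullHomotopicMap (S : LinearFrame Δ) (hΔ : IsReducedEquation Δ) :
    𝟙 (logComplex Δ) - coeffAtZeroHom S hΔ ≫ constCoeffHom S hΔ =
      Homotopy.nullHomotopicMap' (eulerHomotopyHom S hΔ) := by
  have hd : ∀ k, (logComplex Δ).d k (k + 1) = ModuleCat.ofHom (logD Δ k) := fun k => by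
    simp only [logComplex, CochainComplex.of_d]
  ext k : 1
  cases k with
  | zero =>
    rw [Homotopy.nullHomotopicMap'_f_of_not_rel_right
      (show (ComplexShape.up ℕ).Rel 0 1 from rfl) (by simp), hd]
    ext ω : 2
    exact sub_constCoeff_zero S hΔ ω
  | succ k =>
    rw [Homotopy.nullHomotopicMap'_f (show (ComplexShape.up ℕ).Rel k (k + 1) from rfl)
      (show (ComplexShape.up ℕ).Rel (k + 1) (k + 2) from rfl), hd, hd]
    ext ω : 2
    refine (sub_constCoeff_succ S hΔ ω).trans (add_comm _ _)

/-- The logarithmic complex is homotopy equivalent to the Chevalley--Eilenberg complex. -/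
def logHomotopyEquiv (S : LinearFrame Δ) (hΔ : IsReducedEquation Δ) :
    HomotopyEquiv (logComplex Δ) (ceComplex (linearLogFields Δ)) where
  hom := coeffAtZeroHom S hΔ
  inv := constCoeffHom S hΔ
  homotopyHomInvId := (Homotopy.equivSubZero.symm ((Homotopy.ofEq
    (id_sub_eq_nullHomotopicMap S hΔ)).trans (Homotopy.nullHomotopy' _))).symm
  homotopyInvHomId := Homotopy.ofEq (constCoeffHom_comp S hΔ)

/-- Two out of three: evaluation of coefficients at the origin is a homotopy equivalence, and its
composite with the inclusion is an isomorphism. -/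
theorem quasiIso_degZeroInclusion (S : LinearFrame Δ) (hΔ : IsReducedEquation Δ) :
    QuasiIso (degZeroInclusion Δ) := by
  have h1 : QuasiIso (coeffAtZeroHom S hΔ) :=
    (inferInstance : QuasiIso (logHomotopyEquiv S hΔ).hom)
  have h2 := isIso_degZeroInclusion_comp S hΔ
  exact quasiIso_of_comp_right (degZeroInclusion Δ) (coeffAtZeroHom S hΔ)

theorem nonempty_logCohomology_iso (S : LinearFrame Δ) (hΔ : IsReducedEquation Δ) (k : ℕ) :
    Nonempty (logCohomology Δ k ≅ lieCohomology (linearLogFields Δ) k) :=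
  ⟨(logHomotopyEquiv S hΔ).toHomologyIso k⟩

end LFD
end

/-! ### Matrix exponentials and conjugation -/

noncomputable section

namespace LFD

section ExpConjugation

open NormedSpace

variable {R : Type*} [NormedRing R] [NormedAlgebra ℂ R] [CompleteSpace R]

theorem hasSum_exp_apply {V : Type*} [NormedAddCommGroup V] [NormedSpace ℂ V] [CompleteSpace V]
    (T : V →L[ℂ] V) (v : V) :
    HasSum (fun k : ℕ => ((k.factorial : ℂ)⁻¹) • (T ^ k) v) (exp T v) := by
  have h := exp_series_hasSum_exp' (𝕂 := ℂ) T
  simpa using! (ContinuousLinearMap.apply ℂ V v).hasSum h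

theorem exp_mulLeft_apply (X B : R) : exp (ContinuousLinearMap.mul ℂ R X) B = exp X * B := by
  have h := hasSum_exp_apply (ContinuousLinearMap.mul ℂ R X) B
  have hp : ∀ k : ℕ, (ContinuousLinearMap.mul ℂ R X ^ k) B = X ^ k * B := fun k => by
    induction k with
    | zero => simp
    | succ k ih => rw [pow_succ', mul_apply_eq_comp, ih]; simp [pow_succ', mul_assoc]
  simp only [hp] at h
  refine h.unique ?_
  simpa using! (exp_series_hasSum_exp' (𝕂 := ℂ) X).mul_right B

theorem exp_mulRight_apply (X B : R) :
    exp ((ContinuousLinearMap.mul ℂ R).flip X) B = B * exp X := by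
  have h := hasSum_exp_apply ((ContinuousLinearMap.mul ℂ R).flip X) B
  have hp : ∀ k : ℕ, ((ContinuousLinearMap.mul ℂ R).flip X ^ k) B = B * X ^ k := fun k => by
    induction k with
    | zero => simp
    | succ k ih => rw [pow_succ', mul_apply_eq_comp, ih]; simp [pow_succ, mul_assoc]
  simp only [hp] at h
  refine h.unique ?_
  simpa using! (exp_series_hasSum_exp' (𝕂 := ℂ) X).mul_left B

theorem exp_apply_mem {V : Type*} [NormedAddCommGroup V] [NormedSpace ℂ V] [CompleteSpace V]
    {T : V →L[ℂ] V} {K : Submodule ℂ V} (hK : IsClosed (K : Set V)) (hT : ∀ v ∈ K, T v ∈ K)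
    {v : V} (hv : v ∈ K) : exp T v ∈ K := by
  have hp : ∀ k : ℕ, (T ^ k) v ∈ K := fun k => by
    induction k with
    | zero => simpa
    | succ k ih => rw [pow_succ', mul_apply_eq_comp]; exact hT _ ih
  exact hK.mem_of_tendsto (hasSum_exp_apply T v) (Filter.Eventually.of_forall fun s =>
    Submodule.sum_mem _ fun k _ => Submodule.smul_mem _ _ (hp k))

/-- A closed subspace that is stable under `ad X` is stable under conjugation by `exp X`. -/
theorem exp_mul_mul_exp_neg_mem {K : Submodule ℂ R} (hK : IsClosed (K : Set R)) {X : R}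
    (hX : ∀ B ∈ K, X * B - B * X ∈ K) {B : R} (hB : B ∈ K) : exp X * B * exp (-X) ∈ K := by
  let : NormedAlgebra ℚ (R →L[ℂ] R) := .restrictScalars ℚ ℂ _
  -- The operator ad X is the sum of left multiplication by X and right multiplication by -X. These
  -- commute, so exp(ad X) B = exp X · B · exp(-X).
  have hc : Commute (ContinuousLinearMap.mul ℂ R X) ((ContinuousLinearMap.mul ℂ R).flip (-X)) := by
    ext B; simp [mul_assoc]
  have h := exp_apply_mem (T := ContinuousLinearMap.mul ℂ R X +
    (ContinuousLinearMap.mul ℂ R).flip (-X)) hK (fun B hB => by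
      simpa [sub_eq_add_neg] using hX B hB) hB
  rwa [exp_add_of_commute hc, mul_apply_eq_comp, exp_mulRight_apply,
    exp_mulLeft_apply, ← mul_assoc] at h

end ExpConjugation

end LFD
end

noncomputable section

namespace LFD

open Matrix NormedSpace

variable {n : ℕ} {Δ : entireFunctions n}

section MatrixExp

theorem matrix_exp_conj_mem {K : Submodule ℂ (Matrix (Fin n) (Fin n) ℂ)}
    {X : Matrix (Fin n) (Fin n) ℂ} (hX : ∀ B ∈ K, X * B - B * X ∈ K)
    {B : Matrix (Fin n) (Fin n) ℂ} (hB : B ∈ K) : exp X * B * exp (-X) ∈ K :=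
  open scoped Matrix.Norms.Operator in
  exp_mul_mul_exp_neg_mem K.closed_of_finiteDimensional hX hB

theorem matrix_exp_continuous : Continuous (exp : Matrix (Fin n) (Fin n) ℂ → _) :=
  open scoped Matrix.Norms.Operator in
  let : NormedAlgebra ℚ (Matrix (Fin n) (Fin n) ℂ) := .restrictScalars ℚ ℂ _
  exp_continuous

theorem matrix_exp_mul_exp_neg (A : Matrix (Fin n) (Fin n) ℂ) : exp A * exp (-A) = 1 := by
  rw [← Matrix.exp_add_of_commute _ _ (Commute.neg_right (Commute.refl A)), add_neg_cancel]
  exact exp_zero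

theorem hasDerivAt_exp_mulVec (A : Matrix (Fin n) (Fin n) ℂ) (x : Fin n → ℂ) :
    HasDerivAt (fun t : ℝ => exp ((t : ℂ) • A) *ᵥ x) (A *ᵥ x) 0 := by
  open scoped Matrix.Norms.Operator in
  have h := hasDerivAt_exp_smul_const (𝕂 := ℝ) A 0
  let T : Matrix (Fin n) (Fin n) ℂ →L[ℝ] (Fin n → ℂ) :=
    LinearMap.toContinuousLinearMap
      (((Matrix.mulVecBilin ℂ ℂ).flip x).restrictScalars ℝ)
  have h3 := T.hasFDerivAt.comp_hasDerivAt 0 h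
  convert! h3 using 1
  simp [T]
  rfl

/-- The orbit map of the exponential of a space of matrices, differentiated at the origin. -/
theorem hasStrictFDerivAt_exp_mulVec {ι : Type*} [Fintype ι]
    (B : ι → Matrix (Fin n) (Fin n) ℂ) (x : Fin n → ℂ) :
    HasStrictFDerivAt (fun c : ι → ℂ => exp (∑ i, c i • B i) *ᵥ x)
      (LinearMap.toContinuousLinearMap (∑ i, (LinearMap.proj i : (ι → ℂ) →ₗ[ℂ] ℂ).smulRight
        (B i *ᵥ x))) 0 := by
  open scoped Matrix.Norms.Operator in
  let T : Matrix (Fin n) (Fin n) ℂ →L[ℂ] (Fin n → ℂ) :=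
    LinearMap.toContinuousLinearMap ((Matrix.mulVecBilin ℂ ℂ).flip x)
  open scoped Matrix.Norms.Operator in
  let s : (ι → ℂ) →L[ℂ] Matrix (Fin n) (Fin n) ℂ :=
    LinearMap.toContinuousLinearMap
      (∑ i, (LinearMap.proj i : (ι → ℂ) →ₗ[ℂ] ℂ).smulRight (B i))
  have hs : ∀ c, s c = ∑ i, c i • B i := fun c => by simp [s]
  open scoped Matrix.Norms.Operator in
  have h := (hasStrictFDerivAt_exp_zero (𝕂 := ℂ) (𝔸 := Matrix (Fin n) (Fin n) ℂ))
  rw [← map_zero s] at h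
  open scoped Matrix.Norms.Operator in
  have h2 := T.hasStrictFDerivAt.comp (0 : ι → ℂ) (h.comp (0 : ι → ℂ) s.hasStrictFDerivAt)
  refine (h2.congr_fderiv ?_).congr_of_eventuallyEq (Filter.Eventually.of_forall fun c => ?_)
  · ext1 c
    change (s c) *ᵥ x = _
    simp [hs, Matrix.sum_mulVec, Matrix.smul_mulVec]
  · change exp (s c) *ᵥ x = _
    rw [hs]

end MatrixExp

end LFD
end

/-! ### The stabilizer group and its Lie algebra -/

noncomputable section

namespace LFD

open Matrix NormedSpace

variable {n : ℕ} {Δ : entireFunctions n}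

/-- The transposes of the matrices in `L_D`: the matrices `M` for which the vector field
`x ↦ M x` is logarithmic. -/
def logMatrices (Δ : entireFunctions n) : LieSubalgebra ℂ (Matrix (Fin n) (Fin n) ℂ) where
  carrier := {M | Mᵀ ∈ linearLogFields Δ}
  add_mem' h1 h2 := by
    simpa only [Set.mem_ofPred_eq, transpose_add] using add_mem h1 h2
  zero_mem' := by
    simp
  smul_mem' c M h := by
    simpa only [Set.mem_ofPred_eq, transpose_smul] using (linearLogFields Δ).smul_mem c h
  lie_mem' {M N} h1 h2 := by
    have h := (linearLogFields Δ).lie_mem h2 h1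
    simpa only [Set.mem_ofPred_eq, Ring.lie_def, transpose_sub, transpose_mul] using! h

theorem mem_logMatrices {M : Matrix (Fin n) (Fin n) ℂ} :
    M ∈ logMatrices Δ ↔ Mᵀ ∈ linearLogFields Δ := Iff.rfl

/-- `M ↦ -Mᵀ` as an isomorphism of Lie algebras. -/
def logMatricesEquiv (Δ : entireFunctions n) : logMatrices Δ ≃ₗ⁅ℂ⁆ linearLogFields Δ where
  toFun M := ⟨-M.1ᵀ, neg_mem M.2⟩
  invFun A := ⟨-A.1ᵀ, by
    rw [mem_logMatrices, transpose_neg, transpose_transpose]; exact neg_mem A.2⟩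
  left_inv M := by ext; simp
  right_inv A := by ext; simp
  map_add' M N := by ext; simp [add_comm]
  map_smul' c M := by ext; simp
  map_lie' {M N} := by ext1; simp [Ring.lie_def]

theorem linearField_transpose (M : Matrix (Fin n) (Fin n) ℂ) (x : Fin n → ℂ) :
    linearField Mᵀ x = M *ᵥ x := vecMul_transpose M x

theorem mem_logMatrices_iff (hΔ : IsReducedEquation Δ) {M : Matrix (Fin n) (Fin n) ℂ} :
    M ∈ logMatrices Δ ↔ ∀ x, Δ.1 x = 0 → fderiv ℂ Δ.1 x (M *ᵥ x) = 0 := by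
  rw [mem_logMatrices, mem_linearLogFields_iff hΔ]
  simp only [linearField_transpose]

/-- Evaluation of the linear logarithmic vector fields at `x`. -/
def orbitMap (Δ : entireFunctions n) (x : Fin n → ℂ) : logMatrices Δ →ₗ[ℂ] (Fin n → ℂ) where
  toFun M := M.1 *ᵥ x
  map_add' _ _ := add_mulVec _ _ _
  map_smul' _ _ := smul_mulVec _ _ _

@[simp]
theorem orbitMap_apply (x : Fin n → ℂ) (M : logMatrices Δ) : orbitMap Δ x M = M.1 *ᵥ x := rfl

theorem orbitMap_eq (x : Fin n → ℂ) (M : logMatrices Δ) :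
    orbitMap Δ x M = evalField Δ x (-logMatricesEquiv Δ M) := by
  change _ = linearField _ x
  rw [orbitMap_apply, ← linearField_transpose]
  change _ = linearField (-(-M.1ᵀ)) x
  rw [neg_neg]

theorem orbitMap_surjective_iff (x : Fin n → ℂ) :
    Function.Surjective (orbitMap Δ x) ↔ Function.Surjective (evalField Δ x) := by
  have h : (orbitMap Δ x : logMatrices Δ → _) =
      evalField Δ x ∘ ((logMatricesEquiv Δ).toLinearEquiv.toEquiv.trans (Equiv.neg _)) :=
    funext (orbitMap_eq x)
  rw [h, EquivLike.surjective_comp]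

theorem orbitMap_injective_iff (x : Fin n → ℂ) :
    Function.Injective (orbitMap Δ x) ↔ Function.Injective (evalField Δ x) := by
  have h : (orbitMap Δ x : logMatrices Δ → _) =
      evalField Δ x ∘ ((logMatricesEquiv Δ).toLinearEquiv.toEquiv.trans (Equiv.neg _)) :=
    funext (orbitMap_eq x)
  rw [h, EquivLike.injective_comp]

theorem mem_stabilizerGroup_iff {g : GL (Fin n) ℂ} :
    g ∈ stabilizerGroup (divisorSet Δ) ↔ ∀ x, Δ.1 (g.1 *ᵥ x) = 0 ↔ Δ.1 x = 0 := by
  change (fun x => g.1 *ᵥ x) '' {x | Δ.1 x = 0} = {x | Δ.1 x = 0} ↔ _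
  have h1 : ∀ x, g⁻¹.1 *ᵥ (g.1 *ᵥ x) = x := fun x => by simp [mulVec_mulVec]
  have h2 : ∀ x, g.1 *ᵥ (g⁻¹.1 *ᵥ x) = x := fun x => by simp [mulVec_mulVec]
  constructor
  · intro h x
    change g.1 *ᵥ x ∈ {x | Δ.1 x = 0} ↔ _
    rw [← h]
    constructor
    · rintro ⟨y, hy, hyx⟩
      rwa [← h1 x, ← hyx, h1]
    · exact fun hx => ⟨x, hx, rfl⟩
  · intro h
    ext x
    constructor
    · rintro ⟨y, hy, rfl⟩
      exact (h y).2 hy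
    · intro hx
      refine ⟨g⁻¹.1 *ᵥ x, ?_, h2 x⟩
      rw [Set.mem_ofPred_eq, ← h, h2]
      exact hx

/-- Differentiate Δ(exp(tA) x) = 0 at t = 0 for x in D. -/
theorem mem_logMatrices_of_exp (hΔ : IsReducedEquation Δ) {A : Matrix (Fin n) (Fin n) ℂ}
    (h : ∀ (t : ℝ) x, Δ.1 x = 0 → Δ.1 (exp ((t : ℂ) • A) *ᵥ x) = 0) : A ∈ logMatrices Δ := by
  rw [mem_logMatrices_iff hΔ]
  intro x hx
  have h1 := hasDerivAt_exp_mulVec A x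
  have h0 : exp (((0 : ℝ) : ℂ) • A) *ᵥ x = x := by simp
  have h2 := ((entire_differentiable Δ x).hasFDerivAt.restrictScalars ℝ)
  rw [← h0] at h2
  have h3 := h2.comp_hasDerivAt (0 : ℝ) h1
  have h4 : (Δ.1 ∘ fun t : ℝ => exp ((t : ℂ) • A) *ᵥ x) = fun _ => 0 := funext fun t => h t x hx
  rw [h4, h0] at h3
  exact h3.unique (hasDerivAt_const _ _)

/-- Since Δ ∘ g vanishes on D, it is a multiple of Δ, so the field of A also differentiates Δ ∘ g to
a function vanishing on D. By the chain rule this derivative is that of Δ at g x in direction g A x.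
-/
theorem conj_mem_logMatrices (hΔ : IsReducedEquation Δ) {g : GL (Fin n) ℂ}
    (hg : g ∈ stabilizerGroup (divisorSet Δ)) {A : Matrix (Fin n) (Fin n) ℂ}
    (hA : A ∈ logMatrices Δ) : g.1 * A * g⁻¹.1 ∈ logMatrices Δ := by
  rw [mem_stabilizerGroup_iff] at hg
  rw [mem_logMatrices_iff hΔ] at hA ⊢
  let T : (Fin n → ℂ) →L[ℂ] (Fin n → ℂ) := LinearMap.toContinuousLinearMap (Matrix.mulVecLin g.1)
  have hT : ∀ x, T x = g.1 *ᵥ x := fun x => rfl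
  let f : entireFunctions n := ⟨fun x => Δ.1 (T x), fun x _ =>
    (Δ.2 (T x) (Set.mem_univ _)).comp (T.analyticAt x)⟩
  obtain ⟨u, hu⟩ := hΔ.dvd_of_vanishing f fun x hx => (hg x).2 hx
  have key : ∀ x, Δ.1 x = 0 → fderiv ℂ Δ.1 (T x) (T (A *ᵥ x)) = 0 := by
    intro x hx
    have h1 : fderiv ℂ f.1 x (A *ᵥ x) = fderiv ℂ Δ.1 (T x) (T (A *ᵥ x)) := by
      have := ((entire_differentiable Δ (T x)).hasFDerivAt.comp x T.hasFDerivAt).fderiv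
      change fderiv ℂ (Δ.1 ∘ T) x (A *ᵥ x) = _
      rw [this]
      rfl
    rw [← h1, hu]
    change fderiv ℂ (Δ.1 * u.1) x (A *ᵥ x) = 0
    rw [fderiv_mul (entire_differentiable Δ x) (entire_differentiable u x)]
    simp [hx, hA x hx]
  intro y hy
  have h2 : g.1 *ᵥ (g⁻¹.1 *ᵥ y) = y := by simp [mulVec_mulVec]
  have h3 := key (g⁻¹.1 *ᵥ y) (by rw [← hg, h2]; exact hy)
  rw [hT, hT, h2] at h3
  simpa [mulVec_mulVec, mul_assoc] using h3

namespace LinearFrame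

theorem orbitMap_bijective (S : LinearFrame Δ) {x : Fin n → ℂ} (hx : Δ.1 x ≠ 0) :
    Function.Bijective (orbitMap Δ x) :=
  ⟨(orbitMap_injective_iff x).2 (S.evalField_bijective hx).1,
    (orbitMap_surjective_iff x).2 (S.evalField_bijective hx).2⟩

theorem ne_zero_iff (S : LinearFrame Δ) (h0 : Δ ≠ 0) (x : Fin n → ℂ) :
    Δ.1 x ≠ 0 ↔ Function.Surjective (orbitMap Δ x) := by
  rw [orbitMap_surjective_iff, ne_eq, S.eq_zero_iff_not_surjective h0, not_not]

theorem ne_zero_of_conj (S : LinearFrame Δ) (h0 : Δ ≠ 0) {g : GL (Fin n) ℂ}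
    (hg : ∀ A ∈ logMatrices Δ, g.1 * A * g⁻¹.1 ∈ logMatrices Δ) {x : Fin n → ℂ}
    (hx : Δ.1 x ≠ 0) : Δ.1 (g.1 *ᵥ x) ≠ 0 := by
  rw [S.ne_zero_iff h0] at hx ⊢
  intro v
  obtain ⟨A, hA⟩ := hx (g⁻¹.1 *ᵥ v)
  refine ⟨⟨_, hg A.1 A.2⟩, ?_⟩
  rw [orbitMap_apply] at hA ⊢
  rw [mulVec_mulVec, mul_assoc, Units.inv_mul, mul_one, ← mulVec_mulVec, hA, mulVec_mulVec,
    Units.mul_inv, one_mulVec]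

/-- D is the locus where evaluation of the Lie algebra is not surjective, so a matrix that
normalizes the Lie algebra preserves D. The inverse is needed for the reverse inclusion. -/
theorem mem_stabilizerGroup_of_conj (S : LinearFrame Δ) (h0 : Δ ≠ 0) {g : GL (Fin n) ℂ}
    (hg : ∀ A ∈ logMatrices Δ, g.1 * A * g⁻¹.1 ∈ logMatrices Δ)
    (hg' : ∀ A ∈ logMatrices Δ, g⁻¹.1 * A * g.1 ∈ logMatrices Δ) :
    g ∈ stabilizerGroup (divisorSet Δ) := by
  rw [mem_stabilizerGroup_iff]
  refine fun x => not_iff_not.1 ⟨fun h => ?_, S.ne_zero_of_conj h0 hg⟩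
  simpa [mulVec_mulVec] using S.ne_zero_of_conj h0 (g := g⁻¹) (by simpa using hg') h

end LinearFrame

/-- The exponential of a matrix as an element of `GLₙ(ℂ)`. -/
def expGL (A : Matrix (Fin n) (Fin n) ℂ) : GL (Fin n) ℂ where
  val := exp A
  inv := exp (-A)
  val_inv := matrix_exp_mul_exp_neg A
  inv_val := by simpa using matrix_exp_mul_exp_neg (-A)

theorem expGL_val (A : Matrix (Fin n) (Fin n) ℂ) : (expGL A).1 = exp A := rfl

theorem expGL_inv (A : Matrix (Fin n) (Fin n) ℂ) : (expGL A)⁻¹ = expGL (-A) := by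
  ext1; rfl

theorem continuous_expGL : Continuous (expGL (n := n)) :=
  Units.continuous_iff.2 ⟨matrix_exp_continuous, matrix_exp_continuous.comp continuous_neg⟩

namespace LinearFrame

theorem expGL_mem_of_normalizes (S : LinearFrame Δ) (h0 : Δ ≠ 0) {X : Matrix (Fin n) (Fin n) ℂ}
    (hX : ∀ B ∈ logMatrices Δ, X * B - B * X ∈ logMatrices Δ) :
    expGL X ∈ stabilizerGroup (divisorSet Δ) := by
  refine S.mem_stabilizerGroup_of_conj h0 (fun A hA => ?_) (fun A hA => ?_)
  · rw [expGL_inv]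
    exact matrix_exp_conj_mem (K := (logMatrices Δ).toSubmodule) hX hA
  · rw [expGL_inv]
    have h := matrix_exp_conj_mem (K := (logMatrices Δ).toSubmodule) (X := -X) (fun B hB => by
      have := (logMatrices Δ).toSubmodule.neg_mem (hX B hB)
      simpa [sub_eq_add_neg, add_comm] using this) hA
    simpa [expGL_val] using h

/-- The Lie algebra is its own normalizer: if X normalizes it, then exp(tX) preserves D for all t,
so X is logarithmic. This yields discreteness of the isotropy groups. -/
theorem mem_logMatrices_of_normalizes (S : LinearFrame Δ) (hΔ : IsReducedEquation Δ)
    {X : Matrix (Fin n) (Fin n) ℂ}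
    (hX : ∀ B ∈ logMatrices Δ, X * B - B * X ∈ logMatrices Δ) : X ∈ logMatrices Δ := by
  refine mem_logMatrices_of_exp hΔ fun t x hx => ?_
  refine (mem_stabilizerGroup_iff.1 (S.expGL_mem_of_normalizes hΔ.ne_zero
    (X := (t : ℂ) • X) fun B hB => ?_) x).2 hx
  simpa [smul_sub] using (logMatrices Δ).smul_mem (t : ℂ) (hX B hB)

theorem expGL_mem (S : LinearFrame Δ) (h0 : Δ ≠ 0) {A : Matrix (Fin n) (Fin n) ℂ}
    (hA : A ∈ logMatrices Δ) : expGL A ∈ stabilizerGroup (divisorSet Δ) :=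
  S.expGL_mem_of_normalizes h0 fun _ hB => (logMatrices Δ).lie_mem hA hB

theorem linearGroupLieAlgebra_eq (S : LinearFrame Δ) (hΔ : IsReducedEquation Δ) :
    linearGroupLieAlgebra (stabilizerGroup (divisorSet Δ)) = logMatrices Δ := by
  have h : {A : Matrix (Fin n) (Fin n) ℂ | ∀ t : ℝ, ∃ g ∈ stabilizerGroup (divisorSet Δ),
      (g : Matrix (Fin n) (Fin n) ℂ) = exp ((t : ℂ) • A)} = logMatrices Δ := by
    ext A
    constructor
    · intro h
      refine mem_logMatrices_of_exp hΔ fun t x hx => ?_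
      obtain ⟨g, hg, hgA⟩ := h t
      rw [← hgA]
      exact (mem_stabilizerGroup_iff.1 hg x).2 hx
    · exact fun h t => ⟨_, S.expGL_mem hΔ.ne_zero ((logMatrices Δ).smul_mem (t : ℂ) h), rfl⟩
  rw [linearGroupLieAlgebra, h, LieSubalgebra.lieSpan_eq]

end LinearFrame

end LFD
end

/-! ### Countable algebraic sets are finite -/

noncomputable section

namespace LFD

section CountableAlgebraicSet

open MvPolynomial

/-- A `ℂ`-point of an algebra of finite type in every fibre of an integral extension. -/
theorem exists_algHom_of_integral {A : Type*} [CommRing A] [Algebra ℂ A] [Algebra.FiniteType ℂ A]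
    {s : ℕ} {g : MvPolynomial (Fin s) ℂ →ₐ[ℂ] A} (hg : Function.Injective g)
    (hi : g.toRingHom.IsIntegral) (y : Fin s → ℂ) : ∃ ψ : A →ₐ[ℂ] ℂ, ∀ i, ψ (g (X i)) = y i := by
  let φ : MvPolynomial (Fin s) ℂ →ₐ[ℂ] ℂ := aeval y
  have hφ : Function.Surjective φ := fun c => ⟨C c, by simp [φ]⟩
  have hmax : (RingHom.ker φ).IsMaximal := RingHom.ker_isMaximal_of_surjective φ hφ
  let : Algebra (MvPolynomial (Fin s) ℂ) A := g.toRingHom.toAlgebra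
  have : Algebra.IsIntegral (MvPolynomial (Fin s) ℂ) A := ⟨hi⟩
  obtain ⟨Q, hQ, hQφ⟩ := Ideal.exists_ideal_over_maximal_of_isIntegral (S := A) (RingHom.ker φ)
    (by
      have : RingHom.ker (algebraMap (MvPolynomial (Fin s) ℂ) A) = ⊥ :=
        (RingHom.injective_iff_ker_eq_bot _).1 hg
      rw [this]; exact bot_le)
  let : Field (A ⧸ Q) := Ideal.Quotient.field Q
  -- Nullstellensatz: the residue field is finite over ℂ, hence equal to ℂ, and the quotient map is
  -- the required point.
  have : Module.Finite ℂ (A ⧸ Q) := finite_of_finite_type_of_isJacobsonRing ℂ (A ⧸ Q)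
  let e : ℂ ≃ₐ[ℂ] A ⧸ Q := AlgEquiv.ofBijective (Algebra.ofId ℂ (A ⧸ Q))
    (IsAlgClosed.algebraMap_bijective_of_isIntegral (k := ℂ) (K := A ⧸ Q))
  refine ⟨e.symm.toAlgHom.comp (Ideal.Quotient.mkₐ ℂ Q), fun i => ?_⟩
  have h1 : X i - C (y i) ∈ RingHom.ker φ := by simp [φ, RingHom.mem_ker]
  rw [← hQφ, Ideal.mem_comap] at h1
  have h2 : Ideal.Quotient.mkₐ ℂ Q (g (X i - C (y i))) = 0 := Ideal.Quotient.eq_zero_iff_mem.2 h1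
  have h3 : g (C (y i)) = algebraMap ℂ A (y i) := g.commutes (y i)
  rw [map_sub, map_sub, sub_eq_zero, h3] at h2
  change e.symm (Ideal.Quotient.mkₐ ℂ Q (g (X i))) = y i
  rw [h2, AlgHom.commutes, AlgEquiv.commutes]
  rfl

/-- A countable algebraic subset of an affine space is finite. -/
theorem finite_zeroLocus_of_countable {σ : Type*} [Finite σ] {P : Set (MvPolynomial σ ℂ)}
    (h : {z : σ → ℂ | ∀ p ∈ P, eval z p = 0}.Countable) :
    {z : σ → ℂ | ∀ p ∈ P, eval z p = 0}.Finite := by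
  set Z := {z : σ → ℂ | ∀ p ∈ P, eval z p = 0} with hZ
  obtain hZ0 | ⟨z₀, hz₀⟩ := Z.eq_empty_or_nonempty
  · rw [hZ0]; exact Set.finite_empty
  have hle : ∀ z ∈ Z, Ideal.span P ≤ RingHom.ker (aeval z : MvPolynomial σ ℂ →ₐ[ℂ] ℂ) :=
    fun z hz => Ideal.span_le.2 fun p hp => by
      simpa [RingHom.mem_ker, aeval_eq_eval] using hz p hp
  have : Nontrivial (MvPolynomial σ ℂ ⧸ Ideal.span P) :=
    Ideal.Quotient.nontrivial_iff.2 fun htop => by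
      have h1 := hle z₀ hz₀ (htop ▸ Submodule.mem_top : (1 : MvPolynomial σ ℂ) ∈ Ideal.span P)
      simp [RingHom.mem_ker] at h1
  -- Noether normalization. If s > 0, a lift q of the first polynomial variable takes every complex
  -- value on Z, so Z is uncountable.
  obtain ⟨s, g, hg, hi⟩ := exists_integral_inj_algHom_of_fg ℂ (MvPolynomial σ ℂ ⧸ Ideal.span P)
  have hs : s = 0 := by
    by_contra hs
    obtain ⟨q, hq⟩ := Ideal.Quotient.mk_surjective (g (X ⟨0, Nat.pos_of_ne_zero hs⟩))
    have hsurj : (Set.univ : Set ℂ) ⊆ (fun z => eval z q) '' Z := fun c _ => by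
      obtain ⟨ψ, hψ⟩ := exists_algHom_of_integral hg hi fun _ => c
      let χ : MvPolynomial σ ℂ →ₐ[ℂ] ℂ := ψ.comp (Ideal.Quotient.mkₐ ℂ (Ideal.span P))
      have hχ : ∀ p, eval (fun i => χ (X i)) p = χ p := fun p => by
        rw [← aeval_eq_eval]
        exact congrArg (fun f => f p) (aeval_unique χ).symm
      refine ⟨fun i => χ (X i), fun p hp => ?_, ?_⟩
      · rw [hχ]
        change ψ (Ideal.Quotient.mk _ p) = 0
        rw [Ideal.Quotient.eq_zero_iff_mem.2 (Ideal.subset_span hp), map_zero]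
      · change eval _ q = c
        rw [hχ]
        change ψ (Ideal.Quotient.mk _ q) = c
        rw [hq, hψ]
    have hc : (Set.univ : Set ℂ).Countable := (h.image _).mono hsurj
    exact not_countable_complex hc
  subst hs
  have hint : (algebraMap ℂ (MvPolynomial σ ℂ ⧸ Ideal.span P)).IsIntegral := by
    have h1 : (algebraMap ℂ (MvPolynomial (Fin 0) ℂ)).IsIntegral :=
      RingHom.isIntegral_of_surjective _ (C_surjective (Fin 0))
    have h2 := h1.trans _ _ hi
    rwa [show g.toRingHom.comp (algebraMap ℂ (MvPolynomial (Fin 0) ℂ)) = algebraMap ℂ _ from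
      g.comp_algebraMap] at h2
  -- For s = 0 each coordinate is integral over ℂ modulo the ideal, so on Z it takes values among
  -- the roots of one polynomial.
  choose p hp hp0 using fun i => hint (Ideal.Quotient.mk (Ideal.span P) (X i))
  refine (Set.Finite.pi' fun i => (p i).rootSet_finite ℂ).subset fun z hz i => ?_
  rw [Polynomial.mem_rootSet]
  refine ⟨(hp i).ne_zero, ?_⟩
  have h3 : Polynomial.aeval (X i) (p i) ∈ Ideal.span P := by
    rw [← Ideal.Quotient.eq_zero_iff_mem, ← hp0 i]
    change Ideal.Quotient.mkₐ ℂ (Ideal.span P) _ = Polynomial.aeval (Ideal.Quotient.mkₐ ℂ (Ideal.span P) (X i)) (p i)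
    rw [Polynomial.aeval_algHom_apply]
  have h4 := hle z hz h3
  rw [RingHom.mem_ker, ← Polynomial.aeval_algHom_apply, aeval_X] at h4
  exact h4

end CountableAlgebraicSet

end LFD
end

/-! ### Discreteness of isotropy groups -/

noncomputable section

namespace LFD

open Matrix

variable {n : ℕ} {Δ : entireFunctions n}

namespace LinearFrame

variable (S : LinearFrame Δ) {p : Fin n → ℂ} (hp : Δ.1 p ≠ 0)

/-- The linear logarithmic vector field with a given value at a point off the divisor. -/
def fieldAt : (Fin n → ℂ) →ₗ[ℂ] Matrix (Fin n) (Fin n) ℂ :=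
  (logMatrices Δ).toSubmodule.subtype ∘ₗ
    (LinearEquiv.ofBijective (orbitMap Δ p) (S.orbitMap_bijective hp)).symm.toLinearMap

theorem fieldAt_mem (v : Fin n → ℂ) : S.fieldAt hp v ∈ logMatrices Δ :=
  ((LinearEquiv.ofBijective (orbitMap Δ p) (S.orbitMap_bijective hp)).symm v).2

theorem fieldAt_mulVec (v : Fin n → ℂ) : S.fieldAt hp v *ᵥ p = v :=
  (LinearEquiv.ofBijective (orbitMap Δ p) (S.orbitMap_bijective hp)).apply_symm_apply v

theorem fieldAt_of_mem {A : Matrix (Fin n) (Fin n) ℂ} (hA : A ∈ logMatrices Δ) :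
    S.fieldAt hp (A *ᵥ p) = A :=
  congrArg Subtype.val ((S.orbitMap_bijective hp).1 (a₁ := ⟨_, S.fieldAt_mem hp (A *ᵥ p)⟩)
    (a₂ := ⟨A, hA⟩) (S.fieldAt_mulVec hp _))

/-- If g preserves D and fixes p, then g A g⁻¹ is logarithmic with value g A p at p, and a
logarithmic matrix is determined by that value. Normalizing the Lie algebra thus becomes an equation
that is polynomial in the entries of g. -/
theorem fieldAt_conj (hΔ : IsReducedEquation Δ) {g : GL (Fin n) ℂ}
    (hg : g ∈ stabilizerGroup (divisorSet Δ)) (hgp : g.1 *ᵥ p = p)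
    {A : Matrix (Fin n) (Fin n) ℂ} (hA : A ∈ logMatrices Δ) :
    g.1 * A = S.fieldAt hp (g.1 *ᵥ A *ᵥ p) * g.1 := by
  have h1 : g⁻¹.1 *ᵥ p = p := by
    conv_lhs => rw [← hgp, mulVec_mulVec, Units.inv_mul, one_mulVec]
  have h2 := S.fieldAt_of_mem hp (conj_mem_logMatrices hΔ hg hA)
  rw [← mulVec_mulVec, ← mulVec_mulVec, h1] at h2
  rw [h2, mul_assoc, Units.inv_mul, mul_one]

theorem mem_logMatrices_of_basis (S : LinearFrame Δ) (hΔ : IsReducedEquation Δ) {ι : Type*}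
    (b : Module.Basis ι ℂ (logMatrices Δ)) {X : Matrix (Fin n) (Fin n) ℂ}
    (hX : ∀ i, X * (b i).1 - (b i).1 * X ∈ logMatrices Δ) : X ∈ logMatrices Δ := by
  let N : Matrix (Fin n) (Fin n) ℂ →ₗ[ℂ] Matrix (Fin n) (Fin n) ℂ :=
    LinearMap.mulLeft ℂ X - LinearMap.mulRight ℂ X
  let K : Submodule ℂ (logMatrices Δ) :=
    ((logMatrices Δ).toSubmodule.comap N).comap (logMatrices Δ).toSubmodule.subtype
  have h4 : Submodule.span ℂ (Set.range b) ≤ K :=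
    Submodule.span_le.2 (Set.range_subset_iff.2 hX)
  have H : ∀ B : logMatrices Δ, B ∈ K := fun B => h4 (b.mem_span B)
  exact S.mem_logMatrices_of_normalizes hΔ fun B hB => H ⟨B, hB⟩

theorem hasFDerivAt_isotropy_eq (A : Matrix (Fin n) (Fin n) ℂ) (hA : A ∈ logMatrices Δ) :
    open scoped Matrix.Norms.Operator in
    HasFDerivAt (fun M : Matrix (Fin n) (Fin n) ℂ => M * A - S.fieldAt hp (M *ᵥ A *ᵥ p) * M)
      (LinearMap.toContinuousLinearMap (LinearMap.mulRight ℂ A -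
        (S.fieldAt hp ∘ₗ (Matrix.mulVecBilin ℂ ℂ).flip (A *ᵥ p) + LinearMap.mulLeft ℂ A)))
      (1 : Matrix (Fin n) (Fin n) ℂ) := by
  open scoped Matrix.Norms.Operator in
  let U : Matrix (Fin n) (Fin n) ℂ →L[ℂ] Matrix (Fin n) (Fin n) ℂ :=
    LinearMap.toContinuousLinearMap (S.fieldAt hp ∘ₗ (Matrix.mulVecBilin ℂ ℂ).flip (A *ᵥ p))
  have hU : ∀ M, U M = S.fieldAt hp (M *ᵥ A *ᵥ p) := fun M => rfl
  have h3 : U 1 = A := by rw [hU, one_mulVec, S.fieldAt_of_mem hp hA]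
  open scoped Matrix.Norms.Operator in
  have h1 := (LinearMap.toContinuousLinearMap (LinearMap.mulRight ℂ A)).hasFDerivAt
      (x := (1 : Matrix (Fin n) (Fin n) ℂ))
  open scoped Matrix.Norms.Operator in
  have h2 := U.hasFDerivAt.mul' (hasFDerivAt_id (1 : Matrix (Fin n) (Fin n) ℂ))
  refine (h1.sub h2).congr_fderiv ?_
  ext1 X
  change X * A - (U 1 * X + U X * 1) = X * A - (U X + A * X)
  rw [h3, mul_one, add_comm]

include S hp in
/-- The identity is isolated in the isotropy group of a point off the divisor. -/
theorem eventually_eq_one (hΔ : IsReducedEquation Δ) :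
    ∀ᶠ M in nhds (1 : Matrix (Fin n) (Fin n) ℂ), ∀ g : GL (Fin n) ℂ, g.1 = M →
      g ∈ stabilizerGroup (divisorSet Δ) → g.1 *ᵥ p = p → g = 1 := by
  let b := Module.finBasis ℂ (logMatrices Δ)
  let T : Matrix (Fin n) (Fin n) ℂ →ₗ[ℂ] (Fin n → ℂ) := (Matrix.mulVecBilin ℂ ℂ).flip p
  let V : Fin (Module.finrank ℂ (logMatrices Δ)) →
      Matrix (Fin n) (Fin n) ℂ →ₗ[ℂ] Matrix (Fin n) (Fin n) ℂ :=
    fun i => LinearMap.mulRight ℂ (b i).1 - (S.fieldAt hp ∘ₗ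
      (Matrix.mulVecBilin ℂ ℂ).flip ((b i).1 *ᵥ p) + LinearMap.mulLeft ℂ (b i).1)
  have hV : ∀ i X, V i X = X * (b i).1 - (S.fieldAt hp (X *ᵥ (b i).1 *ᵥ p) + (b i).1 * X) :=
    fun i X => rfl
  let D : Matrix (Fin n) (Fin n) ℂ →ₗ[ℂ] (Fin n → ℂ) × (Fin (Module.finrank ℂ (logMatrices Δ)) →
      Matrix (Fin n) (Fin n) ℂ) := T.prod (LinearMap.pi V)
  -- D linearizes at 1 the equations for fixing p and for normalizing the Lie algebra. If X is in
  -- its kernel, then X p = 0 and each bracket [X, b i] is logarithmic; so X is logarithmic by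
  -- self-normalization, and X p = 0 forces X = 0.
  have hD : LinearMap.ker D = ⊥ := by
    rw [LinearMap.ker_eq_bot']
    intro X hX
    have h1 : X *ᵥ p = 0 := congrArg Prod.fst hX
    have h3 : X ∈ logMatrices Δ := by
      refine S.mem_logMatrices_of_basis hΔ b fun i => ?_
      have h2 : V i X = 0 := congrFun (congrArg Prod.snd hX) i
      rw [hV, sub_eq_zero] at h2
      rw [h2, add_sub_cancel_right]
      exact S.fieldAt_mem hp _
    rw [← S.fieldAt_of_mem hp h3, h1, map_zero]
  open scoped Matrix.Norms.Operator in
  have hanti : ∃ C, AntilipschitzWith C (LinearMap.toContinuousLinearMap D) := by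
    obtain ⟨C, -, hC⟩ := D.exists_antilipschitzWith hD
    exact ⟨C, hC⟩
  have hΦ := HasFDerivAt.prodMk ((LinearMap.toContinuousLinearMap T).hasFDerivAt.sub_const p)
    (hasFDerivAt_pi.2 fun i => S.hasFDerivAt_isotropy_eq hp (b i).1 (b i).2)
  -- A map whose derivative at 1 is bounded below does not take the value 0 at other points near 1.
  have hev := eventually_nhdsWithin_iff.1 (hΦ.eventually_ne (c := 0) hanti)
  refine hev.mono fun M hM g hgM hg hgp => ?_
  by_contra hne
  refine hM (fun h => hne (Units.ext (hgM.trans h))) ?_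
  rw [← hgM]
  exact Prod.ext (sub_eq_zero.2 hgp)
    (funext fun i => sub_eq_zero.2 (S.fieldAt_conj hp hΔ hg hgp (b i).2))

end LinearFrame

/-- The isotropy group of `p` in `G_D`. -/
def isotropy (Δ : entireFunctions n) (p : Fin n → ℂ) : Subgroup (GL (Fin n) ℂ) where
  carrier := {g | g ∈ stabilizerGroup (divisorSet Δ) ∧ g.1 *ᵥ p = p}
  mul_mem' {g h} h1 h2 := ⟨mul_mem h1.1 h2.1, by
    rw [Units.val_mul, ← mulVec_mulVec, h2.2, h1.2]⟩
  one_mem' := ⟨(stabilizerGroup (divisorSet Δ)).one_mem, one_mulVec p⟩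
  inv_mem' {g} h := ⟨inv_mem h.1, by
    conv_lhs => rw [← h.2, mulVec_mulVec, Units.inv_mul, one_mulVec]⟩

/-- The group is discrete, its identity being isolated, and it inherits a countable base from the
space of matrices. -/
theorem LinearFrame.isotropy_countable (S : LinearFrame Δ) {p : Fin n → ℂ} (hp : Δ.1 p ≠ 0)
    (hΔ : IsReducedEquation Δ) : Countable (isotropy Δ p) := by
  have hone : {(1 : isotropy Δ p)} ∈ nhds (1 : isotropy Δ p) := by
    have hc : Continuous fun g : isotropy Δ p => g.1.1 :=
      Units.continuous_val.comp continuous_subtype_val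
    filter_upwards [hc.continuousAt.eventually (S.eventually_eq_one hp hΔ)] with g hg
    exact Subtype.ext (hg g.1 rfl g.2.1 g.2.2)
  have : DiscreteTopology (isotropy Δ p) := discreteTopology_of_isOpen_singleton_one
    (isOpen_singleton_iff_nhds_eq_pure _ |>.2 (le_antisymm
      (Filter.le_pure_iff.2 hone) (pure_le_nhds _)))
  have : SecondCountableTopology (Matrix (Fin n) (Fin n) ℂ) :=
    inferInstanceAs (SecondCountableTopology (Fin n → Fin n → ℂ))
  have : SecondCountableTopology (Matrix (Fin n) (Fin n) ℂ)ᵐᵒᵖ :=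
    MulOpposite.opHomeomorph.symm.secondCountableTopology
  have : SecondCountableTopology (GL (Fin n) ℂ) :=
    Units.isEmbedding_embedProduct.secondCountableTopology
  exact countable_of_Lindelof_of_discrete

end LFD
end

/-! ### Finiteness of isotropy groups -/

noncomputable section

namespace LFD

open Matrix

variable {n : ℕ} {Δ : entireFunctions n}

section PolynomialFunctions

variable {σ : Type*}

/-- The polynomial functions on an affine space. -/
def polyFunctions (σ : Type*) : Subalgebra ℂ ((σ → ℂ) → ℂ) :=
  (AlgHom.pi fun z : σ → ℂ => (MvPolynomial.aeval z : MvPolynomial σ ℂ →ₐ[ℂ] ℂ)).range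

theorem coord_mem_polyFunctions (i : σ) : (fun z => z i) ∈ polyFunctions σ :=
  ⟨MvPolynomial.X i, by ext; simp⟩

theorem const_mem_polyFunctions (c : ℂ) : (fun _ => c) ∈ polyFunctions σ :=
  (polyFunctions σ).algebraMap_mem c

theorem finite_zeros_of_countable [Finite σ] {F : Set ((σ → ℂ) → ℂ)}
    (hF : F ⊆ polyFunctions σ) (h : {z | ∀ f ∈ F, f z = 0}.Countable) :
    {z | ∀ f ∈ F, f z = 0}.Finite := by
  have key : {z | ∀ f ∈ F, f z = 0} = {z : σ → ℂ | ∀ p ∈ {p : MvPolynomial σ ℂ |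
      (fun z => MvPolynomial.eval z p) ∈ F}, MvPolynomial.eval z p = 0} := by
    ext z
    refine ⟨fun hz p hp => hz _ hp, fun hz f hf => ?_⟩
    obtain ⟨p, rfl⟩ := hF hf
    exact hz p hf
  rw [key] at h ⊢
  exact finite_zeroLocus_of_countable h

/-- The matrices of functions with polynomial entries. -/
def IsPolyMatrix {a b : Type*} (M : (σ → ℂ) → Matrix a b ℂ) : Prop :=
  ∀ i j, (fun z => M z i j) ∈ polyFunctions σ

theorem IsPolyMatrix.mul {a b c : Type*} [Fintype b] {M : (σ → ℂ) → Matrix a b ℂ}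
    {N : (σ → ℂ) → Matrix b c ℂ} (hM : IsPolyMatrix M) (hN : IsPolyMatrix N) :
    IsPolyMatrix fun z => M z * N z := fun i j => by
  have h := Subalgebra.sum_mem (polyFunctions σ) fun k (_ : k ∈ (Finset.univ : Finset b)) =>
    mul_mem (hM i k) (hN k j)
  convert! h
  simp [Matrix.mul_apply]

theorem IsPolyMatrix.sub {a b : Type*} {M N : (σ → ℂ) → Matrix a b ℂ} (hM : IsPolyMatrix M)
    (hN : IsPolyMatrix N) : IsPolyMatrix fun z => M z - N z := fun i j =>
  sub_mem (hM i j) (hN i j)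

theorem IsPolyMatrix.const {a b : Type*} (M : Matrix a b ℂ) :
    IsPolyMatrix (fun _ : σ → ℂ => M) := fun _ _ => const_mem_polyFunctions _

theorem IsPolyMatrix.mulVec {a b : Type*} [Fintype b] {M : (σ → ℂ) → Matrix a b ℂ}
    (hM : IsPolyMatrix M) (v : b → ℂ) (i : a) : (fun z => (M z *ᵥ v) i) ∈ polyFunctions σ := by
  have h := Subalgebra.sum_mem (polyFunctions σ) fun k (_ : k ∈ (Finset.univ : Finset b)) =>
    mul_mem (hM i k) (const_mem_polyFunctions (v k))
  convert! h
  simp [Matrix.mulVec, dotProduct]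

theorem IsPolyMatrix.linearMap {a b c : Type*} [Fintype a] [DecidableEq a]
    {v : (σ → ℂ) → a → ℂ} (hv : ∀ i, (fun z => v z i) ∈ polyFunctions σ)
    (T : (a → ℂ) →ₗ[ℂ] Matrix b c ℂ) : IsPolyMatrix fun z => T (v z) := fun i j => by
  have h := Subalgebra.sum_mem (polyFunctions σ) fun k (_ : k ∈ (Finset.univ : Finset a)) =>
    mul_mem (hv k) (const_mem_polyFunctions (T (Pi.single k 1) i j))
  convert! h
  rename_i z
  change T (v z) i j = _
  conv_lhs => rw [pi_eq_sum_univ' (v z), map_sum]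
  simp [Matrix.sum_apply]

end PolynomialFunctions

namespace LinearFrame

variable (S : LinearFrame Δ) {p : Fin n → ℂ} (hp : Δ.1 p ≠ 0)

/-- Converse of `fieldAt_conj`: these equations force g to normalize the Lie algebra, hence to
preserve D. -/
theorem isotropy_of_equations (hΔ : IsReducedEquation Δ) {g : GL (Fin n) ℂ}
    (hgp : g.1 *ᵥ p = p)
    (h1 : ∀ A : logMatrices Δ, g.1 * A.1 = S.fieldAt hp (g.1 *ᵥ A.1 *ᵥ p) * g.1)
    (h2 : ∀ A : logMatrices Δ, g⁻¹.1 * A.1 = S.fieldAt hp (g⁻¹.1 *ᵥ A.1 *ᵥ p) * g⁻¹.1) :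
    g ∈ isotropy Δ p := by
  refine ⟨S.mem_stabilizerGroup_of_conj hΔ.ne_zero (fun A hA => ?_) (fun A hA => ?_), hgp⟩
  · rw [h1 ⟨A, hA⟩, mul_assoc, Units.mul_inv, mul_one]
    exact S.fieldAt_mem hp _
  · rw [h2 ⟨A, hA⟩, mul_assoc, Units.inv_mul, mul_one]
    exact S.fieldAt_mem hp _

include S hp in
/-- The isotropy group of a point off the divisor is finite: it is discrete and algebraic. -/
theorem isotropy_finite (hΔ : IsReducedEquation Δ) : Finite (isotropy Δ p) := by
  -- The coordinates are the entries of g (`true`) and of g⁻¹ (`false`). With the inverse as an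
  -- additional variable, invertibility and both normalization conditions are polynomial: `E₁` says
  -- that the two matrices are inverse, `E₂` that g fixes p, and `E₃` is the equation of
  -- `fieldAt_conj`.
  let G : Bool → (Bool × Fin n × Fin n → ℂ) → Matrix (Fin n) (Fin n) ℂ :=
    fun s z => Matrix.of fun i j => z (s, i, j)
  have hG : ∀ s, IsPolyMatrix (G s) := fun s i j => coord_mem_polyFunctions (s, i, j)
  let E₁ : (Bool × Fin n × Fin n → ℂ) → Matrix (Fin n) (Fin n) ℂ := fun z =>
    G true z * G false z - 1
  let E₂ : Fin n → (Bool × Fin n × Fin n → ℂ) → ℂ := fun i z => (G true z *ᵥ p) i - p i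
  let E₃ : Bool → logMatrices Δ → (Bool × Fin n × Fin n → ℂ) → Matrix (Fin n) (Fin n) ℂ :=
    fun s A z => G s z * A.1 - S.fieldAt hp (G s z *ᵥ A.1 *ᵥ p) * G s z
  let F : Set ((Bool × Fin n × Fin n → ℂ) → ℂ) :=
    (Set.range fun q : Fin n × Fin n => fun z => E₁ z q.1 q.2) ∪ Set.range E₂ ∪
      Set.range fun q : Bool × logMatrices Δ × Fin n × Fin n =>
        fun z => E₃ q.1 q.2.1 z q.2.2.1 q.2.2.2
  have hF : F ⊆ polyFunctions (Bool × Fin n × Fin n) := by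
    rintro _ ((⟨⟨i, j⟩, rfl⟩ | ⟨i, rfl⟩) | ⟨⟨s, A, i, j⟩, rfl⟩)
    · exact ((hG true).mul (hG false)).sub (.const 1) i j
    · exact sub_mem ((hG true).mulVec p i) (const_mem_polyFunctions (p i))
    · exact ((hG s).mul (.const A.1)).sub
        ((IsPolyMatrix.linearMap (fun k => (hG s).mulVec (A.1 *ᵥ p) k) (S.fieldAt hp)).mul (hG s))
        i j
  have hZ : ∀ z, (∀ f ∈ F, f z = 0) ↔ G true z * G false z = 1 ∧ G true z *ᵥ p = p ∧
      ∀ s (A : logMatrices Δ), G s z * A.1 = S.fieldAt hp (G s z *ᵥ A.1 *ᵥ p) * G s z := by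
    intro z
    constructor
    · intro h
      refine ⟨sub_eq_zero.1 (Matrix.ext fun i j => h _ (.inl (.inl ⟨(i, j), rfl⟩))),
        funext fun i => sub_eq_zero.1 (h _ (.inl (.inr ⟨i, rfl⟩))), fun s A =>
        sub_eq_zero.1 (Matrix.ext fun i j => h _ (.inr ⟨(s, A, i, j), rfl⟩))⟩
    · rintro ⟨h1, h2, h3⟩ _ ((⟨⟨i, j⟩, rfl⟩ | ⟨i, rfl⟩) | ⟨⟨s, A, i, j⟩, rfl⟩)
      · exact congrFun (congrFun (sub_eq_zero.2 h1) i) j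
      · exact sub_eq_zero.2 (congrFun h2 i)
      · exact congrFun (congrFun (sub_eq_zero.2 (h3 s A)) i) j
  let c : isotropy Δ p → (Bool × Fin n × Fin n → ℂ) := fun g q =>
    if q.1 then g.1.1 q.2.1 q.2.2 else g.1⁻¹.1 q.2.1 q.2.2
  have hc1 : ∀ g, G true (c g) = g.1.1 := fun g => by ext; simp [G, c]
  have hc2 : ∀ g, G false (c g) = g.1⁻¹.1 := fun g => by ext; simp [G, c]
  have hrange : {z | ∀ f ∈ F, f z = 0} = Set.range c := by
    ext z
    rw [Set.mem_ofPred_eq, hZ]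
    constructor
    · rintro ⟨h1, h2, h3⟩
      refine ⟨⟨⟨G true z, G false z, h1, _root_.mul_eq_one_comm.1 h1⟩,
        S.isotropy_of_equations hp hΔ h2 (h3 true) (h3 false)⟩, ?_⟩
      ext ⟨s, i, j⟩
      cases s <;> rfl
    · rintro ⟨g, rfl⟩
      rw [hc1, hc2]
      refine ⟨Units.mul_inv _, g.2.2, ?_⟩
      rintro (_ | _) A
      · rw [hc2]
        exact S.fieldAt_conj hp hΔ (g⁻¹).2.1 (g⁻¹).2.2 A.2
      · rw [hc1]
        exact S.fieldAt_conj hp hΔ g.2.1 g.2.2 A.2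
  have : Countable (isotropy Δ p) := S.isotropy_countable hp hΔ
  have hfin := finite_zeros_of_countable hF (hrange ▸ Set.countable_range c)
  rw [hrange] at hfin
  have hinj : Function.Injective c := fun g h hgh =>
    Subtype.ext (Units.ext (by rw [← hc1, ← hc1, hgh]))
  have := hfin.to_subtype
  exact Finite.of_injective (Set.rangeFactorization c)
    (Set.rangeFactorization_injective.2 hinj)

end LinearFrame

end LFD
end

/-! ### The exponential map and local transitivity -/

noncomputable section

namespace LFD

open Matrix NormedSpace Topology

variable {n : ℕ} {Δ : entireFunctions n}

theorem countable_zeros {f : ℂ → ℂ} (hf : AnalyticOnNhd ℂ f Set.univ) {a : ℂ} (ha : f a ≠ 0) :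
    {z | f z = 0}.Countable := by
  have h := mem_codiscrete'.1 (hf.preimage_zero_mem_codiscrete ha)
  have h2 : (f ⁻¹' {0}ᶜ)ᶜ = {z | f z = 0} := by ext; simp
  rw [h2] at h
  have := h.2.to_subtype
  have hc : Countable {z | f z = 0} := countable_of_Lindelof_of_discrete
  exact Set.countable_coe_iff.1 hc

/-- On the complex line through two points off D the zeros of Δ form a countable set, and the
complement of a countable subset of ℂ is path connected. -/
theorem isPathConnected_compl_divisor (h0 : Δ ≠ 0) : IsPathConnected (divisorSet Δ)ᶜ := by
  obtain ⟨a, ha⟩ : ∃ a, Δ.1 a ≠ 0 := by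
    by_contra! h
    exact h0 (Subtype.ext (funext h))
  refine ⟨a, ha, fun {b} hb => ?_⟩
  let γ : ℂ → (Fin n → ℂ) := fun z => a + z • (b - a)
  have hγ : Continuous γ := by fun_prop
  have han : AnalyticOnNhd ℂ (fun z => Δ.1 (γ z)) Set.univ := fun z _ =>
    (Δ.2 (γ z) (Set.mem_univ _)).comp (f := γ) (by fun_prop)
  have hγ0 : γ 0 = a := by simp [γ]
  have hγ1 : γ 1 = b := by simp [γ]
  have hc := countable_zeros han (a := 0) (by rwa [hγ0])
  have hp := (hc.isPathConnected_compl_of_one_lt_rank (by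
    rw [Complex.rank_real_complex]; norm_num)).image hγ
  have hj := hp.joinedIn (γ 0) ⟨0, by simpa [hγ0] using ha, rfl⟩ (γ 1)
    ⟨1, by rw [Set.mem_compl_iff, Set.mem_ofPred_eq, hγ1]; exact hb, rfl⟩
  rw [hγ0, hγ1] at hj
  refine hj.mono ?_
  rintro _ ⟨z, hz, rfl⟩
  exact hz

namespace LinearFrame

variable (S : LinearFrame Δ) (hΔ : IsReducedEquation Δ)

/-- The exponential of an element of the Lie algebra, in the identity component of `G_D`. -/
def expG (A : logMatrices Δ) : identityComponent (divisorSet Δ) :=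
  ⟨⟨expGL A.1, S.expGL_mem hΔ.ne_zero A.2⟩, by
    let f : ℝ → stabilizerGroup (divisorSet Δ) := fun t =>
      ⟨expGL ((t : ℂ) • A.1), S.expGL_mem hΔ.ne_zero ((logMatrices Δ).smul_mem _ A.2)⟩
    have hf : Continuous f := by
      refine Continuous.subtype_mk (continuous_expGL.comp ?_) _
      fun_prop
    have h1 : f 0 = 1 := by
      ext1; ext1; simp [f, expGL_val]
    have h := (isPreconnected_range hf).subset_connectedComponent (x := 1) ⟨0, h1⟩
    have h2 := h ⟨1, rfl⟩
    simpa [f] using! h2⟩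

theorem expG_val (A : logMatrices Δ) : (S.expG hΔ A).1.1.1 = exp A.1 := rfl

theorem continuous_expG : Continuous (S.expG hΔ) :=
  Continuous.subtype_mk (Continuous.subtype_mk (continuous_expGL.comp continuous_subtype_val) _) _

theorem expG_zero : S.expG hΔ 0 = 1 := by
  ext1; ext1; ext1
  exact exp_zero

theorem joined_one_expG (A : logMatrices Δ) : Joined 1 (S.expG hΔ A) := by
  refine ⟨⟨⟨fun t => S.expG hΔ ((t : ℂ) • A), ?_⟩, ?_, ?_⟩⟩
  · exact (S.continuous_expG hΔ).comp (by fun_prop)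
  · simp [S.expG_zero hΔ]
  · simp

/-- The exponential in coordinates. -/
def expCoord (c : Fin (Module.finrank ℂ (logMatrices Δ)) → ℂ) : identityComponent (divisorSet Δ) :=
  S.expG hΔ (∑ i, c i • Module.finBasis ℂ (logMatrices Δ) i)

theorem continuous_expCoord : Continuous (S.expCoord hΔ) :=
  (S.continuous_expG hΔ).comp (continuous_induced_rng.2 (by
    have : (Subtype.val ∘ fun c : Fin (Module.finrank ℂ (logMatrices Δ)) → ℂ =>
        ∑ i, c i • Module.finBasis ℂ (logMatrices Δ) i) =
        fun c => ∑ i, c i • (Module.finBasis ℂ (logMatrices Δ) i).1 := by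
      ext1 c; simp
    rw [this]
    fun_prop))

theorem expCoord_zero : S.expCoord hΔ 0 = 1 := by simp [expCoord, S.expG_zero hΔ]

/-- The derivative of c ↦ exp(c) q at 0 is evaluation at q, which is surjective off D, so the map is
open at 0. -/
theorem map_expCoord_mulVec_nhds {q : Fin n → ℂ} (hq : Δ.1 q ≠ 0) :
    Filter.map (fun c => (S.expCoord hΔ c).1.1.1 *ᵥ q) (𝓝 0) = 𝓝 q := by
  have h := hasStrictFDerivAt_exp_mulVec
    (fun i => (Module.finBasis ℂ (logMatrices Δ) i).1) q
  have hsum : ∀ c : Fin (Module.finrank ℂ (logMatrices Δ)) → ℂ,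
      (∑ i, c i • Module.finBasis ℂ (logMatrices Δ) i).1 =
        ∑ i, c i • (Module.finBasis ℂ (logMatrices Δ) i).1 := fun c => by
    simp
  have hfun : (fun c => (S.expCoord hΔ c).1.1.1 *ᵥ q) = fun c =>
      exp (∑ i, c i • (Module.finBasis ℂ (logMatrices Δ) i).1) *ᵥ q := by
    funext c
    rw [expCoord, expG_val, hsum]
  have hsurj := h.map_nhds_eq_of_surj (by
    rw [LinearMap.coe_toContinuousLinearMap, LinearMap.range_eq_top]
    intro v
    obtain ⟨A, hA⟩ := (S.orbitMap_bijective hq).2 v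
    refine ⟨(Module.finBasis ℂ (logMatrices Δ)).repr A, ?_⟩
    rw [← hA, orbitMap_apply]
    conv_rhs => rw [← (Module.finBasis ℂ (logMatrices Δ)).sum_repr A, hsum, sum_mulVec]
    simp [smul_mulVec])
  rw [hfun, hsurj]
  congr 1
  simp

include S hΔ in
theorem image_mem_nhds {q : Fin n → ℂ} (hq : Δ.1 q ≠ 0)
    {U : Set (identityComponent (divisorSet Δ))} (hU : U ∈ 𝓝 1) :
    (fun g : identityComponent (divisorSet Δ) => g.1.1.1 *ᵥ q) '' U ∈ 𝓝 q := by
  rw [← S.map_expCoord_mulVec_nhds hΔ hq]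
  have h : S.expCoord hΔ ⁻¹' U ∈ 𝓝 0 :=
    (S.continuous_expCoord hΔ).continuousAt.preimage_mem_nhds (by rwa [S.expCoord_zero hΔ])
  exact Filter.mem_of_superset (Filter.image_mem_map h) (by
    rintro _ ⟨c, hc, rfl⟩
    exact ⟨_, hc, rfl⟩)

end LinearFrame

end LFD
end

/-! ### The orbit map as a finite covering -/

noncomputable section

namespace LFD

open Matrix NormedSpace Topology

variable {n : ℕ} {Δ : entireFunctions n}

namespace LinearFrame

variable (S : LinearFrame Δ) (hΔ : IsReducedEquation Δ) {p : Fin n → ℂ} (hp : Δ.1 p ≠ 0)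

theorem continuous_coe_mulVec (q : Fin n → ℂ) :
    Continuous fun g : identityComponent (divisorSet Δ) => g.1.1.1 *ᵥ q :=
  (Units.continuous_val.comp (continuous_subtype_val.comp continuous_subtype_val)).matrix_mulVec
    continuous_const

include S hΔ hp in
/-- Near the identity the group consists of exponentials. -/
theorem eventually_exists_expCoord :
    ∀ᶠ g in 𝓝 (1 : identityComponent (divisorSet Δ)), ∃ c, S.expCoord hΔ c = g := by
  have hval : Continuous fun g : identityComponent (divisorSet Δ) => g.1.1.1 :=
    Units.continuous_val.comp (continuous_subtype_val.comp continuous_subtype_val)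
  have h1 : ∀ᶠ g in 𝓝 (1 : identityComponent (divisorSet Δ)), g.1.1.1 *ᵥ p = p → g = 1 := by
    filter_upwards [hval.continuousAt.eventually (S.eventually_eq_one hp hΔ)] with g hg hgp
    exact Subtype.ext (Subtype.ext (hg g.1.1 rfl g.1.2 hgp))
  have h2 : ContinuousAt (fun x : (Fin (Module.finrank ℂ (logMatrices Δ)) → ℂ) ×
      identityComponent (divisorSet Δ) => (S.expCoord hΔ x.1)⁻¹ * x.2) (0, 1) :=
    (((S.continuous_expCoord hΔ).comp continuous_fst).inv.mul continuous_snd).continuousAt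
  have h3 := h2.eventually (by
    simpa only [S.expCoord_zero hΔ, inv_one, mul_one] using h1)
  rw [nhds_prod_eq] at h3
  obtain ⟨P, hP, Q, hQ, hPQ⟩ := Filter.eventually_prod_iff.1 h3
  -- By local transitivity, for g near 1 there is a small c with g p = exp(c) p. Then exp(c)⁻¹ g
  -- fixes p and is near 1, hence equals 1 because the isotropy group is discrete.
  have h4 : (fun c => (S.expCoord hΔ c).1.1.1 *ᵥ p) '' {c | P c} ∈ 𝓝 p := by
    rw [← S.map_expCoord_mulVec_nhds hΔ hp]
    exact Filter.image_mem_map hP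
  have h5 : ∀ᶠ g in 𝓝 (1 : identityComponent (divisorSet Δ)),
      g.1.1.1 *ᵥ p ∈ (fun c => (S.expCoord hΔ c).1.1.1 *ᵥ p) '' {c | P c} :=
    (continuous_coe_mulVec p).continuousAt.preimage_mem_nhds (by
      rwa [show (1 : identityComponent (divisorSet Δ)).1.1.1 *ᵥ p = p from one_mulVec p])
  filter_upwards [hQ, h5] with g hg hgp
  obtain ⟨c, hc, hcp⟩ := hgp
  refine ⟨c, ?_⟩
  have h6 := hPQ hc hg ?_
  · exact inv_mul_eq_one.1 h6
  · change ((S.expCoord hΔ c)⁻¹.1.1.1 * g.1.1.1) *ᵥ p = p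
    rw [← mulVec_mulVec, ← hcp, mulVec_mulVec]
    change ((S.expCoord hΔ c).1.1⁻¹.1 * (S.expCoord hΔ c).1.1.1) *ᵥ p = p
    rw [Units.inv_mul, one_mulVec]

instance : ConnectedSpace (identityComponent (divisorSet Δ)) :=
  Subtype.connectedSpace isConnected_connectedComponent

-- The path component of 1 is a subgroup containing a neighbourhood of 1, as exponentials are joined
-- to 1. It is thus open and closed in the connected group G_D°.
include S hΔ hp in
theorem joined_one (g : identityComponent (divisorSet Δ)) : Joined 1 g := by
  have hopen : IsOpen (Subgroup.pathComponentOne (identityComponent (divisorSet Δ)) :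
      Set (identityComponent (divisorSet Δ))) := by
    refine Subgroup.isOpen_of_mem_nhds (g := 1) _ ?_
    filter_upwards [S.eventually_exists_expCoord hΔ hp] with g hg
    obtain ⟨c, rfl⟩ := hg
    exact S.joined_one_expG hΔ _
  have h := IsClopen.eq_univ ⟨Subgroup.isClosed_of_isOpen _ hopen, hopen⟩
    ⟨1, Subgroup.one_mem _⟩
  have h2 : g ∈ (Subgroup.pathComponentOne (identityComponent (divisorSet Δ)) :
      Set (identityComponent (divisorSet Δ))) := h ▸ Set.mem_univ g
  exact h2

theorem mulVec_ne_zero (g : identityComponent (divisorSet Δ)) {q : Fin n → ℂ} (hq : Δ.1 q ≠ 0) :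
    Δ.1 (g.1.1.1 *ᵥ q) ≠ 0 := fun h => hq ((mem_stabilizerGroup_iff.1 g.1.2 q).1 h)

/-- The orbit map `G_D° → ℂⁿ ∖ D`. -/
def groupOrbit (hp : Δ.1 p ≠ 0) (g : identityComponent (divisorSet Δ)) : ↥(divisorSet Δ)ᶜ :=
  ⟨g.1.1.1 *ᵥ p, mulVec_ne_zero g hp⟩

theorem continuous_groupOrbit : Continuous (groupOrbit hp) :=
  (continuous_coe_mulVec p).subtype_mk _

theorem coe_mul_mulVec (g h : identityComponent (divisorSet Δ)) (q : Fin n → ℂ) :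
    (g * h).1.1.1 *ᵥ q = g.1.1.1 *ᵥ h.1.1.1 *ᵥ q := (mulVec_mulVec _ _ _).symm

include S hΔ in
theorem isOpenMap_groupOrbit : IsOpenMap (groupOrbit hp) := by
  intro U hU
  rw [isOpen_iff_mem_nhds]
  rintro _ ⟨g, hg, rfl⟩
  have h1 : (fun h => h * g) ⁻¹' U ∈ 𝓝 (1 : identityComponent (divisorSet Δ)) :=
    (continuous_mul_const g).continuousAt.preimage_mem_nhds (hU.mem_nhds (by simpa using hg))
  have h2 := S.image_mem_nhds hΔ (groupOrbit hp g).2 h1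
  have h3 := continuous_subtype_val.continuousAt.preimage_mem_nhds h2
  filter_upwards [h3] with x hx
  obtain ⟨h, hh, hx⟩ := hx
  exact ⟨h * g, hh, Subtype.ext ((coe_mul_mulVec h g p).trans hx)⟩

-- All orbits in the complement of D are open, so the orbit of p is also closed; the complement is
-- connected.
include S hΔ in
theorem surjective_groupOrbit : Function.Surjective (groupOrbit hp) := by
  have hconn : ConnectedSpace ↥(divisorSet Δ)ᶜ :=
    Subtype.connectedSpace (isPathConnected_compl_divisor hΔ.ne_zero).isConnected
  have hopen : IsOpen (Set.range (groupOrbit hp)) := (S.isOpenMap_groupOrbit hΔ hp).isOpen_range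
  have hclosed : IsClosed (Set.range (groupOrbit hp)) := by
    rw [← isOpen_compl_iff, isOpen_iff_mem_nhds]
    intro q hq
    have h3 := continuous_subtype_val.continuousAt.preimage_mem_nhds
      (S.image_mem_nhds hΔ q.2 Filter.univ_mem)
    filter_upwards [h3] with x hx
    obtain ⟨h, -, hx⟩ := hx
    rintro ⟨g, rfl⟩
    refine hq ⟨h⁻¹ * g, Subtype.ext ?_⟩
    change (h⁻¹ * g).1.1.1 *ᵥ p = q.1
    rw [coe_mul_mulVec]
    change _ = g.1.1.1 *ᵥ p at hx
    rw [← hx, ← coe_mul_mulVec, inv_mul_cancel]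
    exact one_mulVec _
  exact Set.range_eq_univ.1 (IsClopen.eq_univ ⟨hclosed, hopen⟩ (Set.range_nonempty _))

/-- The isotropy group of `p` in `G_D°`. -/
def isotropyG (Δ : entireFunctions n) (p : Fin n → ℂ) : Subgroup (identityComponent (divisorSet Δ)) :=
  (isotropy Δ p).comap ((stabilizerGroup (divisorSet Δ)).subtype.comp
    (identityComponent (divisorSet Δ)).subtype)

include S hΔ hp in
theorem finite_isotropyG : Finite (isotropyG Δ p) := by
  have := S.isotropy_finite hp hΔ
  refine Finite.of_injective (β := isotropy Δ p) (fun g => ⟨g.1.1.1, g.2⟩) fun g h hgh => ?_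
  have h1 : g.1.1.1 = h.1.1.1 := congrArg (fun x : isotropy Δ p => x.1) hgh
  exact Subtype.ext (Subtype.ext (Subtype.ext h1))

theorem groupOrbit_eq_iff {g h : identityComponent (divisorSet Δ)} :
    groupOrbit hp g = groupOrbit hp h ↔ g⁻¹ * h ∈ isotropyG Δ p := by
  have key : g⁻¹ * h ∈ isotropyG Δ p ↔ (g⁻¹ * h).1.1.1 *ᵥ p = p :=
    ⟨fun H => H.2, fun H => ⟨(g⁻¹ * h).1.2, H⟩⟩
  rw [key, coe_mul_mulVec, Subtype.ext_iff]
  change g.1.1.1 *ᵥ p = h.1.1.1 *ᵥ p ↔ _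
  constructor
  · intro H
    rw [← H, ← coe_mul_mulVec, inv_mul_cancel]
    exact one_mulVec _
  · intro H
    conv_lhs => rw [← H]
    rw [← coe_mul_mulVec, ← coe_mul_mulVec, mul_inv_cancel, one_mul]

-- The orbit map is the quotient by the right action of the isotropy group, which is discrete
-- because it is finite.
include S hΔ in
theorem isCoveringMap_groupOrbit : IsCoveringMap (groupOrbit hp) := by
  have := S.finite_isotropyG hΔ hp
  have hq : IsQuotientMap (groupOrbit hp) := (S.isOpenMap_groupOrbit hΔ hp).isQuotientMap
    (continuous_groupOrbit hp) (S.surjective_groupOrbit hΔ hp)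
  exact (hq.isQuotientCoveringMap_of_subgroupOp (isotropyG Δ p)
    ⟨inferInstanceAs (DiscreteTopology (isotropyG Δ p))⟩ (groupOrbit_eq_iff hp)).isCoveringMap

end LinearFrame

end LFD
end

/-! ### Duals of chain complexes -/

noncomputable section

namespace LFD

section DualComplex

open Homotopy

/-- The transpose of a linear map. -/
def dualHom {A B : ModuleCat.{0} ℂ} (f : A ⟶ B) :
    ModuleCat.of ℂ (Module.Dual ℂ B) ⟶ ModuleCat.of ℂ (Module.Dual ℂ A) :=
  ModuleCat.ofHom f.hom.dualMap

theorem dualHom_comp {A B C : ModuleCat.{0} ℂ} (f : A ⟶ B) (g : B ⟶ C) :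
    dualHom (f ≫ g) = dualHom g ≫ dualHom f := rfl

theorem dualHom_add {A B : ModuleCat.{0} ℂ} (f g : A ⟶ B) :
    dualHom (f + g) = dualHom f + dualHom g := by
  ext : 1
  exact LinearMap.ext fun a => LinearMap.ext fun x => map_add a _ _

theorem dualHom_zero {A B : ModuleCat.{0} ℂ} : dualHom (0 : A ⟶ B) = 0 := by
  ext : 1
  exact LinearMap.ext fun a => LinearMap.ext fun x => map_zero a

theorem dualHom_nsmul {A B : ModuleCat.{0} ℂ} (N : ℕ) (f : A ⟶ B) :
    dualHom (N • f) = N • dualHom f := by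
  induction N with
  | zero => rw [zero_smul, zero_smul, dualHom_zero]
  | succ N ih => rw [succ_nsmul, succ_nsmul, dualHom_add, ih]

/-- The dual cochain complex of a chain complex of vector spaces. -/
def dualComplex (K : ChainComplex (ModuleCat.{0} ℂ) ℕ) : CochainComplex (ModuleCat.{0} ℂ) ℕ :=
  CochainComplex.of (fun k => ModuleCat.of ℂ (Module.Dual ℂ (K.X k)))
    (fun k => dualHom (K.d (k + 1) k))
    (fun k => by rw [← dualHom_comp, K.d_comp_d, dualHom_zero])

variable {K L M : ChainComplex (ModuleCat.{0} ℂ) ℕ}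

theorem dualComplex_d (k : ℕ) : (dualComplex K).d k (k + 1) = dualHom (K.d (k + 1) k) := by
  simp only [dualComplex, CochainComplex.of_d]

/-- The transpose of a chain map. -/
def dualComplexMap (φ : K ⟶ L) : dualComplex L ⟶ dualComplex K :=
  CochainComplex.ofHom (fun k => dualHom (φ.f k))
    (fun k => by
      rw [dualComplex_d, dualComplex_d]
      exact congrArg dualHom (φ.comm (k + 1) k).symm)

theorem dualComplexMap_f (φ : K ⟶ L) (k : ℕ) : (dualComplexMap φ).f k = dualHom (φ.f k) := rfl

theorem dualComplexMap_comp (φ : K ⟶ L) (ψ : L ⟶ M) :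
    dualComplexMap (φ ≫ ψ) = dualComplexMap ψ ≫ dualComplexMap φ := by
  ext k : 1
  rfl

theorem dualComplexMap_nsmul_id (N : ℕ) :
    dualComplexMap (N • 𝟙 K) = N • 𝟙 (dualComplex K) := by
  ext k : 1
  have h1 : (N • 𝟙 K : K ⟶ K).f k = N • 𝟙 (K.X k) := by simp
  have h2 : (N • 𝟙 (dualComplex K) : dualComplex K ⟶ _).f k = N • 𝟙 ((dualComplex K).X k) := by
    simp
  rw [dualComplexMap_f, h1, h2]
  exact dualHom_nsmul N _

/-- The transpose of a family of maps between the terms of two complexes. -/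
def dualFamily (f : ∀ i j, K.X i ⟶ L.X j) (i j : ℕ) :
    (dualComplex L).X i ⟶ (dualComplex K).X j :=
  dualHom (f j i)

/-- The transpose of a chain homotopy. -/
def dualComplexHomotopy {φ ψ : K ⟶ L} (h : Homotopy φ ψ) :
    Homotopy (dualComplexMap φ) (dualComplexMap ψ) where
  hom := dualFamily h.hom
  zero i j hij := by
    rw [dualFamily, h.zero j i hij]
    exact dualHom_zero
  comm i := by
    have hc := h.comm i
    cases i with
    | zero =>
      rw [dNext_zero_chainComplex, zero_add, prevD_chainComplex] at hc
      rw [prevD_zero_cochainComplex, dNext_cochainComplex, add_zero, dualComplex_d,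
        dualComplexMap_f, dualComplexMap_f]
      exact (congrArg dualHom hc).trans (dualHom_add _ _)
    | succ i =>
      rw [dNext_succ_chainComplex, prevD_chainComplex, add_comm (K.d _ _ ≫ _)] at hc
      rw [prevD_succ_cochainComplex, dNext_cochainComplex, dualComplex_d, dualComplex_d,
        dualComplexMap_f, dualComplexMap_f]
      exact ((congrArg dualHom hc).trans (dualHom_add _ _)).trans
        (congrArg (· + dualHom (ψ.f (i + 1))) (dualHom_add _ _))

theorem homologyMap_nsmul_id (C : CochainComplex (ModuleCat.{0} ℂ) ℕ) (N k : ℕ) :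
    HomologicalComplex.homologyMap (N • 𝟙 C) k = N • 𝟙 (C.homology k) := by
  have h := (HomologicalComplex.homologyFunctor (ModuleCat.{0} ℂ) (ComplexShape.up ℕ) k).map_nsmul
    (f := 𝟙 C) (n := N)
  rw [CategoryTheory.Functor.map_id] at h
  exact h

/-- Chain maps that are inverse to each other up to homotopy and multiplication by a positive
integer induce isomorphisms on the cohomology of the dual complexes. -/
theorem nonempty_homology_dualComplex_iso {N : ℕ} (hN : N ≠ 0) (φ : K ⟶ L) (ψ : L ⟶ K)
    (h1 : ψ ≫ φ = N • 𝟙 L) (h2 : Homotopy (φ ≫ ψ) (N • 𝟙 K)) (k : ℕ) :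
    Nonempty ((dualComplex K).homology k ≅ (dualComplex L).homology k) := by
  let α := HomologicalComplex.homologyMap (dualComplexMap φ) k
  let β := HomologicalComplex.homologyMap (dualComplexMap ψ) k
  have hαβ : α ≫ β = N • 𝟙 _ := by
    rw [← homologyMap_nsmul_id, ← dualComplexMap_nsmul_id, ← h1, dualComplexMap_comp,
      HomologicalComplex.homologyMap_comp]
  have hβα : β ≫ α = N • 𝟙 _ := by
    rw [← homologyMap_nsmul_id, ← dualComplexMap_nsmul_id, ← HomologicalComplex.homologyMap_comp,
      ← dualComplexMap_comp]
    exact (dualComplexHomotopy h2).homologyMap_eq k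
  have e1 : ∀ x, β.hom (α.hom x) = (N : ℂ) • x := fun x => by
    have := congrArg (fun f => f.hom x) hαβ
    simpa [Nat.cast_smul_eq_nsmul] using! this
  have e2 : ∀ x, α.hom (β.hom x) = (N : ℂ) • x := fun x => by
    have := congrArg (fun f => f.hom x) hβα
    simpa [Nat.cast_smul_eq_nsmul] using! this
  have hN' : (N : ℂ) ≠ 0 := Nat.cast_ne_zero.2 hN
  -- Both composites are multiplication by N, which is invertible over ℂ.
  have : IsIso α := by
    rw [ConcreteCategory.isIso_iff_bijective]
    refine ⟨fun x y hxy => ?_, fun y => ⟨(N : ℂ)⁻¹ • β.hom y, ?_⟩⟩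
    · have h3 : (N : ℂ) • x = (N : ℂ) • y := by
        rw [← e1, ← e1]
        exact congrArg β.hom hxy
      exact smul_right_injective _ hN' h3
    · change α.hom _ = y
      rw [map_smul, e2, smul_smul, inv_mul_cancel₀ hN', one_smul]
  exact ⟨(asIso α).symm⟩

end DualComplex

end LFD
end

/-! ### The transfer for finite simplicial covers -/

noncomputable section

namespace LFD

section Transfer

open Simplicial Limits Opposite

theorem sum_f_apply {K L : ChainComplex (ModuleCat.{0} ℂ) ℕ} {ι : Type*} (s : Finset ι)
    (φ : ι → (K ⟶ L)) (k : ℕ) : (∑ f ∈ s, φ f).f k = ∑ f ∈ s, (φ f).f k :=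
  (HomologicalComplex.eval (ModuleCat.{0} ℂ) (ComplexShape.down ℕ) k).map_sum φ s

/-- A map of simplicial sets whose fibres are permuted simply transitively by a finite family of
endomorphisms over the base. -/
structure SimplicialCover {A B : SSet.{0}} (π : A ⟶ B) (ι : Type) where
  act : ι → (A ⟶ A)
  act_comp : ∀ f, act f ≫ π = π
  surjective : ∀ k : ℕ, Function.Surjective (π.app (op ⦋k⦌))
  existsUnique : ∀ (k : ℕ) (a b : A _⦋k⦌), π.app _ a = π.app _ b → ∃! f, (act f).app _ a = b

namespace SimplicialCover

variable {A B : SSet.{0}} {π : A ⟶ B} {ι : Type} [Fintype ι] (T : SimplicialCover π ι)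
  (R : ModuleCat.{0} ℂ)

omit [Fintype ι] in
theorem app_act {k : ℕ} (f : ι) (a : A _⦋k⦌) : π.app _ ((T.act f).app _ a) = π.app _ a :=
  congrArg (fun φ : A ⟶ B => φ.app (op ⦋k⦌) a) (T.act_comp f)

/-- The translates of two simplices over the same base simplex are the same family, reindexed by σ.
Only existence and uniqueness of the translating index are used, not a group structure on ι. -/
theorem sum_act_eq {k : ℕ} {a b : A _⦋k⦌} (h : π.app _ a = π.app _ b) {M : Type*} [AddCommMonoid M]
    (φ : A _⦋k⦌ → M) : ∑ f, φ ((T.act f).app _ a) = ∑ f, φ ((T.act f).app _ b) := by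
  have e : ∀ f, ∃! g, (T.act g).app _ b = (T.act f).app _ a := fun f =>
    T.existsUnique k _ _ (by rw [app_act, h])
  choose σ hσ hσ' using e
  have hbij : Function.Bijective σ := by
    constructor
    · intro f g hfg
      have h1 : (T.act f).app _ a = (T.act g).app _ a := by rw [← hσ, ← hσ, hfg]
      exact (T.existsUnique k a _ (T.app_act g a).symm).unique h1 rfl
    · intro g
      obtain ⟨f, hf, -⟩ := T.existsUnique k a ((T.act g).app _ b) (by rw [app_act, h])
      exact ⟨f, (hσ' f g hf.symm).symm⟩
  exact Fintype.sum_bijective σ hbij _ _ fun f => by rw [hσ]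

/-- A lift of each simplex of the base. -/
def lift {k : ℕ} (b : B _⦋k⦌) : A _⦋k⦌ := (T.surjective k b).choose

omit [Fintype ι] in
theorem app_lift {k : ℕ} (b : B _⦋k⦌) : π.app _ (T.lift b) = b := (T.surjective k b).choose_spec

/-- The transfer in a given degree: a simplex is sent to the sum of its lifts. -/
def transferX (k : ℕ) : (B.chainComplex R).X k ⟶ (A.chainComplex R).X k :=
  Cofan.IsColimit.desc (B.isColimitChainComplexXCofan R k) fun b =>
    ∑ f, A.ιChainComplex ((T.act f).app _ (T.lift b))

theorem ι_transferX {k : ℕ} (b : B _⦋k⦌) : B.ιChainComplex b ≫ T.transferX R k =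
    ∑ f, A.ιChainComplex ((T.act f).app _ (T.lift b)) :=
  Cofan.IsColimit.fac (B.isColimitChainComplexXCofan R k) _ b

/-- The transfer does not depend on the chosen lift. This makes it compatible with faces, since a
face of a lift is a lift of the face but need not be the chosen one. -/
theorem ι_transferX_app {k : ℕ} (a : A _⦋k⦌) :
    B.ιChainComplex (π.app _ a) ≫ T.transferX R k =
      ∑ f, A.ιChainComplex (R := R) ((T.act f).app _ a) := by
  rw [ι_transferX]
  exact T.sum_act_eq (T.app_lift _) fun a => A.ιChainComplex (R := R) a

/-- The transfer map of simplicial chain complexes. -/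
def transfer : B.chainComplex R ⟶ A.chainComplex R where
  f := T.transferX R
  comm' i j hij := by
    obtain rfl : j + 1 = i := hij
    refine SSet.chainComplex_hom_ext fun b => ?_
    obtain ⟨a, rfl⟩ := T.surjective _ b
    rw [← Category.assoc, ι_transferX_app, SSet.ιChainComplex_d_assoc, Preadditive.sum_comp,
      Preadditive.sum_comp]
    simp only [SSet.ιChainComplex_d, Preadditive.zsmul_comp]
    rw [Finset.sum_comm]
    refine Finset.sum_congr rfl fun i _ => ?_
    rw [← Finset.smul_sum]
    have h1 : B.δ i (π.app _ a) = π.app _ (A.δ i a) := (SSet.δ_naturality_apply π i a).symm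
    rw [h1, ι_transferX_app]
    congr 1
    refine Finset.sum_congr rfl fun f _ => ?_
    rw [SSet.δ_naturality_apply]

theorem transfer_comp : T.transfer R ≫ SSet.chainComplexMap π R = Fintype.card ι • 𝟙 _ := by
  ext k : 1
  refine SSet.chainComplex_hom_ext fun b => ?_
  rw [HomologicalComplex.comp_f]
  change _ ≫ T.transferX R k ≫ _ = _
  rw [← Category.assoc, ι_transferX, Preadditive.sum_comp]
  simp [app_act, app_lift]

theorem comp_transfer :
    SSet.chainComplexMap π R ≫ T.transfer R = ∑ f, SSet.chainComplexMap (T.act f) R := by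
  ext k : 1
  refine SSet.chainComplex_hom_ext fun a => ?_
  rw [HomologicalComplex.comp_f]
  change _ ≫ _ ≫ T.transferX R k = _
  rw [SSet.ι_chainComplexMap_f_assoc, ι_transferX_app]
  rw [sum_f_apply, Preadditive.comp_sum]
  exact Finset.sum_congr rfl fun f _ => (SSet.ι_chainComplexMap_f ..).symm

end SimplicialCover

theorem nonempty_homotopy_sum {ι : Type} (s : Finset ι) {K L : ChainComplex (ModuleCat.{0} ℂ) ℕ}
    {φ ψ : ι → (K ⟶ L)} (h : ∀ f, Nonempty (Homotopy (φ f) (ψ f))) :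
    Nonempty (Homotopy (∑ f ∈ s, φ f) (∑ f ∈ s, ψ f)) := by
  classical
  induction s using Finset.induction_on with
  | empty => exact ⟨Homotopy.ofEq (by simp)⟩
  | insert a s ha ih =>
    rw [Finset.sum_insert ha, Finset.sum_insert ha]
    exact ⟨(h a).some.add ih.some⟩

end Transfer

end LFD
end

/-! ### Cohomology of finite coverings -/

noncomputable section

namespace LFD

section CoveringCohomology

open Simplicial Opposite

instance simplyConnectedSpace_toTop (m : SimplexCategory) :
    SimplyConnectedSpace (SimplexCategory.toTop.{0}.obj m) := by
  have h1 : ContractibleSpace (stdSimplex ℝ (Fin (m.len + 1))) :=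
    (convex_stdSimplex ℝ _).contractibleSpace ⟨_, single_mem_stdSimplex ℝ 0⟩
  have h2 : ContractibleSpace (ULift.{0} (stdSimplex ℝ (Fin (m.len + 1)))) :=
    Homeomorph.ulift.contractibleSpace
  exact inferInstanceAs (SimplyConnectedSpace (ULift.{0} (stdSimplex ℝ (Fin (m.len + 1)))))

instance locallyPathConnectedSpace_toTop (m : SimplexCategory) :
    LocallyPathConnectedSpace (SimplexCategory.toTop.{0}.obj m) := by
  have h1 : LocallyPathConnectedSpace (stdSimplex ℝ (Fin (m.len + 1))) :=
    (convex_stdSimplex ℝ _).locallyPathConnectedSpace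
  exact (Homeomorph.ulift.{0} (X := stdSimplex ℝ (Fin (m.len + 1)))).isOpenEmbedding.locallyPathConnectedSpace

variable {E X : Type} [TopologicalSpace E] [TopologicalSpace X] {p : C(E, X)} {ι : Type}

/-- A covering whose fibres are permuted simply transitively by a family of deck transformations
gives a cover of singular simplicial sets. -/
def simplicialCoverOfCovering (hp : IsCoveringMap p) (hs : Function.Surjective p)
    (r : ι → C(E, E)) (hr : ∀ f e, p (r f e) = p e)
    (hu : ∀ e e', p e = p e' → ∃! f, r f e = e') :
    SimplicialCover (TopCat.toSSet.map (TopCat.ofHom p)) ι where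
  act f := TopCat.toSSet.map (TopCat.ofHom (r f))
  act_comp f := by
    rw [← Functor.map_comp]
    congr 1
    ext e
    exact hr f e
  surjective k := by
    rintro ⟨b⟩
    let v : SimplexCategory.toTop.{0}.obj ⦋k⦌ := Classical.arbitrary _
    obtain ⟨e, he⟩ := hs (b.hom v)
    -- Singular simplices lift because the standard simplex is simply connected and locally path
    -- connected.
    obtain ⟨a, ⟨-, ha⟩, -⟩ := hp.existsUnique_continuousMap_lifts
      (A := SimplexCategory.toTop.{0}.obj ⦋k⦌) b.hom v e he
    refine ⟨⟨TopCat.ofHom a⟩, ULift.ext _ _ ?_⟩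
    exact TopCat.hom_ext (ContinuousMap.ext fun x => congrFun ha x)
  existsUnique k := by
    rintro ⟨a⟩ ⟨b⟩ hab
    have hab' : ∀ x, p (a.hom x) = p (b.hom x) := fun x =>
      congrArg (fun s : (TopCat.toSSet.obj (TopCat.of X)).obj (op ⦋k⦌) => s.down.hom x) hab
    let v : SimplexCategory.toTop.{0}.obj ⦋k⦌ := Classical.arbitrary _
    -- The deck transformation is fixed by its effect on the image of one vertex-independent point
    -- v; by unique lifting it then matches the two simplices everywhere.
    obtain ⟨f, hf, hf'⟩ := hu _ _ (hab' v)
    refine ⟨f, ULift.ext _ _ ?_, fun g hg => hf' g ?_⟩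
    · refine TopCat.hom_ext (ContinuousMap.ext fun x => ?_)
      exact congrFun (hp.eq_of_comp_eq (A := SimplexCategory.toTop.{0}.obj ⦋k⦌) (g₁ := fun x => r f (a.hom x)) (g₂ := b.hom)
        ((r f).continuous.comp a.hom.continuous) b.hom.continuous
        (funext fun x => (hr f _).trans (hab' x)) v hf) x
    · exact congrArg (fun s : (TopCat.toSSet.obj (TopCat.of E)).obj (op ⦋k⦌) => s.down.hom v) hg

/-- The cohomology with complex coefficients of the total space and of the base of a finite covering
agree if the deck transformations are homotopic to the identity. -/
theorem nonempty_singularCohomology_iso [Finite ι] [Nonempty ι] (hp : IsCoveringMap p)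
    (hs : Function.Surjective p) (r : ι → C(E, E)) (hr : ∀ f e, p (r f e) = p e)
    (hu : ∀ e e', p e = p e' → ∃! f, r f e = e')
    (hh : ∀ f, (r f).Homotopic (ContinuousMap.id E)) (k : ℕ) :
    Nonempty (singularCohomology E k ≅ singularCohomology X k) := by
  have := Fintype.ofFinite ι
  let T := simplicialCoverOfCovering hp hs r hr hu
  have h1 : ∀ f, Nonempty (Homotopy (SSet.chainComplexMap (T.act f) (ModuleCat.of ℂ ℂ))
      (𝟙 _)) := fun f => by
    let H : TopCat.Homotopy (TopCat.ofHom (r f)) (𝟙 (TopCat.of E)) := (hh f).some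
    refine ⟨(H.singularChainComplexFunctorObjMap (ModuleCat.of ℂ ℂ)).trans (Homotopy.ofEq ?_)⟩
    exact CategoryTheory.Functor.map_id _ _
  obtain ⟨h2⟩ := nonempty_homotopy_sum Finset.univ h1
  -- Projection followed by transfer is the sum of the deck transformations, hence homotopic to N
  -- times the identity; the other composite equals N times the identity.
  rw [← T.comp_transfer, Finset.sum_const, Finset.card_univ] at h2
  exact nonempty_homology_dualComplex_iso Fintype.card_ne_zero _ _
    (T.transfer_comp (ModuleCat.of ℂ ℂ)) h2 k

end CoveringCohomology

end LFD
end

/-! ### Comparison of the cohomologies -/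

noncomputable section

namespace LFD

section LieCohomology

variable {L L' : Type} [LieRing L] [LieAlgebra ℂ L] [LieRing L'] [LieAlgebra ℂ L']

theorem ceDiff_compLinearMap (e : L →ₗ⁅ℂ⁆ L') : ∀ (k : ℕ) (ω : L' [⋀^Fin k]→ₗ[ℂ] ℂ),
    ceDiff L k (ω.compLinearMap (e : L →ₗ[ℂ] L')) =
      (ceDiff L' k ω).compLinearMap (e : L →ₗ[ℂ] L')
  | 0, ω => by ext v; rfl
  | k + 1, ω => by
    ext v
    change ceDiffSucc L k (ω.compLinearMap (e : L →ₗ[ℂ] L')) v = ceDiffSucc L' k ω (fun i => e (v i))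
    rw [ceDiffSucc_apply, ceDiffSucc_apply]
    congr 1
    refine Finset.sum_congr rfl fun i _ => Finset.sum_congr rfl fun j _ => ?_
    congr 1
    rw [AlternatingMap.compLinearMap_apply]
    congr 1
    ext a
    refine Fin.cases ?_ (fun a => ?_) a
    · exact e.map_lie _ _
    · rfl

/-- Isomorphic Lie algebras have isomorphic Chevalley--Eilenberg complexes. -/
def ceComplexIso (e : L ≃ₗ⁅ℂ⁆ L') : ceComplex L ≅ ceComplex L' :=
  HomologicalComplex.Hom.isoOfComponents
    (fun k => (AlternatingMap.domLCongr ℂ ℂ (Fin k) ℂ e.toLinearEquiv).toModuleIso)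
    (by
      rintro k _ rfl
      simp only [ceComplex, CochainComplex.of_d]
      ext : 1
      refine LinearMap.ext fun ω => ?_
      exact (ceDiff_compLinearMap (e.symm : L' →ₗ⁅ℂ⁆ L) k ω))

/-- Isomorphic Lie algebras have isomorphic cohomology. -/
def lieCohomologyIso (e : L ≃ₗ⁅ℂ⁆ L') (k : ℕ) : lieCohomology L k ≅ lieCohomology L' k :=
  HomologicalComplex.homologyMapIso (ceComplexIso e) k

end LieCohomology

namespace LinearFrame

variable {n : ℕ} {Δ : entireFunctions n}

theorem nonempty_lieCohomology_iso (S : LinearFrame Δ) (hΔ : IsReducedEquation Δ) (k : ℕ) :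
    Nonempty (lieCohomology (linearGroupLieAlgebra (stabilizerGroup (divisorSet Δ))) k ≅
      lieCohomology (linearLogFields Δ) k) := by
  rw [S.linearGroupLieAlgebra_eq hΔ]
  exact ⟨lieCohomologyIso (logMatricesEquiv Δ) k⟩

/-- The isotropy group acts simply transitively on the fibres of the orbit map by right
translations. A path in G_D° from the translating element to 1 provides the homotopy to the identity
required by the transfer argument. -/
theorem nonempty_singularCohomology_iso (S : LinearFrame Δ) (hΔ : IsReducedEquation Δ) (k : ℕ) :
    Nonempty (singularCohomology (identityComponent (divisorSet Δ)) k ≅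
      singularCohomology ↥(divisorSet Δ)ᶜ k) := by
  obtain ⟨p, hp⟩ := (isPathConnected_compl_divisor hΔ.ne_zero).nonempty
  have := S.finite_isotropyG hΔ hp
  refine LFD.nonempty_singularCohomology_iso (ι := isotropyG Δ p)
    (p := ⟨groupOrbit hp, continuous_groupOrbit hp⟩) (S.isCoveringMap_groupOrbit hΔ hp)
    (S.surjective_groupOrbit hΔ hp) (fun f => ⟨fun g => g * f.1, continuous_mul_const f.1⟩)
    (fun f g => ?_) (fun g h hgh => ?_) (fun f => ?_) k
  · refine ((groupOrbit_eq_iff hp).2 ?_).symm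
    simp
  · refine ⟨⟨g⁻¹ * h, (groupOrbit_eq_iff hp).1 hgh⟩, mul_inv_cancel_left g h, fun f hf => ?_⟩
    exact Subtype.ext (eq_inv_mul_of_mul_eq hf)
  · obtain ⟨γ⟩ := (S.joined_one hΔ hp f.1).symm
    exact ⟨{ toFun := fun x => x.2 * γ x.1
             continuous_toFun := by fun_prop
             map_zero_left := fun g => by simp
             map_one_left := fun g => by simp }⟩

end LinearFrame

end LFD

end

theorem proposition84 (n : ℕ) (Δ : entireFunctions n)
    (hΔ : IsReducedEquation Δ) (hD : IsLinearFree Δ) :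
    QuasiIso (degZeroInclusion Δ) ∧
    (∃ e : degZeroComplex Δ ≅ ceComplex (linearLogFields Δ),
      ∀ (k : ℕ) (ω : degZeroForms Δ k) (A : Fin k → linearLogFields Δ) (x : Fin n → ℂ),
        x ∉ divisorSet Δ →
        (show linearLogFields Δ [⋀^Fin k]→ₗ[ℂ] ℂ from (e.hom.f k).hom ω) A =
          ω.1 x (fun i => linearField (A i).1 x)) ∧
    (∀ k, Nonempty (logCohomology Δ k ≅ lieCohomology (linearLogFields Δ) k)) ∧
    (SatisfiesGLCT Δ ↔
      ∀ k, Nonempty (singularCohomology (identityComponent (divisorSet Δ)) k ≅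
        lieCohomology (linearGroupLieAlgebra (stabilizerGroup (divisorSet Δ))) k)) := by
  obtain ⟨S⟩ := hD.nonempty_frame
  refine ⟨quasiIso_degZeroInclusion S hΔ, ⟨degZeroIso S hΔ, fun k ω A x hx =>
    degZeroIso_hom_apply S hΔ k ω A hx⟩, nonempty_logCohomology_iso S hΔ, ?_⟩
  -- The equivalence holds in each degree separately: three isomorphisms identify the two sides of
  -- one comparison with the two sides of the other.
  refine forall_congr' fun k => ?_
  obtain ⟨a⟩ := nonempty_logCohomology_iso S hΔ k
  obtain ⟨b⟩ := S.nonempty_lieCohomology_iso hΔ k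
  obtain ⟨c⟩ := S.nonempty_singularCohomology_iso hΔ k
  exact ⟨fun ⟨e⟩ => ⟨c ≪≫ e.symm ≪≫ a ≪≫ b.symm⟩, fun ⟨e⟩ => ⟨a ≪≫ b.symm ≪≫ e.symm ≪≫ c⟩⟩
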